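/- Parameterized problems and W[2]. A parameterized problem is a set $L\subseteq\Sigma^*\times\Sigma^*$ over a fixed finite alphabet $\Sigma$. A problem $L$ is (fixed-parameter) reducible to $L'$ if there are a constant $p$, a function $q:\mathbb N\to\mathbb N$ and an algorithm $A$ that transforms each $(x,y)\in\Sigma^*\times\Sigma^*$ into a pair $(x',y')$, where $y'$ depends on $y$ only, in time $O(q(|y|)\,|x|^p)$ (read as $q(|y|)\,(|x|+1)^p$, so that the empty word $x$ is covered), such that $(x,y)\in L$ if and only if $(x',y')\in L'$. Let $WS(2)$ be the following problem, with parameter $k$: given a formula $\Phi$ in conjunctive normal form and a non-negative integer $k$, does $\Phi$ have a model with exactly $k$ atoms (a model being a set of atoms occurring in $\Phi$ that, when exactly these atoms are true, satisfies $\Phi$)? The class W[2] consists of all parameterized problems that are reducible to $WS(2)$. A problem $L$ is W[2]-complete if $L$ is in W[2] and every problem in W[2] is reducible to $L$. Programs. A propositional logic program $P$ is a finite collection of rules $r=\;p\leftarrow q_1,\dots,q_m,\mathbf{not}(s_1),\dots,\mathbf{not}(s_n)$, with $p,q_i,s_j$ atoms; $At(P)$ is the set of atoms that appear in $P$. The body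 of $r$ is true in a set $M$ of atoms if all $q_i\in M$ and all $s_j\notin M$. A model of $P$ is a set $M\subseteq At(P)$ that contains the head $p$ of each rule whose body is true in $M$. A supported model of $P$ is a model $M\subseteq At(P)$ of the Clark completion of $P$: for each $p\in At(P)$, $p\in M$ if and only if $P$ has a rule with head $p$ whose body is true in $M$. The reduct $P^M$ is obtained from $P$ by removing all rules with some $s_j\in M$ and deleting all negated atoms from the remaining rules; $M$ is a stable model of $P$ if $M$ is the least model of $P^M$ with respect to inclusion. A program is purely negative if $m=0$ in each of its rules. Let $\mathcal N$ be the class of purely negative programs and $\mathcal A$ the class of all programs. For $\mathcal C\in\{\mathcal N,\mathcal A\}$ and $\Delta\in\{\le,=\}$ let $\mathcal{ST}_\Delta(\mathcal C)$ (respectively $\mathcal{SP}_\Delta(\mathcal C)$) be the following problem, with parameter $k$: given a program $P\in\mathcal C$ and a non-negative integer $k$, does $P$ have a stable (respectively supported) model $M$ with $|M|\mathrel{\Delta}k$? Theorem. The eight problems $\mathcal{ST}_\le(\mathcal N)$, $\mathcal{SP}_\le(\mathcal N)$, $\mathcal{ST}_\le(\mathcal A)$, $\mathcal{SP}_\le(\mathcal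 A)$, $\mathcal{ST}_=(\mathcal N)$, $\mathcal{SP}_=(\mathcal N)$, $\mathcal{ST}_=(\mathcal A)$ and $\mathcal{SP}_=(\mathcal A)$ are all W[2]-complete. -/

import Mathlib

namespace LPComplexity

/-! ## Words and parameterized problems -/

/-- The fixed finite alphabet: two bits, two sign markers, and a marker that opens a clause. -/
inductive Sym : Type
  | zero
  | one
  | pos
  | neg
  | clause
  deriving DecidableEq

/-- Words over the fixed alphabet. -/
abbrev Word : Type := List Sym

/-- A parameterized decision problem is a set of pairs (instance, parameter) of words. -/
abbrev ParamProblem : Type := Set (Word × Word)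

/-- The input or output tape of a machine that works on the pair `(x, y)`: the word `x`, a
separator (`none`), and the word `y`. -/
def pairTape (x y : Word) : List (Option Sym) :=
  x.map some ++ none :: y.map some

/-- Fixed-parameter reducibility of `L` to `L'`. There are one algorithm `A` (a Turing machine
with finitely many stacks, `Turing.FinTM2`), a constant `p` and a function `q` such that `A`
transforms every pair `(x, y)` into a pair `(f x y, g y)`, whose parameter depends on `y` only,
in at most `q |y| * (|x| + 1) ^ p` steps, and such that membership is preserved both ways.
The summand `1` only serves the empty word `x`, and the constant in the `O` is part of `q`. -/
def Reduces (L L' : ParamProblem) : Prop :=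
  ∃ (A : Turing.TM2ComputableAux (Option Sym) (Option Sym)) (p : ℕ) (q : ℕ → ℕ)
    (f : Word → Word → Word) (g : Word → Word),
    (∀ x y : Word, Nonempty (Turing.TM2OutputsInTime A.tm
      ((pairTape x y).map A.inputAlphabet.symm)
      (some ((pairTape (f x y) (g y)).map A.outputAlphabet.symm))
      (q y.length * (x.length + 1) ^ p))) ∧
    ∀ x y : Word, (x, y) ∈ L ↔ (f x y, g y) ∈ L'

/-! ## Encodings of atoms and numbers -/

/-- Propositional atoms; the name of an atom is an arbitrary bit string. -/
abbrev Atom : Type := List Bool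

/-- An atom is written as its name. -/
def encodeAtom (a : Atom) : Word :=
  a.map fun b => if b then Sym.one else Sym.zero

/-- The parameter `k` is written in unary. -/
def encodeNat (k : ℕ) : Word :=
  List.replicate k Sym.one

/-! ## Formulas in conjunctive normal form and the class W[2] -/

/-- A literal: an atom or a negated atom. -/
structure Literal where
  positive : Bool
  atom : Atom

/-- A 2-normalized formula: a conjunction of disjunctions of literals. -/
abbrev CNF : Type := List (List Literal)

/-- Truth of a literal in the valuation that makes exactly the atoms in `M` true. -/
def Literal.Holds (l : Literal) (M : Finset Atom) : Prop :=
  if l.positive then l.atom ∈ M else l.atom ∉ M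

/-- The set of atoms that occur in a formula. -/
def CNF.atoms (F : CNF) : Finset Atom :=
  (F.flatMap fun c => c.map Literal.atom).toFinset

/-- `M` is a model of `F`; models are sets of atoms that occur in the formula. -/
def CNF.IsModel (F : CNF) (M : Finset Atom) : Prop :=
  M ⊆ F.atoms ∧ ∀ c ∈ F, ∃ l ∈ c, l.Holds M

/-- A literal is written as its sign followed by the name of its atom. -/
def Literal.encode (l : Literal) : Word :=
  (if l.positive then Sym.pos else Sym.neg) :: encodeAtom l.atom

/-- A formula is written clause by clause, each clause opened by its marker. -/
def CNF.encode (F : CNF) : Word :=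
  F.flatMap fun c => Sym.clause :: c.flatMap Literal.encode

/-- Weighted 2-normalized satisfiability `WS(2)`: given a 2-normalized formula and `k`, does the
formula have a model with exactly `k` atoms? -/
def WS2 : ParamProblem :=
  {w | ∃ (F : CNF) (k : ℕ), w = (F.encode, encodeNat k) ∧
    ∃ M : Finset Atom, F.IsModel M ∧ M.card = k}

/-- The class W[2]: the problems that reduce to weighted 2-normalized satisfiability. -/
def W2 : Set ParamProblem :=
  {L | Reduces L WS2}

/-- `L` is complete for the class `E`: it lies in `E`, and all problems in `E` reduce to it. -/
def IsCompleteFor (L : ParamProblem) (E : Set ParamProblem) : Prop :=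
  L ∈ E ∧ ∀ L' ∈ E, Reduces L' L

/-! ## Logic programs -/

/-- The rule `p ← q₁, …, qₘ, not s₁, …, not sₙ` with head `p`, positive body `q₁, …, qₘ` and
negative body `s₁, …, sₙ`. -/
structure Rule where
  head : Atom
  posBody : List Atom
  negBody : List Atom

/-- A (finite, propositional) logic program, as a list of its rules. -/
abbrev Program : Type := List Rule

/-- The conjunction of the body of `r` is true in `M`. -/
def Rule.BodyHolds (r : Rule) (M : Finset Atom) : Prop :=
  (∀ q ∈ r.posBody, q ∈ M) ∧ ∀ s ∈ r.negBody, s ∉ M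

/-- The set `At(P)` of atoms that appear in `P`. -/
def Program.atoms (P : Program) : Finset Atom :=
  (P.flatMap fun r => r.head :: (r.posBody ++ r.negBody)).toFinset

/-- `M` is a model of `P`: a subset of `At(P)` that satisfies all rules, read as implications. -/
def Program.IsModel (P : Program) (M : Finset Atom) : Prop :=
  M ⊆ P.atoms ∧ ∀ r ∈ P, r.BodyHolds M → r.head ∈ M

/-- `M` is a supported model of `P`: a subset of `At(P)` that is a model of the Clark completion,
which consists, for each atom `p ∈ At(P)`, of the equivalence between `p` and the disjunction of
the bodies of the rules with head `p`. -/
def Program.IsSupportedModel (P : Program) (M : Finset Atom) : Prop :=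
  M ⊆ P.atoms ∧ ∀ p ∈ P.atoms, (p ∈ M ↔ ∃ r ∈ P, r.head = p ∧ r.BodyHolds M)

/-- The Gelfond-Lifschitz reduct of `P` with respect to `M`: remove the rules whose negative body
meets `M`, then remove the negated atoms from the remaining rules. -/
def Program.reduct (P : Program) (M : Finset Atom) : Program :=
  (P.filter fun r => ∀ s ∈ r.negBody, s ∉ M).map fun r => ⟨r.head, r.posBody, []⟩

/-- `M` is a stable model of `P`: it is the least model (with respect to inclusion) of the reduct
of `P` with respect to `M`. -/
def Program.IsStableModel (P : Program) (M : Finset Atom) : Prop :=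
  IsLeast {N : Finset Atom | (P.reduct M).IsModel N} M

/-- The class of all programs. -/
def allPrograms : Set Program := Set.univ

/-- The class of purely negative programs: all rules have an empty positive body. -/
def negativePrograms : Set Program := {P | ∀ r ∈ P, r.posBody = []}

/-- A rule is written as the clause marker, its head, and the literals of its body. -/
def Rule.encode (r : Rule) : Word :=
  Sym.clause :: (encodeAtom r.head
    ++ r.posBody.flatMap (fun q => Sym.pos :: encodeAtom q)
    ++ r.negBody.flatMap (fun s => Sym.neg :: encodeAtom s))

/-- A program is written rule by rule. -/
def Program.encode (P : Program) : Word :=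
  P.flatMap Rule.encode

/-- The problem `D_Δ(C)`, parameterized by `k`: given a program `P` in the class `C` and `k`, does
`P` have a model `M` in the class `D` such that `|M| Δ k`? -/
def modelProblem (D : Program → Finset Atom → Prop) (Δ : ℕ → ℕ → Prop) (C : Set Program) :
    ParamProblem :=
  {w | ∃ (P : Program) (k : ℕ), P ∈ C ∧ w = (P.encode, encodeNat k) ∧
    ∃ M : Finset Atom, D P M ∧ Δ M.card k}

/-- The problems `ST_Δ(C)` on stable models. -/
def ST (Δ : ℕ → ℕ → Prop) (C : Set Program) : ParamProblem :=
  modelProblem Program.IsStableModel Δ C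

/-- The problems `SP_Δ(C)` on supported models. -/
def SP (Δ : ℕ → ℕ → Prop) (C : Set Program) : ParamProblem :=
  modelProblem Program.IsSupportedModel Δ C

end LPComplexity

/-!
Two reductions prove the theorem: each of the eight problems reduces to `WS2`, and `WS2` reduces to
all eight problems by one and the same map. As reducibility is transitive (`Reduces.trans`),
completeness follows.

*Membership.* A set `M` of atoms is a supported model of `P` if and only if it is closed under the
rules of `P` and each `p ∈ M` is the head of a rule whose body is true in `M`; it is stable if and
only if, in addition, these rules can be chosen together with levels such that the positive body
of the rule of `p` lies below the level of `p` (`Program.Justified`). Levels below `M.card`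
suffice. Therefore a formula in conjunctive normal form can guess `M` together with one pair of a
level below `k` and a rule for each `p ∈ M`. Its models have two true atoms for each element of
`M`, which fixes `M.card` through the weight `2 * k`; free padding atoms turn `M.card = k` into
`M.card ≤ k` (`exists_model_justificationFormula_iff`, `modelProblem_mem_W2`).

*Hardness.* A set of `k` atoms among `n` linearly ordered ones is described by its `k + 1` gaps: the
pairs of consecutive elements of the set, with the end points `0` and `n + 1` added. Then an atom
is in the set if it ends a gap, and it is outside if it lies inside a gap. Thus both kinds of
literals become disjunctions of positive statements on gaps, and a clause becomes a rule
`f ← not f, not g₁, …, not gᵣ`, which excludes the models without any of the gaps `gᵢ`. Rules of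
the same form make consecutive gaps fit together, and the rules that derive a gap from the absence
of all other gaps in the same place choose exactly one gap for each place. The program is purely
negative, so that its supported models are stable, and all of them have `k + 1` elements
(`isSupportedModel_gap_iff`, `exists_isSupportedModel_weightProgram_iff`,
`reduces_WS2_modelProblem`).

*Running time.* That the maps are computable by machines in polynomial time is derived from a small
theory of polynomial time functions. Data are binary trees, written as prefix codes on a stack.
Structured programs on four stacks (`Cmd`) are compiled to stack machines with the same number of
steps (`Run.simulate`). The functions that such programs compute in polynomial time (`Poly`) are
closed under composition, pairing, case distinction and folding of lists with polynomially bounded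
intermediate results (`Poly.foldl_of_bound`), from which all list operations in the two reductions
are obtained. Transitivity of reducibility is about arbitrary machines and needs the composition of
two stack machines (`compMachine`).
-/

namespace LPComplexity

open Function Turing StateTransition

instance : Fintype Sym :=
  ⟨{.zero, .one, .pos, .neg, .clause}, by intro x; cases x <;> simp⟩

/-! ### A structured language on four stacks and its compilation to stack machines -/

/-- The four stacks of the programs below. -/
inductive Stk : Type
  | main
  | aux
  | tmp
  | cnt
  deriving DecidableEq

instance : Fintype Stk :=
  ⟨{.main, .aux, .tmp, .cnt}, by intro x; cases x <;> simp⟩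

/-- The symbols on the stacks. -/
abbrev Cell : Type := Option Sym

/-- The contents of the four stacks. -/
abbrev Store : Type := Stk → List Cell

/-- Structured programs on four stacks. `pop k f` pops the top of the stack `k` and goes on with
the program that `f` assigns to the popped symbol (`none` if the stack was empty); `loop k p c`
repeats `c` as long as the top of the stack `k` satisfies `p`. -/
inductive Cmd : Type
  | skip : Cmd
  | push : Stk → Cell → Cmd
  | pop : Stk → (Option Cell → Cmd) → Cmd
  | loop : Stk → (Option Cell → Bool) → Cmd → Cmd
  | seq : Cmd → Cmd → Cmd

/-- `Run c s s' n`: started on the stacks `s`, the program `c` ends with the stacks `s'` after `n`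
steps. -/
inductive Run : Cmd → Store → Store → ℕ → Prop
  | skip (s : Store) : Run .skip s s 1
  | push (k : Stk) (a : Cell) (s : Store) : Run (.push k a) s (update s k (a :: s k)) 1
  | pop {k : Stk} {f : Option Cell → Cmd} {s s' : Store} {n : ℕ}
      (h : Run (f (s k).head?) (update s k (s k).tail) s' n) : Run (.pop k f) s s' (n + 1)
  | loop_done {k : Stk} {p : Option Cell → Bool} {c : Cmd} {s : Store}
      (hp : p (s k).head? = false) : Run (.loop k p c) s s 1
  | loop_step {k : Stk} {p : Option Cell → Bool} {c : Cmd} {s s' s'' : Store} {n m : ℕ}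
      (hp : p (s k).head? = true) (h : Run c s s' n) (h' : Run (.loop k p c) s' s'' m) :
      Run (.loop k p c) s s'' (n + m + 1)
  | seq {c d : Cmd} {s s' s'' : Store} {n m : ℕ} (h : Run c s s' n) (h' : Run d s' s'' m) :
      Run (.seq c d) s s'' (n + m)

/-- The labels of the stack machine that executes a program. -/
inductive Lab : Cmd → Type
  | skip : Lab .skip
  | push {k : Stk} {a : Cell} : Lab (.push k a)
  | popHead {k : Stk} {f : Option Cell → Cmd} : Lab (.pop k f)
  | popArm {k : Stk} {f : Option Cell → Cmd} (o : Option Cell) (l : Lab (f o)) : Lab (.pop k f)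
  | loopHead {k : Stk} {p : Option Cell → Bool} {c : Cmd} : Lab (.loop k p c)
  | loopBody {k : Stk} {p : Option Cell → Bool} {c : Cmd} (l : Lab c) : Lab (.loop k p c)
  | seqLeft {c d : Cmd} (l : Lab c) : Lab (.seq c d)
  | seqRight {c d : Cmd} (l : Lab d) : Lab (.seq c d)

instance labFinite (c : Cmd) : Finite (Lab c) := by
  induction c with
  | skip =>
    exact Finite.of_surjective (fun _ : Unit => Lab.skip) fun l => by cases l; exact ⟨(), rfl⟩
  | push k a =>
    exact Finite.of_surjective (fun _ : Unit => Lab.push) fun l => by cases l; exact ⟨(), rfl⟩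
  | pop k f ih =>
    refine Finite.of_surjective (fun x : Option (Σ o : Option Cell, Lab (f o)) =>
      (x.elim .popHead fun y => .popArm y.1 y.2 : Lab (.pop k f))) fun l => ?_
    cases l with
    | popHead => exact ⟨none, rfl⟩
    | popArm o l => exact ⟨some ⟨o, l⟩, rfl⟩
  | loop k p c ih =>
    refine Finite.of_surjective (fun x : Option (Lab c) =>
      (x.elim .loopHead .loopBody : Lab (.loop k p c))) fun l => ?_
    cases l with
    | loopHead => exact ⟨none, rfl⟩
    | loopBody l => exact ⟨some l, rfl⟩
  | seq c d ih ih' =>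
    refine Finite.of_surjective (fun x : Lab c ⊕ Lab d =>
      (x.elim .seqLeft .seqRight : Lab (.seq c d))) fun l => ?_
    cases l with
    | seqLeft l => exact ⟨.inl l, rfl⟩
    | seqRight l => exact ⟨.inr l, rfl⟩

/-- The label at which the execution of a program starts. -/
def entry : (c : Cmd) → Lab c
  | .skip => .skip
  | .push _ _ => .push
  | .pop _ _ => .popHead
  | .loop _ _ _ => .loopHead
  | .seq c _ => .seqLeft (entry c)

/-- The statements of the stack machine that executes a program, inside a machine with labels `Λ`
in which the labels of the program are embedded by `e`, and in which execution goes on at the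
label `x` after the program. The internal state holds the symbol read last. -/
def stmt {Λ : Type} : {c : Cmd} → (Lab c → Λ) → Λ → Lab c →
    TM2.Stmt (fun _ : Stk => Cell) Λ (Option Cell)
  | .skip, _, x, _ => .goto fun _ => x
  | .push k a, _, x, _ => .push k (fun _ => a) (.goto fun _ => x)
  | .pop k f, e, _, .popHead =>
    .pop k (fun _ o => o) (.goto fun o => e (.popArm o (entry (f o))))
  | .pop _ _, e, x, .popArm o l => stmt (fun l => e (.popArm o l)) x l
  | .loop k p c, e, x, .loopHead =>
    .peek k (fun _ o => o) (.goto fun o => if p o then e (.loopBody (entry c)) else x)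
  | .loop _ _ _, e, _, .loopBody l => stmt (fun l => e (.loopBody l)) (e .loopHead) l
  | .seq _ d, e, _, .seqLeft l => stmt (fun l => e (.seqLeft l)) (e (.seqRight (entry d))) l
  | .seq _ _, e, x, .seqRight l => stmt (fun l => e (.seqRight l)) x l

/-- The stack machine executes a program step by step as prescribed by `Run`. -/
theorem Run.simulate {Λ : Type} {c : Cmd} {s s' : Store} {n : ℕ} (h : Run c s s' n)
    (M : Λ → TM2.Stmt (fun _ : Stk => Cell) Λ (Option Cell)) (e : Lab c → Λ) (x : Λ)
    (hM : ∀ l, M (e l) = stmt e x l) (v : Option Cell) :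
    ∃ v', (flip bind (TM2.step M))^[n] (some ⟨some (e (entry c)), v, s⟩)
      = some ⟨some x, v', s'⟩ := by
  have hstep : ∀ l v s, flip bind (TM2.step M) (some ⟨some l, v, s⟩)
      = some (TM2.stepAux (M l) v s) := fun _ _ _ => rfl
  induction h generalizing v x with
  | skip s => exact ⟨v, by rw [iterate_one, hstep, hM]; simp [stmt, entry]⟩
  | push k a s => exact ⟨v, by rw [iterate_one, hstep, hM]; simp [stmt, entry]⟩
  | @pop k f s s' n h ih =>
    obtain ⟨v', hv⟩ := ih (fun l => e (.popArm _ l)) x (fun l => by rw [hM, stmt]) ((s k).head?)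
    exact ⟨v', by rw [iterate_succ_apply, hstep, hM, ← hv]; simp [stmt, entry]⟩
  | loop_done hp =>
    exact ⟨_, by rw [iterate_one, hstep, hM]; simp [stmt, entry, hp]; rfl⟩
  | @loop_step k p c s s' s'' n m hp h h' ih ih' =>
    obtain ⟨v₁, h₁⟩ := ih (fun l => e (.loopBody l)) (e .loopHead) (fun l => by rw [hM, stmt])
      ((s k).head?)
    obtain ⟨v₂, h₂⟩ := ih' e x hM v₁
    refine ⟨v₂, ?_⟩
    rw [iterate_succ_apply, add_comm n m, iterate_add_apply, ← h₂, entry, ← h₁, hstep, hM]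
    simp [stmt, hp]
  | @seq c d s s' s'' n m h h' ih ih' =>
    obtain ⟨v₁, h₁⟩ := ih (fun l => e (.seqLeft l)) (e (.seqRight (entry d)))
      (fun l => by rw [hM, stmt]) v
    obtain ⟨v₂, h₂⟩ := ih' (fun l => e (.seqRight l)) x (fun l => by rw [hM, stmt]) v₁
    exact ⟨v₂, by rw [add_comm n m, iterate_add_apply, ← h₂, ← h₁, entry]⟩

/-- The stack machine of a program: its input and its output are on the main stack. -/
noncomputable def machine (c : Cmd) : FinTM2 :=
  have := Fintype.ofFinite (Lab c)
  { K := Stk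
    k₀ := .main
    k₁ := .main
    Γ := fun _ => Cell
    Λ := Option (Lab c)
    main := some (entry c)
    σ := Option Cell
    initialState := none
    m := fun l => l.elim (.load (fun _ => none) .halt) (stmt some none) }

/-- The stack contents of a program, given stack by stack. -/
def st (m a t c : List Cell) : Store
  | .main => m
  | .aux => a
  | .tmp => t
  | .cnt => c

theorem Run.outputs {c : Cmd} {w w' : List Cell} {n : ℕ}
    (h : Run c (st w [] [] []) (st w' [] [] []) n) :
    Nonempty (TM2OutputsInTime (machine c) w (some w') (n + 1)) := by
  obtain ⟨v, hv⟩ := h.simulate (machine c).m some none (fun l => rfl) none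
  refine ⟨⟨⟨n + 1, ?_⟩, le_rfl⟩⟩
  have h1 : initList (machine c) w = ⟨some (some (entry c)), none, st w [] [] []⟩ := by
    unfold initList
    congr 1
    funext k
    cases k <;> rfl
  have h2 : haltList (machine c) w' = ⟨none, none, st w' [] [] []⟩ := by
    unfold haltList
    congr 1
    funext k
    cases k <;> rfl
  change (flip bind (TM2.step (machine c).m))^[n + 1] (some (initList (machine c) w))
    = some (haltList (machine c) w')
  rw [h1, h2, iterate_succ_apply']
  erw [hv]
  rfl

/-- A program lengthens a stack by at most one symbol per step. -/
theorem Run.length_le {c : Cmd} {s s' : Store} {n : ℕ} (h : Run c s s' n) (k : Stk) :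
    (s' k).length ≤ (s k).length + n := by
  induction h with
  | skip s => omega
  | push j a s =>
    by_cases hk : k = j
    · subst hk; simp
    · simp [update_of_ne hk]
  | @pop j f s s' n h ih =>
    by_cases hk : k = j
    · subst hk; simp at ih; omega
    · simp [update_of_ne hk] at ih; omega
  | loop_done hp => omega
  | loop_step hp h h' ih ih' => omega
  | seq h h' ih ih' => omega

end LPComplexity

namespace LPComplexity

open Function Turing StateTransition

/-! ### Running programs within a time bound -/

/-- `Runs c s s' n`: started on `s`, the program `c` ends with `s'` after at most `n` steps. -/
def Runs (c : Cmd) (s s' : Store) (n : ℕ) : Prop := ∃ m ≤ n, Run c s s' m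

theorem Runs.mono {c : Cmd} {s s' : Store} {n m : ℕ} (h : Runs c s s' n) (hnm : n ≤ m) :
    Runs c s s' m :=
  let ⟨k, hk, hr⟩ := h
  ⟨k, hk.trans hnm, hr⟩

theorem Runs.skip (s : Store) : Runs .skip s s 1 := ⟨1, le_rfl, .skip s⟩

theorem Runs.push (k : Stk) (a : Cell) (s : Store) :
    Runs (.push k a) s (update s k (a :: s k)) 1 := ⟨1, le_rfl, .push k a s⟩

theorem Runs.pop {k : Stk} {f : Option Cell → Cmd} {s s' : Store} {n : ℕ}
    (h : Runs (f (s k).head?) (update s k (s k).tail) s' n) : Runs (.pop k f) s s' (n + 1) :=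
  let ⟨m, hm, hr⟩ := h
  ⟨m + 1, by omega, .pop hr⟩

theorem Runs.seq {c d : Cmd} {s s' s'' : Store} {n m : ℕ} (h : Runs c s s' n)
    (h' : Runs d s' s'' m) : Runs (.seq c d) s s'' (n + m) :=
  let ⟨i, hi, hr⟩ := h
  let ⟨j, hj, hr'⟩ := h'
  ⟨i + j, by omega, .seq hr hr'⟩

theorem Runs.loop_done {k : Stk} {p : Option Cell → Bool} {c : Cmd} {s : Store}
    (hp : p (s k).head? = false) : Runs (.loop k p c) s s 1 := ⟨1, le_rfl, .loop_done hp⟩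

theorem Runs.loop_step {k : Stk} {p : Option Cell → Bool} {c : Cmd} {s s' s'' : Store} {n m : ℕ}
    (hp : p (s k).head? = true) (h : Runs c s s' n) (h' : Runs (.loop k p c) s' s'' m) :
    Runs (.loop k p c) s s'' (n + m + 1) :=
  let ⟨i, hi, hr⟩ := h
  let ⟨j, hj, hr'⟩ := h'
  ⟨i + j + 1, by omega, .loop_step hp hr hr'⟩

section

variable (m a t c x : List Cell)

@[simp] theorem st_main : st m a t c .main = m := rfl
@[simp] theorem st_aux : st m a t c .aux = a := rfl
@[simp] theorem st_tmp : st m a t c .tmp = t := rfl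
@[simp] theorem st_cnt : st m a t c .cnt = c := rfl

@[simp] theorem update_st_main : update (st m a t c) .main x = st x a t c := by
  funext k; cases k <;> rfl

@[simp] theorem update_st_aux : update (st m a t c) .aux x = st m x t c := by
  funext k; cases k <;> rfl

@[simp] theorem update_st_tmp : update (st m a t c) .tmp x = st m a x c := by
  funext k; cases k <;> rfl

@[simp] theorem update_st_cnt : update (st m a t c) .cnt x = st m a t x := by
  funext k; cases k <;> rfl

end

/-! ### Binary trees on the main stack -/

/-- Binary trees, the universal data type of the programs. -/
inductive BTree : Type
  | leaf : BTree
  | node : BTree → BTree → BTree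

/-- The symbol of a leaf. -/
abbrev cL : Cell := some .zero

/-- The symbol of an inner node. -/
abbrev cN : Cell := some .one

/-- The preorder code of a tree. It is a prefix code, so that a tree can be found on the top of
a stack without a marker for its end. -/
def BTree.word : BTree → List Cell
  | .leaf => [cL]
  | .node l r => cN :: (l.word ++ r.word)

/-- The stacks with the contents of the stack `tmp` (for `true`) or `aux` (for `false`)
singled out as `d`, and the contents of the other one as `o`. -/
def sd (b : Bool) (m d o c : List Cell) : Store := if b then st m o d c else st m d o c

/-- The stack that is singled out by `sd`. -/
def dst (b : Bool) : Stk := if b then .tmp else .aux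

section

variable (b : Bool) (m d o c x : List Cell)

@[simp] theorem sd_main : sd b m d o c .main = m := by cases b <;> rfl
@[simp] theorem sd_dst : sd b m d o c (dst b) = d := by cases b <;> rfl
@[simp] theorem sd_cnt : sd b m d o c .cnt = c := by cases b <;> rfl

@[simp] theorem update_sd_main : update (sd b m d o c) .main x = sd b x d o c := by
  cases b <;> simp [sd]

@[simp] theorem update_sd_dst : update (sd b m d o c) (dst b) x = sd b m x o c := by
  cases b <;> simp [sd, dst]

@[simp] theorem update_sd_cnt : update (sd b m d o c) .cnt x = sd b m d o x := by
  cases b <;> simp [sd]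

end

/-- The body of the loop that moves a tree: the counter holds one symbol for each subtree that
is still to be moved. -/
def moveBody (b : Bool) : Cmd :=
  .pop .main fun o => if o = some cN then .seq (.push (dst b) cN) (.push .cnt cL)
    else .seq (.push (dst b) cL) (.pop .cnt fun _ => .skip)

/-- Moves the topmost tree of the main stack to another stack, in reverse. -/
def moveTree (b : Bool) : Cmd :=
  .seq (.push .cnt cL) (.loop .cnt Option.isSome (moveBody b))

theorem moveLoop_runs (b : Bool) (t : BTree) (m d o c : List Cell) (s' : Store) (n : ℕ)
    (h : Runs (.loop .cnt Option.isSome (moveBody b)) (sd b m (t.word.reverse ++ d) o c) s' n) :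
    Runs (.loop .cnt Option.isSome (moveBody b)) (sd b (t.word ++ m) d o (cL :: c)) s'
      (n + 5 * t.word.length) := by
  induction t generalizing m d c n with
  | leaf =>
    have h1 : Runs (moveBody b) (sd b (BTree.leaf.word ++ m) d o (cL :: c))
        (sd b m (cL :: d) o c) 4 := by
      refine Runs.pop (n := 3) ?_
      simp only [BTree.word, sd_main, List.cons_append, List.nil_append, List.head?_cons,
        List.tail_cons, update_sd_main]
      refine Runs.seq (n := 1) (m := 2) (Runs.push _ _ _) (Runs.pop (n := 1) ?_)
      simpa using Runs.skip _
    have := Runs.loop_step (p := Option.isSome) (k := .cnt) (by simp) h1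
      (by simpa [BTree.word] using h)
    exact this.mono (by simp [BTree.word]; omega)
  | node l r ihl ihr =>
    have h1 : Runs (moveBody b) (sd b ((BTree.node l r).word ++ m) d o (cL :: c))
        (sd b (l.word ++ (r.word ++ m)) (cN :: d) o (cL :: cL :: c)) 3 := by
      refine Runs.pop (n := 2) ?_
      simp only [BTree.word, sd_main, List.cons_append, List.head?_cons,
        List.tail_cons, update_sd_main, ↓reduceIte]
      refine Runs.seq (n := 1) (m := 1) (Runs.push _ _ _) ?_
      simpa using Runs.push .cnt cL (sd b (l.word ++ (r.word ++ m)) (cN :: d) o (cL :: c))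
    have h2 := ihl _ _ _ _ (ihr _ _ _ _ (by simpa [BTree.word] using h))
    have := Runs.loop_step (p := Option.isSome) (k := .cnt) (by simp) h1 h2
    exact this.mono (by simp [BTree.word]; omega)

theorem moveTree_runs (b : Bool) (t : BTree) (m d o : List Cell) :
    Runs (moveTree b) (sd b (t.word ++ m) d o []) (sd b m (t.word.reverse ++ d) o [])
      (5 * t.word.length + 2) := by
  have h := moveLoop_runs b t m d o [] _ 1 (Runs.loop_done (by simp))
  refine (Runs.seq (Runs.push .cnt cL _) ?_).mono (m := _) (n := 1 + (1 + 5 * t.word.length))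
    (by omega)
  simpa using h

/-- Moves the contents of a stack to the main stack, in reverse. -/
def unload (b : Bool) : Cmd :=
  .loop (dst b) Option.isSome (.pop (dst b) fun o => .push .main (o.getD cL))

theorem unload_runs (b : Bool) (w m o : List Cell) :
    Runs (unload b) (sd b m w o []) (sd b (w.reverse ++ m) [] o []) (3 * w.length + 1) := by
  induction w generalizing m with
  | nil => exact Runs.loop_done (by simp)
  | cons x w ih =>
    simp only [List.reverse_cons, List.append_assoc, List.singleton_append]
    refine (Runs.loop_step (s' := sd b (x :: m) w o []) (n := 2) (by simp)
      (Runs.pop (n := 1) ?_) (ih _)).mono (by simp; omega)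
    simpa using Runs.push .main x (sd b m w o [])

/-- Removes the contents of a stack. -/
def clear (b : Bool) : Cmd :=
  .loop (dst b) Option.isSome (.pop (dst b) fun _ => .skip)

theorem clear_runs (b : Bool) (w m o : List Cell) :
    Runs (clear b) (sd b m w o []) (sd b m [] o []) (3 * w.length + 1) := by
  induction w generalizing m with
  | nil => exact Runs.loop_done (by simp)
  | cons x w ih =>
    refine (Runs.loop_step (s' := sd b m w o []) (n := 2) (by simp)
      (Runs.pop (n := 1) ?_) (ih _)).mono (by simp; omega)
    simpa using Runs.skip (sd b m w o [])

/-- Removes the topmost tree of the main stack. -/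
def dropTree : Cmd := .seq (moveTree false) (clear false)

/-- The stacks when only the main stack is in use. -/
abbrev ms (m : List Cell) : Store := st m [] [] []

theorem dropTree_runs (t : BTree) (m : List Cell) :
    Runs dropTree (ms (t.word ++ m)) (ms m) (8 * t.word.length + 3) :=
  ((moveTree_runs false t m [] []).seq (clear_runs false _ _ _)).mono (by simp; omega)

/-- Exchanges the two topmost trees of the main stack. -/
def swapTrees : Cmd :=
  .seq (moveTree false) (.seq (moveTree true) (.seq (unload false) (unload true)))

theorem swapTrees_runs (t u : BTree) (m : List Cell) :
    Runs swapTrees (ms (t.word ++ (u.word ++ m))) (ms (u.word ++ (t.word ++ m)))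
      (8 * t.word.length + 8 * u.word.length + 6) := by
  have h1 := moveTree_runs false t (u.word ++ m) [] []
  have h2 := moveTree_runs true u m [] t.word.reverse
  have h3 := unload_runs false t.word.reverse m u.word.reverse
  have h4 := unload_runs true u.word.reverse (t.word ++ m) []
  simp only [sd, Bool.false_eq_true, ↓reduceIte, List.append_nil, List.reverse_reverse,
    List.length_reverse] at h1 h2 h3 h4
  exact (h1.seq (h2.seq (h3.seq h4))).mono (by omega)

/-- Moves the contents of `aux` to the main stack, in reverse, and a copy to `tmp`. -/
def copyBack : Cmd :=
  .loop .aux Option.isSome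
    (.pop .aux fun o => .seq (.push .main (o.getD cL)) (.push .tmp (o.getD cL)))

theorem copyBack_runs (w m d : List Cell) :
    Runs copyBack (st m w d []) (st (w.reverse ++ m) [] (w.reverse ++ d) [])
      (4 * w.length + 1) := by
  induction w generalizing m d with
  | nil => exact Runs.loop_done (by simp)
  | cons x w ih =>
    simp only [List.reverse_cons, List.append_assoc, List.singleton_append]
    refine (Runs.loop_step (s' := st (x :: m) w (x :: d) []) (n := 3) (by simp)
      (Runs.pop (n := 2) ?_) (ih _ _)).mono (by simp; omega)
    refine Runs.seq (n := 1) (m := 1) (Runs.push _ _ _) ?_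
    simpa using Runs.push .tmp x (st (x :: m) w d [])

/-- Moves the contents of `tmp` to `aux`, in reverse. -/
def tmpToAux : Cmd :=
  .loop .tmp Option.isSome (.pop .tmp fun o => .push .aux (o.getD cL))

theorem tmpToAux_runs (w m d : List Cell) :
    Runs tmpToAux (st m d w []) (st m (w.reverse ++ d) [] []) (3 * w.length + 1) := by
  induction w generalizing d with
  | nil => exact Runs.loop_done (by simp)
  | cons x w ih =>
    simp only [List.reverse_cons, List.append_assoc, List.singleton_append]
    refine (Runs.loop_step (s' := st m (x :: d) w []) (n := 2) (by simp)
      (Runs.pop (n := 1) ?_) (ih _)).mono (by simp; omega)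
    simpa using Runs.push .aux x (st m d w [])

/-- Duplicates the topmost tree of the main stack. -/
def dupTree : Cmd :=
  .seq (moveTree false) (.seq copyBack (.seq tmpToAux (unload false)))

theorem dupTree_runs (t : BTree) (m : List Cell) :
    Runs dupTree (ms (t.word ++ m)) (ms (t.word ++ (t.word ++ m))) (15 * t.word.length + 5) := by
  have h1 := moveTree_runs false t m [] []
  have h2 := copyBack_runs t.word.reverse m []
  have h3 := tmpToAux_runs t.word (t.word ++ m) []
  have h4 := unload_runs false t.word.reverse (t.word ++ m) []
  simp only [sd, Bool.false_eq_true, ↓reduceIte, List.append_nil, List.reverse_reverse,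
    List.length_reverse] at h1 h2 h3 h4
  exact (h1.seq (h2.seq (h3.seq h4))).mono (by omega)

/-- Pushes a fixed word on the main stack. -/
def pushWord : List Cell → Cmd
  | [] => .skip
  | x :: w => .seq (pushWord w) (.push .main x)

theorem pushWord_runs (w m : List Cell) {a t c : List Cell} :
    Runs (pushWord w) (st m a t c) (st (w ++ m) a t c) (w.length + 1) := by
  induction w with
  | nil => exact Runs.skip _
  | cons x w ih =>
    refine (ih.seq (m := 1) (s'' := st (x :: (w ++ m)) a t c) ?_).mono (by simp)
    simpa using Runs.push .main x (st (w ++ m) a t c)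

/-! ### Polynomial bounds -/

/-- `T` is bounded by a polynomial. -/
@[fun_prop]
def PolyBounded (T : ℕ → ℕ) : Prop := ∃ k, ∀ n, T n ≤ (n + 2) ^ k

namespace PolyBounded

variable {S T : ℕ → ℕ}

theorem mono (hT : PolyBounded T) (h : ∀ n, S n ≤ T n) : PolyBounded S :=
  let ⟨k, hk⟩ := hT
  ⟨k, fun n => (h n).trans (hk n)⟩

theorem pow_le_pow {n a b : ℕ} (h : a ≤ b) : (n + 2) ^ a ≤ (n + 2) ^ b :=
  Nat.pow_le_pow_right (by omega) h

@[fun_prop]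
theorem const (c : ℕ) : PolyBounded fun _ => c :=
  ⟨c, fun n => Nat.lt_two_pow_self.le.trans (Nat.pow_le_pow_left (by omega) c)⟩

@[fun_prop]
theorem id : PolyBounded fun n => n := ⟨1, fun n => by simp⟩

@[fun_prop]
theorem add (hS : PolyBounded S) (hT : PolyBounded T) : PolyBounded fun n => S n + T n := by
  obtain ⟨a, ha⟩ := hS
  obtain ⟨b, hb⟩ := hT
  refine ⟨a + b + 1, fun n => ?_⟩
  have h1 : (n + 2) ^ a ≤ (n + 2) ^ (a + b) := pow_le_pow (by omega)
  have h2 : (n + 2) ^ b ≤ (n + 2) ^ (a + b) := pow_le_pow (by omega)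
  calc S n + T n ≤ (n + 2) ^ (a + b) * 2 := by linarith [ha n, hb n]
    _ ≤ (n + 2) ^ (a + b) * (n + 2) := Nat.mul_le_mul_left _ (by omega)

@[fun_prop]
theorem mul (hS : PolyBounded S) (hT : PolyBounded T) : PolyBounded fun n => S n * T n := by
  obtain ⟨a, ha⟩ := hS
  obtain ⟨b, hb⟩ := hT
  exact ⟨a + b, fun n => by rw [pow_add]; exact Nat.mul_le_mul (ha n) (hb n)⟩

@[fun_prop]
theorem pow (hS : PolyBounded S) (k : ℕ) : PolyBounded fun n => S n ^ k := by
  obtain ⟨a, ha⟩ := hS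
  exact ⟨a * k, fun n => by rw [pow_mul]; exact Nat.pow_le_pow_left (ha n) k⟩

@[fun_prop]
theorem comp (hT : PolyBounded T) (hS : PolyBounded S) : PolyBounded fun n => T (S n) := by
  obtain ⟨b, hb⟩ := hT
  exact ((hS.add (const 2)).pow b).mono fun n => hb _

end PolyBounded

end LPComplexity

namespace LPComplexity

open Function Turing StateTransition

/-! ### Functions computable in polynomial time -/

/-- A representation of the elements of a type by binary trees. -/
class TreeCode (α : Type) where
  /-- the tree that represents an element -/
  tree : α → BTree

variable {α β γ δ σ : Type} [TreeCode α] [TreeCode β] [TreeCode γ] [TreeCode δ] [TreeCode σ]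

/-- The code of an element as a word on a stack. -/
def enc (a : α) : List Cell := (TreeCode.tree a).word

/-- The length of the code of an element. -/
def size (a : α) : ℕ := (enc a).length

/-- `f` is computable in polynomial time: some program replaces the code of `a` on the top of
the main stack by the code of `f a`, in time polynomial in the length of the code of `a`. -/
@[fun_prop]
def Poly (f : α → β) : Prop :=
  ∃ (c : Cmd) (T : ℕ → ℕ), PolyBounded T ∧
    ∀ a m, Runs c (ms (enc a ++ m)) (ms (enc (f a) ++ m)) (T (size a))

instance : TreeCode (α × β) := ⟨fun p => .node (TreeCode.tree p.1) (TreeCode.tree p.2)⟩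

instance : TreeCode Bool := ⟨fun b => if b then .node .leaf .leaf else .leaf⟩

instance : TreeCode Unit := ⟨fun _ => .leaf⟩

/-- A list is represented by the pairs of its heads and tails. -/
def listTree : List α → BTree
  | [] => .leaf
  | a :: l => .node (TreeCode.tree a) (listTree l)

instance : TreeCode (List α) := ⟨listTree⟩

/-- Natural numbers are written in unary. -/
instance : TreeCode ℕ := ⟨fun n => TreeCode.tree (List.replicate n ())⟩

theorem enc_pair (p : α × β) : enc p = cN :: (enc p.1 ++ enc p.2) := rfl
theorem enc_nil : enc ([] : List α) = [cL] := rfl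
theorem enc_cons (a : α) (l : List α) : enc (a :: l) = cN :: (enc a ++ enc l) := rfl
theorem enc_true : enc true = [cN, cL, cL] := rfl
theorem enc_false : enc false = [cL] := rfl

theorem size_pair (p : α × β) : size p = size p.1 + size p.2 + 1 := by simp [size, enc_pair]
theorem size_nil : size ([] : List α) = 1 := rfl
theorem size_cons (a : α) (l : List α) : size (a :: l) = size a + size l + 1 := by
  simp [size, enc_cons]

theorem size_bool (b : Bool) : size b ≤ 3 := by cases b <;> simp [size, enc_true, enc_false]

theorem size_nat (n : ℕ) : size n = 2 * n + 1 := by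
  change size (List.replicate n ()) = _
  induction n with
  | zero => rfl
  | succ n ih =>
    have : size () = 1 := rfl
    rw [List.replicate_succ, size_cons, ih, this]
    omega

theorem size_append (l l' : List α) : size (l ++ l') + 1 = size l + size l' := by
  induction l with
  | nil => simp [size_nil]; omega
  | cons a l ih => simp only [List.cons_append, size_cons]; omega

theorem size_reverse (l : List α) : size l.reverse = size l := by
  induction l with
  | nil => rfl
  | cons a l ih =>
    have := size_append l.reverse [a]
    simp only [List.reverse_cons, size_cons, size_nil] at *
    omega

theorem length_lt_size (l : List α) : l.length < size l := by
  induction l with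
  | nil => simp [size_nil]
  | cons a l ih => simp only [List.length_cons, size_cons]; omega

theorem size_le_of_mem {a : α} {l : List α} (h : a ∈ l) : size a ≤ size l := by
  induction l with
  | nil => simp at h
  | cons b l ih =>
    rw [size_cons]
    rcases List.mem_cons.1 h with rfl | h
    · omega
    · have := ih h; omega

namespace Poly

/-- A polynomial time function enlarges codes polynomially. -/
theorem size_bound {f : α → β} (hf : Poly f) :
    ∃ T, PolyBounded T ∧ Monotone T ∧ ∀ a, size (f a) ≤ T (size a) := by
  obtain ⟨c, T, ⟨k, hT⟩, h⟩ := hf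
  -- A program lengthens the main stack by at most one symbol per step.
  refine ⟨fun n => n + (n + 2) ^ k, by fun_prop,
    fun a b h => Nat.add_le_add h (Nat.pow_le_pow_left (by omega) k), fun a => ?_⟩
  obtain ⟨n, hn, hr⟩ := h a []
  have := hr.length_le .main
  simp only [st_main, List.append_nil] at this
  exact this.trans (Nat.add_le_add le_rfl (hn.trans (hT _)))

/-- The time bound may be taken to be monotone. -/
theorem exists_monotone {f : α → β} (hf : Poly f) :
    ∃ (c : Cmd) (T : ℕ → ℕ), PolyBounded T ∧ Monotone T ∧
      ∀ a m, Runs c (ms (enc a ++ m)) (ms (enc (f a) ++ m)) (T (size a)) := by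
  obtain ⟨c, T, ⟨k, hT⟩, h⟩ := hf
  exact ⟨c, fun n => (n + 2) ^ k, by fun_prop,
    fun a b h => Nat.pow_le_pow_left (by omega) k, fun a m => (h a m).mono (hT _)⟩

/-- A function that does not change codes is computed by the empty program. -/
theorem of_enc_eq {f : α → β} (h : ∀ a, enc (f a) = enc a) : Poly f :=
  ⟨.skip, fun _ => 1, by fun_prop, fun a _ => by rw [h]; exact Runs.skip _⟩

@[fun_prop]
theorem id : Poly (fun a : α => a) := of_enc_eq fun _ => rfl

@[fun_prop]
theorem const (b : β) : Poly (fun _ : α => b) :=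
  ⟨.seq dropTree (pushWord (enc b)), fun n => 8 * n + 3 + (size b + 1),
    by fun_prop,
    fun _ _ => (dropTree_runs _ _).seq (pushWord_runs _ _)⟩

@[fun_prop]
theorem comp {g : β → γ} {f : α → β} (hg : Poly g) (hf : Poly f) : Poly (fun a => g (f a)) := by
  obtain ⟨S, hS, -, hSf⟩ := hf.size_bound
  obtain ⟨c, T, hT, h⟩ := hf
  obtain ⟨d, U, hU, hUm, h'⟩ := hg.exists_monotone
  exact ⟨.seq c d, fun n => T n + U (S n), by fun_prop,
    fun a m => ((h a m).seq (h' (f a) m)).mono (Nat.add_le_add le_rfl (hUm (hSf a)))⟩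

@[fun_prop]
theorem pair {f : α → β} {g : α → γ} (hf : Poly f) (hg : Poly g) :
    Poly (fun a => (f a, g a)) := by
  obtain ⟨S, hS, -, hSf⟩ := hf.size_bound
  obtain ⟨S', hS', -, hSg⟩ := hg.size_bound
  obtain ⟨c, T, hT, h⟩ := hf
  obtain ⟨d, U, hU, h'⟩ := hg
  refine ⟨.seq dupTree (.seq c (.seq swapTrees (.seq d (.seq swapTrees (.push .main cN))))),
    fun n => 15 * n + 5 + (T n + (8 * S n + 8 * n + 6 + (U n + (8 * S' n + 8 * S n + 6 + 1)))),
    by fun_prop, fun a m => ?_⟩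
  refine (dupTree_runs _ _).seq ((h a _).seq (.seq (.mono (swapTrees_runs _ _ _) ?_)
    ((h' a _).seq (.seq (.mono (swapTrees_runs _ _ _) ?_) ?_))))
  · have := hSf a
    simp only [size, enc] at *
    omega
  · have h1 := hSf a
    have h2 := hSg a
    simp only [size, enc] at *
    omega
  · simpa [BTree.word, TreeCode.tree, enc] using
      Runs.push .main cN (ms (enc (f a) ++ (enc (g a) ++ m)))

@[fun_prop]
theorem fst : Poly (Prod.fst : α × β → α) := by
  refine ⟨.pop .main fun _ => .seq swapTrees dropTree,
    fun n => 8 * n + 6 + (8 * n + 3) + 1,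
    by fun_prop, fun p m => Runs.pop ?_⟩
  have h1 := swapTrees_runs (TreeCode.tree p.1) (TreeCode.tree p.2) m
  have h2 := dropTree_runs (TreeCode.tree p.2) ((TreeCode.tree p.1).word ++ m)
  have h3 : size p = (TreeCode.tree p.1).word.length + (TreeCode.tree p.2).word.length + 1 :=
    size_pair p
  rw [enc_pair]
  simpa [enc] using (h1.seq h2).mono (m := 8 * size p + 6 + (8 * size p + 3)) (by omega)

@[fun_prop]
theorem snd : Poly (Prod.snd : α × β → β) := by
  refine ⟨.pop .main fun _ => dropTree, fun n => 8 * n + 3 + 1,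
    by fun_prop, fun p m => Runs.pop ?_⟩
  have h2 := dropTree_runs (TreeCode.tree p.1) ((TreeCode.tree p.2).word ++ m)
  have h3 : size p = (TreeCode.tree p.1).word.length + (TreeCode.tree p.2).word.length + 1 :=
    size_pair p
  rw [enc_pair]
  simpa [enc] using h2.mono (m := 8 * size p + 3) (by omega)

@[fun_prop]
theorem cond {c' : α → Bool} {f g : α → β} (hc : Poly c') (hf : Poly f) (hg : Poly g) :
    Poly (fun a => bif c' a then f a else g a) := by
  obtain ⟨q, T, hT, h⟩ := hc
  obtain ⟨d, U, hU, h'⟩ := hf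
  obtain ⟨e, V, hV, h''⟩ := hg
  refine ⟨.seq dupTree (.seq q (.pop .main fun o =>
    if o = some cN then .pop .main fun _ => .pop .main fun _ => d else e)),
    fun n => 15 * n + 5 + (T n + (U n + V n + 3)),
    by fun_prop, fun a m => ?_⟩
  refine (dupTree_runs _ _).seq ((h a _).seq ?_)
  change Runs _ (ms (enc (c' a) ++ (enc a ++ m))) (ms (enc (bif c' a then f a else g a) ++ m)) _
  cases c' a with
  | true =>
    have h1 := (h' a m).mono (m := U (size a) + V (size a)) (by omega)
    refine Runs.pop (n := U (size a) + V (size a) + 2) (Runs.pop (Runs.pop ?_))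
    simpa [enc_true] using h1
  | false =>
    have h1 := (h'' a m).mono (m := U (size a) + V (size a) + 2) (by omega)
    refine Runs.pop ?_
    simpa [enc_false] using h1

/-- The loop that folds a list: the stack holds the rest of the list above the state. -/
theorem foldl_loop_runs {f : β × σ → σ} {c : Cmd} {T : ℕ → ℕ} (hT : Monotone T)
    (h : ∀ (p : (β × List β) × σ) (m : List Cell), Runs c (ms (enc p ++ m))
      (ms (enc (p.1.2, f (p.1.1, p.2)) ++ m)) (T (size p))) (m : List Cell) (B N : ℕ)
    (l : List β) (s : σ) (hl : size l ≤ N)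
    (hB : ∀ l', l' <+: l → size (l'.foldl (fun s b => f (b, s)) s) ≤ B) :
    Runs (.loop .main (fun o => o = some cN)
        (.seq (.push .main cN) (.seq c (.pop .main fun _ => .skip))))
      (ms (enc l ++ (enc s ++ m))) (ms (cL :: (enc (l.foldl (fun s b => f (b, s)) s) ++ m)))
      (l.length * (T (N + B + 1) + 4) + 1) := by
  induction l generalizing s with
  | nil => exact (Runs.loop_done (by simp [enc_nil])).mono (by simp)
  | cons b l ih =>
    have ih' := ih (f (b, s)) (by rw [size_cons] at hl; omega) fun l' hl' => by
      simpa using hB (b :: l') (by simpa using hl')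
    have h1 := h ((b, l), s) m
    have h2 : size ((b, l), s) ≤ N + B + 1 := by
      have := hB [] List.nil_prefix
      rw [size_cons] at hl
      simp only [size_pair, List.foldl_nil] at *
      omega
    have h3 : Runs (.pop .main fun _ => .skip) (ms (enc (l, f (b, s)) ++ m))
        (ms (enc l ++ (enc (f (b, s)) ++ m))) 2 := by
      refine Runs.pop (n := 1) ?_
      simpa [enc_pair] using Runs.skip _
    refine (Runs.loop_step (by simp [enc_cons]) (.seq (Runs.push _ _ _) (.seq (m := 2) ?_ h3))
      ih').mono (n := 1 + (T (N + B + 1) + 2) + (l.length * (T (N + B + 1) + 4) + 1) + 1) ?_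
    · refine cast ?_ (h1.mono (hT h2))
      simp [enc_pair, enc_cons]
    · rw [List.length_cons, Nat.succ_mul]
      omega

/-- Folding a list is computable in polynomial time if one step is, and if the intermediate
results have polynomial length. -/
theorem foldl_of_bound {f : β × σ → σ} {l : α → List β} {s : α → σ} (hf : Poly f) (hl : Poly l)
    (hs : Poly s) {B : ℕ → ℕ} (hB : PolyBounded B)
    (hfB : ∀ a l', l' <+: l a → size (l'.foldl (fun s b => f (b, s)) (s a)) ≤ B (size a)) :
    Poly (fun a => (l a).foldl (fun s b => f (b, s)) (s a)) := by
  have hstep : Poly (fun p : (β × List β) × σ => (p.1.2, f (p.1.1, p.2))) := by fun_prop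
  obtain ⟨S, hS, -, hSl⟩ := hl.size_bound
  obtain ⟨d, U, hU, h'⟩ := hl.pair hs
  obtain ⟨c, T, hT, hTm, h⟩ := hstep.exists_monotone
  refine ⟨.seq d (.pop .main fun _ => .seq (.loop .main (fun o => o = some cN)
    (.seq (.push .main cN) (.seq c (.pop .main fun _ => .skip)))) (.pop .main fun _ => .skip)),
    fun n => U n + (S n * (T (S n + B n + 1) + 4) + 1 + 2 + 1),
    by fun_prop, fun a m => (h' a m).seq (Runs.pop ?_)⟩
  have h1 := foldl_loop_runs hTm h m (B (size a)) (S (size a)) (l a) (s a) (hSl a) (hfB a)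
  have h2 : Runs (.pop .main fun _ => .skip)
      (ms (cL :: (enc ((l a).foldl (fun s b => f (b, s)) (s a)) ++ m)))
      (ms (enc ((l a).foldl (fun s b => f (b, s)) (s a)) ++ m)) 2 := by
    refine Runs.pop (n := 1) ?_
    simpa using Runs.skip _
  have h3 := h1.seq h2
  rw [enc_pair]
  simp only [st_main, List.cons_append, List.append_assoc, List.tail_cons,
    update_st_main]
  refine h3.mono (Nat.add_le_add (Nat.add_le_add (Nat.mul_le_mul_right _ ?_) le_rfl) le_rfl)
  exact (length_lt_size _).le.trans (hSl a)

end Poly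
end LPComplexity

namespace LPComplexity

open Function

variable {α β γ δ σ : Type} [TreeCode α] [TreeCode β] [TreeCode γ] [TreeCode δ] [TreeCode σ]

/-! ### Polynomial time operations on lists and numbers -/

namespace Poly

@[fun_prop]
theorem not {c : α → Bool} (hc : Poly c) : Poly (fun a => !c a) := by
  have : Poly (fun a => bif c a then false else true) := by fun_prop
  convert this using 2 with a
  cases c a <;> rfl

@[fun_prop]
theorem and {c d : α → Bool} (hc : Poly c) (hd : Poly d) : Poly (fun a => c a && d a) := by
  have : Poly (fun a => bif c a then d a else false) := by fun_prop
  convert this using 2 with a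
  cases c a <;> rfl

@[fun_prop]
theorem or {c d : α → Bool} (hc : Poly c) (hd : Poly d) : Poly (fun a => c a || d a) := by
  have : Poly (fun a => bif c a then true else d a) := by fun_prop
  convert this using 2 with a
  cases c a <;> rfl

@[fun_prop]
theorem cons {f : α → β} {g : α → List β} (hf : Poly f) (hg : Poly g) :
    Poly (fun a => f a :: g a) := by
  have : Poly (fun p : β × List β => p.1 :: p.2) := of_enc_eq fun _ => rfl
  exact this.comp (hf.pair hg)

@[fun_prop]
theorem tail {f : α → List β} (hf : Poly f) : Poly (fun a => (f a).tail) := by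
  suffices Poly (List.tail : List β → List β) from this.comp hf
  refine ⟨.pop .main fun o => if o = some cN then dropTree else .push .main cL,
    fun n => 8 * n + 4, by fun_prop, fun l m => Runs.pop ?_⟩
  cases l with
  | nil => simpa [enc_nil] using (Runs.push .main cL (ms m)).mono (by omega)
  | cons b l =>
    have := (dropTree_runs (TreeCode.tree b) (enc l ++ m)).mono (m := 8 * size (b :: l) + 3) (by
      rw [size_cons, size, enc]; omega)
    rw [enc_cons]
    simpa [enc] using this

@[fun_prop]
theorem headD {f : α → List β} (hf : Poly f) (d : β) : Poly (fun a => (f a).headD d) := by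
  suffices Poly (fun l : List β => l.headD d) from this.comp hf
  refine ⟨.pop .main fun o => if o = some cN then .seq swapTrees dropTree else pushWord (enc d),
    fun n => (8 * n + 6) + (8 * n + 3) + size d + 1 + 1, by fun_prop, fun l m => Runs.pop ?_⟩
  cases l with
  | nil => simpa [enc_nil] using (pushWord_runs (enc d) m).mono (by simp only [size]; omega)
  | cons b l =>
    have h1 := swapTrees_runs (TreeCode.tree b) (TreeCode.tree l) m
    have h2 := dropTree_runs (TreeCode.tree l) ((TreeCode.tree b).word ++ m)
    have := (h1.seq h2).mono (m := (8 * size (b :: l) + 6) + (8 * size (b :: l) + 3) + size d + 1)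
      (by have := size_cons b l; simp only [size, enc] at *; omega)
    rw [enc_cons]
    simpa [enc] using this

@[fun_prop]
theorem isEmpty {f : α → List β} (hf : Poly f) : Poly (fun a => (f a).isEmpty) := by
  have h : Poly (fun a => (f a).foldl (fun s b => (fun _ : β × Bool => false) (b, s)) true) :=
    foldl_of_bound (f := fun _ : β × Bool => false) (s := fun _ => true) (by fun_prop) hf
      (by fun_prop) (PolyBounded.const 3) fun _ _ _ => size_bool _
  convert h using 2 with a
  cases f a with
  | nil => rfl
  | cons b l =>
    change false = l.foldl (fun _ _ => false) false
    induction l with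
    | nil => rfl
    | cons c l ih => exact ih

/-- Folding a list from the left with a context. -/
theorem foldl {f : α → σ → β → σ} {l : α → List β} {s : α → σ}
    (hf : Poly fun p : α × σ × β => f p.1 p.2.1 p.2.2) (hl : Poly l) (hs : Poly s)
    (hB : ∃ B, PolyBounded B ∧ ∀ a l', l' <+: l a → size (l'.foldl (f a) (s a)) ≤ B (size a)) :
    Poly (fun a => (l a).foldl (f a) (s a)) := by
  obtain ⟨B, hB, hfB⟩ := hB
  have key : ∀ a (s : σ) (l : List β),
      l.foldl (fun t b => (fun q : β × α × σ => (q.2.1, f q.2.1 q.2.2 q.1)) (b, t)) (a, s)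
        = (a, l.foldl (f a) s) := by
    intro a s l
    induction l generalizing s with
    | nil => rfl
    | cons b l ih => exact ih _
  have h1 : Poly (fun q : β × α × σ => (q.2.1, f q.2.1 q.2.2 q.1)) := by
    have : Poly (fun q : β × α × σ => f q.2.1 q.2.2 q.1) :=
      hf.comp (f := fun q : β × α × σ => (q.2.1, q.2.2, q.1)) (by fun_prop)
    fun_prop
  have h2 := foldl_of_bound (B := fun n => n + B n + 1) h1 hl (Poly.id.pair hs) (by fun_prop)
    fun a l' hl' => by
      rw [key, size_pair]
      have := hfB a l' hl'
      dsimp only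
      omega
  have h3 := snd.comp h2
  simpa only [key] using h3

@[fun_prop]
theorem reverse {f : α → List β} (hf : Poly f) : Poly (fun a => (f a).reverse) := by
  suffices Poly (List.reverse : List β → List β) from this.comp hf
  have key : ∀ l s : List β, l.foldl (fun s b => b :: s) s = l.reverse ++ s := by
    intro l
    induction l with
    | nil => intro s; rfl
    | cons b l ih => intro s; simp [ih]
  have := foldl (α := List β) (f := fun _ s b => b :: s) (l := fun l => l) (s := fun _ => [])
    (by fun_prop) (by fun_prop) (by fun_prop) ⟨fun n => n, by fun_prop, fun l l' h => by
      obtain ⟨t, rfl⟩ := h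
      rw [key, List.append_nil, size_reverse]
      have := size_append l' t
      have := length_lt_size t
      dsimp only
      omega⟩
  simpa [key] using this

/-- Folding a list from the right with a context. -/
theorem foldr {f : α → β → σ → σ} {l : α → List β} {s : α → σ}
    (hf : Poly fun p : α × β × σ => f p.1 p.2.1 p.2.2) (hl : Poly l) (hs : Poly s)
    (hB : ∃ B, PolyBounded B ∧ ∀ a l', l' <:+ l a → size (l'.foldr (f a) (s a)) ≤ B (size a)) :
    Poly (fun a => (l a).foldr (f a) (s a)) := by
  obtain ⟨B, hB, hfB⟩ := hB
  have h1 : Poly fun p : α × σ × β => f p.1 p.2.2 p.2.1 :=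
    hf.comp (f := fun p : α × σ × β => (p.1, p.2.2, p.2.1)) (by fun_prop)
  have := foldl (f := fun a t b => f a b t) (l := fun a => (l a).reverse) h1 (by fun_prop) hs
    ⟨B, hB, fun a l' h => by
      have h2 := hfB a l'.reverse (by rwa [← List.reverse_prefix, List.reverse_reverse])
      simpa [List.foldr_reverse] using h2⟩
  simpa [List.foldl_reverse] using this

@[fun_prop]
theorem append {f g : α → List β} (hf : Poly f) (hg : Poly g) : Poly (fun a => f a ++ g a) := by
  suffices Poly (fun p : List β × List β => p.1 ++ p.2) from this.comp (hf.pair hg)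
  have := foldr (α := List β × List β) (f := fun _ b s => b :: s) (l := fun p => p.1)
    (s := fun p => p.2) (by fun_prop) (by fun_prop) (by fun_prop)
    ⟨fun n => n, by fun_prop, fun p l' h => by
      obtain ⟨t, ht⟩ := h
      have h1 := size_append l' p.2
      have h2 := size_append t l'
      have h3 := length_lt_size t
      rw [ht] at h2
      simp only [size_pair] at *
      simp
      omega⟩
  simpa using this

theorem size_flatMap_le {β γ : Type} [TreeCode γ] (l : List β) (g : β → List γ) (N : ℕ)
    (h : ∀ b ∈ l, size (g b) ≤ N) :
    size (l.flatMap g) ≤ l.length * N + 1 := by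
  induction l with
  | nil => simp [size_nil]
  | cons b l ih =>
    have h1 := size_append (g b) (l.flatMap g)
    have h2 := ih fun c hc => h c (List.mem_cons_of_mem _ hc)
    have h3 := h b List.mem_cons_self
    rw [List.flatMap_cons, List.length_cons, Nat.succ_mul]
    omega

@[fun_prop]
theorem flatMap {l : α → List β} {g : α → β → List γ} (hl : Poly l)
    (hg : Poly (fun p : α × β => g p.1 p.2)) : Poly (fun a => (l a).flatMap (g a)) := by
  obtain ⟨S, hS, -, hSl⟩ := hl.size_bound
  obtain ⟨T, hT, hTm, hTg⟩ := hg.size_bound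
  have key : ∀ a (l : List β), l.foldr (fun b s => g a b ++ s) [] = l.flatMap (g a) := by
    intro a l
    induction l with
    | nil => rfl
    | cons b l ih => simp [ih]
  have h1 : Poly fun p : α × β × List γ => g p.1 p.2.1 ++ p.2.2 := by
    have := hg.comp (f := fun p : α × β × List γ => (p.1, p.2.1)) (by fun_prop)
    fun_prop
  have := foldr (f := fun a b s => g a b ++ s) (s := fun _ => []) h1 hl (by fun_prop)
    ⟨fun n => S n * T (n + S n + 1) + 1, by fun_prop, fun a l' h => by
      rw [key]
      refine (size_flatMap_le l' (g a) (T (size a + S (size a) + 1)) fun b hb => ?_).trans ?_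
      · refine (hTg (a, b)).trans (hTm ?_)
        have := size_le_of_mem (h.subset hb)
        have := hSl a
        simp only [size_pair]
        omega
      · have := h.length_le
        have := length_lt_size (l a)
        have := hSl a
        exact Nat.add_le_add_right (Nat.mul_le_mul_right _ (by omega)) 1⟩
  simpa only [key] using this

@[fun_prop]
theorem map {l : α → List β} {g : α → β → γ} (hl : Poly l)
    (hg : Poly (fun p : α × β => g p.1 p.2)) : Poly (fun a => (l a).map (g a)) := by
  have : Poly (fun a => (l a).flatMap (fun b => [g a b])) := by fun_prop
  simpa only [List.map_eq_flatMap] using this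

@[fun_prop]
theorem filter {l : α → List β} {g : α → β → Bool} (hl : Poly l)
    (hg : Poly (fun p : α × β => g p.1 p.2)) : Poly (fun a => (l a).filter (g a)) := by
  have : Poly (fun a => (l a).flatMap (fun b => bif g a b then [b] else [])) := by fun_prop
  convert this using 2 with a
  induction l a with
  | nil => rfl
  | cons b l ih => cases h : g a b <;> simp [h, ih]

@[fun_prop]
theorem any {l : α → List β} {g : α → β → Bool} (hl : Poly l)
    (hg : Poly (fun p : α × β => g p.1 p.2)) : Poly (fun a => (l a).any (g a)) := by
  have : Poly (fun a => !((l a).filter (g a)).isEmpty) := by fun_prop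
  convert this using 2 with a
  induction l a with
  | nil => rfl
  | cons b l ih => cases h : g a b <;> simp [h, ih]

@[fun_prop]
theorem all {l : α → List β} {g : α → β → Bool} (hl : Poly l)
    (hg : Poly (fun p : α × β => g p.1 p.2)) : Poly (fun a => (l a).all (g a)) := by
  have : Poly (fun a => !((l a).any (fun b => !g a b))) := by fun_prop
  simpa [List.any_eq_not_all_not] using this

/-- The length is found by forgetting the entries, as lists of units and numbers have the same
codes. -/
@[fun_prop]
theorem length {l : α → List β} (hl : Poly l) : Poly (fun a => (l a).length) := by
  have h : Poly (fun l : List Unit => l.length) := of_enc_eq fun l => by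
    change enc (List.replicate l.length ()) = _
    rw [← List.eq_replicate_length.2 fun _ _ => rfl]
  have := h.comp (f := fun a => (l a).map fun _ => ()) (by fun_prop)
  simpa using this

@[fun_prop]
theorem replicate {n : α → ℕ} {f : α → β} (hn : Poly n) (hf : Poly f) :
    Poly (fun a => List.replicate (n a) (f a)) := by
  have h : Poly (fun n : ℕ => List.replicate n ()) := of_enc_eq fun n => rfl
  have := h.comp hn
  have h2 : Poly (fun a => (List.replicate (n a) ()).map fun _ => f a) := by fun_prop
  simpa using h2

@[fun_prop]
theorem add {m n : α → ℕ} (hm : Poly m) (hn : Poly n) : Poly (fun a => m a + n a) := by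
  have : Poly (fun a => (List.replicate (m a) () ++ List.replicate (n a) ()).length) := by
    fun_prop
  simpa using this

@[fun_prop]
theorem range {n : α → ℕ} (hn : Poly n) : Poly (fun a => List.range (n a)) := by
  suffices Poly List.range from this.comp hn
  have key : ∀ l : List Unit, l.foldl (fun s _ => s ++ [s.length]) [] = List.range l.length := by
    intro l
    induction l using List.reverseRecOn with
    | nil => rfl
    | append_singleton l b ih => simp [ih, List.range_succ]
  have hsz : ∀ n, size (List.range n) ≤ n * (2 * n + 2) + 1 := by
    intro n
    have := size_flatMap_le (List.range n) (fun i => [i]) (2 * n + 2) fun i hi => by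
      rw [size_cons, size_nil, size_nat]
      have := List.mem_range.1 hi
      omega
    simpa using this
  have := foldl (α := ℕ) (f := fun _ s (_ : Unit) => s ++ [s.length])
    (l := fun n => List.replicate n ()) (s := fun _ => []) (by fun_prop) (by fun_prop)
    (by fun_prop) ⟨fun n => n * (2 * n + 2) + 1, by fun_prop, fun n l' h => by
      rw [key]
      have h1 := h.length_le
      rw [List.length_replicate] at h1
      have h2 : n ≤ size n := by rw [size_nat]; omega
      refine (hsz _).trans ?_
      dsimp only
      gcongr <;> omega⟩
  simpa [key] using this

@[fun_prop]
theorem lt {m n : α → ℕ} (hm : Poly m) (hn : Poly n) : Poly (fun a => decide (m a < n a)) := by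
  suffices Poly (fun p : ℕ × ℕ => decide (p.1 < p.2)) from this.comp (hm.pair hn)
  have key : ∀ (l s : List Unit), l.foldl (fun s _ => s.tail) s = s.drop l.length := by
    intro l
    induction l with
    | nil => simp
    | cons b l ih => intro s; simp [ih]
  have := foldl (α := ℕ × ℕ) (f := fun _ s (_ : Unit) => s.tail)
    (l := fun p => List.replicate p.1 ()) (s := fun p => List.replicate p.2 ()) (by fun_prop)
    (by fun_prop) (by fun_prop) ⟨fun n => n, by fun_prop, fun p l' h => by
      rw [key, List.drop_replicate, size_pair]
      change size (p.2 - l'.length) ≤ _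
      simp only [size_nat]
      omega⟩
  simp only [key] at this
  have h2 := this.isEmpty.not
  convert h2 using 2 with p
  rw [Bool.eq_iff_iff]
  simp [List.drop_replicate, Nat.sub_eq_zero_iff_le]

/-- Equality of elements of the type `α` is decidable in polynomial time. -/
def DecEq (α : Type) [TreeCode α] [DecidableEq α] : Prop :=
  Poly (fun p : α × α => decide (p.1 = p.2))

theorem DecEq.decide_eq [DecidableEq β] (h : DecEq β) {f g : α → β} (hf : Poly f) (hg : Poly g) :
    Poly (fun a => decide (f a = g a)) :=
  Poly.comp (g := fun p : β × β => decide (p.1 = p.2)) h (hf.pair hg)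

theorem decEq_bool : DecEq Bool := by
  have : Poly (fun p : Bool × Bool => (p.1 && p.2) || (!p.1 && !p.2)) := by fun_prop
  unfold DecEq
  convert this using 2 with p
  rcases p with ⟨_ | _, _ | _⟩ <;> rfl

theorem decEq_nat : DecEq ℕ := by
  have : Poly (fun p : ℕ × ℕ => !decide (p.1 < p.2) && !decide (p.2 < p.1)) := by fun_prop
  unfold DecEq
  convert this using 2 with p
  rw [Bool.eq_iff_iff]
  simp
  omega

theorem decEq_list [DecidableEq α] (h : DecEq α) : DecEq (List α) := by
  rcases isEmpty_or_nonempty α with hα | ⟨⟨d⟩⟩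
  · have : Poly (fun _ : List α × List α => true) := by fun_prop
    unfold DecEq
    convert this using 2 with p
    simpa using Subsingleton.elim p.1 p.2
  let f : Bool × List α → α → Bool × List α := fun s b =>
    (s.1 && (!s.2.isEmpty && decide (s.2.headD d = b)), s.2.tail)
  have key : ∀ (l : List α) (s : Bool × List α),
      ((l.foldl f s).1 && (l.foldl f s).2.isEmpty) = (s.1 && decide (l = s.2)) := by
    intro l
    induction l with
    | nil => rintro ⟨_ | _, _ | _⟩ <;> simp
    | cons b l ih =>
      rintro ⟨c, _ | ⟨e, s⟩⟩
      · rw [List.foldl_cons, ih]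
        simp [f]
      · rw [List.foldl_cons, ih]
        change (c && (true && decide (e = b)) && decide (l = s)) = _
        rw [Bool.eq_iff_iff]
        simp [and_assoc, eq_comm (a := b)]
  have hsz : ∀ (l : List α) (s : Bool × List α), size (l.foldl f s) ≤ 3 + size s.2 + 1 := by
    intro l
    induction l with
    | nil =>
      intro s
      have := size_bool s.1
      rw [List.foldl_nil, size_pair]
      omega
    | cons b l ih =>
      rintro ⟨c, _ | ⟨e, s⟩⟩
      · exact ih _
      · refine (ih _).trans ?_
        simp only [f, List.tail_cons, size_cons]
        omega
  have hf : Poly (fun p : (List α × List α) × (Bool × List α) × α => f p.2.1 p.2.2) := by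
    have := h.decide_eq (f := fun p : (List α × List α) × (Bool × List α) × α => p.2.1.2.headD d)
      (g := fun p => p.2.2) (by fun_prop) (by fun_prop)
    simp only [f]
    fun_prop
  have h1 := foldl (f := fun _ : List α × List α => f) (l := fun p => p.1)
    (s := fun p => (true, p.2)) hf (by fun_prop) (by fun_prop)
    ⟨fun n => 3 + n + 1, by fun_prop, fun p l' _ => (hsz l' _).trans (by
      simp only [size_pair]
      omega)⟩
  have h2 : Poly (fun p : List α × List α =>
      (p.1.foldl f (true, p.2)).1 && (p.1.foldl f (true, p.2)).2.isEmpty) := by fun_prop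
  unfold DecEq
  simpa [key] using h2

end Poly
end LPComplexity

namespace LPComplexity

open Function Turing

variable {α β γ δ σ : Type} [TreeCode α] [TreeCode β] [TreeCode γ] [TreeCode δ] [TreeCode σ]

/-! ### From tapes to lists and back -/

/-- The stack symbols in a fixed order. -/
def allCells : List Cell :=
  [none, some .zero, some .one, some .pos, some .neg, some .clause]

/-- The number of a stack symbol. -/
def cellIdx : Cell → ℕ
  | none => 0
  | some .zero => 1
  | some .one => 2
  | some .pos => 3
  | some .neg => 4
  | some .clause => 5

theorem allCells_getElem? (c : Cell) : allCells[cellIdx c]? = some c := by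
  rcases c with _ | _ | _ | _ | _ | _ <;> rfl

/-- Symbols are represented by their numbers. -/
instance : TreeCode Cell := ⟨fun c => TreeCode.tree (cellIdx c)⟩

instance : TreeCode Sym := ⟨fun s => TreeCode.tree (some s : Cell)⟩

theorem size_cell (c : Cell) : size c ≤ 11 := by
  change size (cellIdx c) ≤ _
  rw [size_nat]
  rcases c with _ | _ | _ | _ | _ | _ <;> simp [cellIdx]

namespace Poly

/-- Functions on the finite set of stack symbols are computed by case distinction. -/
theorem of_cell (f : Cell → β) : Poly f := by
  have h : Poly cellIdx := of_enc_eq fun _ => rfl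
  have hc : ∀ n : ℕ, Poly (fun c => decide (cellIdx c = n)) := fun n =>
    decEq_nat.decide_eq h (by fun_prop)
  have h0 := hc 0
  have h1 := hc 1
  have h2 := hc 2
  have h3 := hc 3
  have h4 := hc 4
  have : Poly (fun c : Cell => bif decide (cellIdx c = 0) then f none else
    bif decide (cellIdx c = 1) then f (some .zero) else
    bif decide (cellIdx c = 2) then f (some .one) else
    bif decide (cellIdx c = 3) then f (some .pos) else
    bif decide (cellIdx c = 4) then f (some .neg) else f (some .clause)) := by fun_prop
  convert this using 2 with c
  rcases c with _ | _ | _ | _ | _ | _ <;> rfl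

theorem decEq_sym : DecEq Sym := by
  have h : Poly (fun s : Sym => cellIdx (some s)) := of_enc_eq fun _ => rfl
  have := decEq_nat.decide_eq (h.comp (f := fun p : Sym × Sym => p.1) (by fun_prop))
    (h.comp (f := fun p : Sym × Sym => p.2) (by fun_prop))
  unfold DecEq
  convert this using 2 with p
  rcases p with ⟨_ | _ | _ | _ | _, _ | _ | _ | _ | _⟩ <;> rfl

end Poly

/-- Moves the contents of the main stack to `tmp`, in reverse. -/
def mainToTmp : Cmd :=
  .loop .main Option.isSome (.pop .main fun o => .push .tmp (o.getD cL))

theorem mainToTmp_runs (w d : List Cell) :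
    Runs mainToTmp (st w [] d []) (st [] [] (w.reverse ++ d) []) (3 * w.length + 1) := by
  induction w generalizing d with
  | nil => exact Runs.loop_done (by simp)
  | cons x w ih =>
    simp only [List.reverse_cons, List.append_assoc, List.singleton_append]
    refine (Runs.loop_step (s' := st w [] (x :: d) []) (n := 2) (by simp)
      (Runs.pop (n := 1) ?_) (ih _)).mono (by simp; omega)
    simpa using Runs.push .tmp x (st w [] d [])

/-- Puts the code of the list of the symbols on `tmp` on the main stack. -/
def encodeTmp : Cmd :=
  .loop .tmp Option.isSome (.pop .tmp fun o => pushWord (cN :: enc (o.getD cL)))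

theorem encodeTmp_runs (w l : List Cell) :
    Runs encodeTmp (st (enc l) [] w []) (st (enc (w.reverse ++ l)) [] [] [])
      (15 * w.length + 1) := by
  induction w generalizing l with
  | nil => exact Runs.loop_done (by simp)
  | cons x w ih =>
    simp only [List.reverse_cons, List.append_assoc, List.singleton_append]
    refine (Runs.loop_step (s' := st (enc (x :: l)) [] w []) (n := 14) (by simp)
      (Runs.pop (n := 13) ?_) (ih _)).mono (by simp; omega)
    have h1 := pushWord_runs (cN :: enc x) (enc l) (a := []) (t := w) (c := [])
    have h2 : (cN :: enc x).length + 1 ≤ 13 := by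
      have := size_cell x
      rw [size] at this
      simp only [List.length_cons]
      omega
    simpa [enc_cons] using h1.mono h2

/-- Replaces a word by the code of the list of its symbols. -/
def readTape : Cmd := .seq mainToTmp (.seq (.push .main cL) encodeTmp)

theorem readTape_runs (w : List Cell) :
    Runs readTape (ms w) (ms (enc w)) (18 * w.length + 3) := by
  have h1 := mainToTmp_runs w []
  have h2 := Runs.push .main cL (st [] [] (w.reverse ++ []) [])
  have h3 := encodeTmp_runs w.reverse []
  simp only [update_st_main, st_main, List.append_nil, List.reverse_reverse, List.length_reverse]
    at h1 h2 h3
  exact (h1.seq (h2.seq h3)).mono (by omega)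

/-- Moves the symbol whose code is on the top of the main stack to `tmp`, given the list of the
symbols in the order of their numbers. -/
def decodeCell : List Cell → Cmd
  | [] => .skip
  | x :: l => .pop .main fun o =>
    if o = some cN then .pop .main fun _ => decodeCell l else .push .tmp x

theorem decodeCell_runs {l : List Cell} {i : ℕ} {x : Cell} (h : l[i]? = some x)
    (m d : List Cell) :
    Runs (decodeCell l) (st (enc i ++ m) [] d []) (st m [] (x :: d) []) (2 * i + 2) := by
  induction l generalizing i with
  | nil => simp at h
  | cons y l ih =>
    cases i with
    | zero =>
      obtain rfl : y = x := by simpa using h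
      have h0 : enc 0 = [cL] := rfl
      refine Runs.pop (n := 1) ?_
      simpa [h0] using Runs.push .tmp y (st m [] d [])
    | succ i =>
      have h0 : enc (i + 1) = cN :: cL :: enc i := rfl
      refine Runs.pop (n := 2 * i + 3) ?_
      simp only [st_main, h0, List.cons_append, List.head?_cons, List.tail_cons, update_st_main,
        ↓reduceIte]
      refine Runs.pop (n := 2 * i + 2) ?_
      simpa using ih (by simpa using h)

/-- Decodes a list of symbols on the main stack to `tmp`, in reverse. -/
def decodeMain : Cmd :=
  .loop .main (fun o => o = some cN) (.pop .main fun _ => decodeCell allCells)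

theorem decodeMain_runs (l d : List Cell) :
    Runs decodeMain (st (enc l) [] d []) (st [cL] [] (l.reverse ++ d) [])
      (14 * l.length + 1) := by
  induction l generalizing d with
  | nil => exact Runs.loop_done (by simp [enc_nil])
  | cons x l ih =>
    simp only [List.reverse_cons, List.append_assoc, List.singleton_append]
    refine (Runs.loop_step (s' := st (enc l) [] (x :: d) []) (n := 13) (by simp [enc_cons])
      (Runs.pop (n := 12) ?_) (ih _)).mono (by simp; omega)
    have h1 := decodeCell_runs (allCells_getElem? x) (enc l) d
    have h2 : cellIdx x ≤ 5 := by rcases x with _ | _ | _ | _ | _ | _ <;> simp [cellIdx]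
    rw [enc_cons, st_main, List.tail_cons, update_st_main]
    exact h1.mono (m := 12) (by omega)

/-- Replaces the code of a list of symbols by the word of these symbols. -/
def writeTape : Cmd := .seq decodeMain (.pop .main fun _ => unload true)

theorem writeTape_runs (w : List Cell) :
    Runs writeTape (ms (enc w)) (ms w) (17 * w.length + 3) := by
  have h1 := decodeMain_runs w []
  have h3 := unload_runs true w.reverse [] []
  simp only [List.append_nil, List.reverse_reverse, List.length_reverse, sd, ↓reduceIte] at h1 h3
  exact (h1.seq (Runs.pop (n := 3 * w.length + 1) (by simpa using h3))).mono (by omega)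

/-- Splits the contents of a tape into the two words before and after the separator. -/
def splitTape (l : List Cell) : Word × Word :=
  l.foldr (fun c s => bif c.isNone then ([], s.1) else (c.getD .zero :: s.1, s.2)) ([], [])

theorem splitTape_pairTape (x y : Word) : splitTape (pairTape x y) = (x, y) := by
  have h : ∀ (w : Word) (s : Word × Word), (w.map some).foldr (fun c s => bif c.isNone then
      ([], s.1) else (c.getD Sym.zero :: s.1, s.2)) s = (w ++ s.1, s.2) := by
    intro w s
    induction w with
    | nil => rfl
    | cons a w ih => simp [ih]
  simp [splitTape, pairTape, h]

theorem size_splitTape_le (l : List Cell) : size (splitTape l) ≤ size l + 2 := by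
  induction l with
  | nil => simp [splitTape, size_pair, size_nil]
  | cons c l ih =>
    have h : splitTape (c :: l) = bif c.isNone then ([], (splitTape l).1)
      else (c.getD .zero :: (splitTape l).1, (splitTape l).2) := rfl
    rw [h, size_cons]
    cases c with
    | none => simp [size_pair, size_nil] at *; omega
    | some a =>
      have ha : size a = size (some a : Cell) := rfl
      simp [size_pair, size_cons] at *
      omega

theorem size_tape_le (w : List Cell) : size w ≤ 12 * w.length + 1 := by
  induction w with
  | nil => simp [size_nil]
  | cons c w ih =>
    have := size_cell c
    rw [size_cons, List.length_cons]
    omega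

theorem Poly.splitTape : Poly splitTape := by
  have h1 : Poly (fun c : Cell => c.isNone) := of_cell _
  have h2 : Poly (fun c : Cell => c.getD .zero) := of_cell _
  have h : Poly (fun p : List Cell × Cell × (Word × Word) => bif p.2.1.isNone then
      (([] : Word), p.2.2.1) else (p.2.1.getD .zero :: p.2.2.1, p.2.2.2)) := by
    have h1' := h1.comp (f := fun p : List Cell × Cell × (Word × Word) => p.2.1) (by fun_prop)
    have h2' := h2.comp (f := fun p : List Cell × Cell × (Word × Word) => p.2.1) (by fun_prop)
    fun_prop
  exact Poly.foldr (α := List Cell) (f := fun _ c s => bif c.isNone then ([], s.1)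
      else (c.getD .zero :: s.1, s.2)) (l := fun l => l) (s := fun _ => ([], [])) h (by fun_prop)
    (by fun_prop) ⟨fun n => n + 2, by fun_prop, fun l l' hl => (size_splitTape_le l').trans (by
      obtain ⟨t, rfl⟩ := hl
      have := size_append t l'
      have := length_lt_size t
      dsimp only
      omega)⟩

/-- A reduction by a polynomial time function whose second component depends on the parameter
only. -/
theorem reduces_of_poly {L L' : ParamProblem} {F : Word × Word → Word} {G : Word → Word}
    (hF : Poly F) (hG : Poly G) (h : ∀ x y, (x, y) ∈ L ↔ (F (x, y), G y) ∈ L') :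
    Reduces L L' := by
  have hsome : Poly (fun s : Sym => (some s : Cell)) := Poly.of_enc_eq fun _ => rfl
  have hmap : Poly (fun w : Word => w.map (some : Sym → Cell)) := by fun_prop
  have hsplit := Poly.splitTape
  have hP : Poly (fun w : List Cell => pairTape (F (splitTape w)) (G (splitTape w).2)) := by
    have h1 := hmap.comp (hF.comp hsplit)
    have h2 := hmap.comp (hG.comp (Poly.snd.comp hsplit))
    unfold pairTape
    fun_prop
  obtain ⟨S, hS, hSm, hSf⟩ := hP.size_bound
  obtain ⟨c, T, hT, hTm, hr⟩ := hP.exists_monotone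
  have htime : PolyBounded fun n =>
      18 * n + 3 + (T (12 * n + 1) + (17 * S (12 * n + 1) + 3)) + 1 := by fun_prop
  obtain ⟨k, hk⟩ := htime
  let c' : Cmd := .seq readTape (.seq c writeTape)
  refine ⟨⟨machine c', Equiv.refl _, Equiv.refl _⟩, k, fun n => (n + 3) ^ k,
    fun x y => F (x, y), G, fun x y => ?_, h⟩
  have hw := size_tape_le (pairTape x y)
  have hr' := (hr (pairTape x y) []).mono (hTm hw)
  have hS' := (length_lt_size _).le.trans ((hSf (pairTape x y)).trans (hSm hw))
  simp only [splitTape_pairTape, List.append_nil] at hr' hS'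
  obtain ⟨n, hn, hrun⟩ := (readTape_runs (pairTape x y)).seq (hr'.seq (writeTape_runs _))
  obtain ⟨ho⟩ := hrun.outputs
  have hid : ∀ w : List Cell, w.map (Equiv.refl Cell).symm = w := fun w => List.map_id w
  suffices hm : ho.steps ≤ (y.length + 3) ^ k * (x.length + 1) ^ k by
    have h2 : Nonempty (TM2OutputsInTime (machine c') (pairTape x y)
        (some (pairTape (F (x, y)) (G y))) ((y.length + 3) ^ k * (x.length + 1) ^ k)) :=
      ⟨⟨ho.toEvalsTo, hm⟩⟩
    exact cast (by erw [hid, hid]) h2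
  refine ho.steps_le_m.trans ?_
  have hlen : (pairTape x y).length = x.length + y.length + 1 := by
    simp [pairTape]
    omega
  rw [← mul_pow]
  refine le_trans ?_ ((hk (pairTape x y).length).trans (Nat.pow_le_pow_left ?_ k))
  · dsimp only
    omega
  · rw [hlen]
    nlinarith

end LPComplexity

namespace LPComplexity

open Function Turing StateTransition

/-! ### Composition of reductions -/

section Lift

variable {K K' : Type} [DecidableEq K] [DecidableEq K'] {Γ : K → Type} {Γ' : K' → Type}
  {Λ Λ' σ σ' : Type}

/-- A statement as part of a larger machine: stacks are renamed by `e`, the internal state is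
accessed by `get` and `set`, labels are renamed by `lab`, and `x` says where to go on instead of
halting. The alphabets of corresponding stacks are identified by `φ`. -/
def liftStmt (e : K → K') (φ : ∀ k, Γ k ≃ Γ' (e k)) (get : σ' → σ) (set : σ → σ' → σ')
    (lab : Λ → Λ') (x : Option Λ') : TM2.Stmt Γ Λ σ → TM2.Stmt Γ' Λ' σ'
  | .push k f q => .push (e k) (fun v => φ k (f (get v))) (liftStmt e φ get set lab x q)
  | .peek k f q => .peek (e k) (fun v o => set (f (get v) (o.map (φ k).symm)) v)
      (liftStmt e φ get set lab x q)
  | .pop k f q => .pop (e k) (fun v o => set (f (get v) (o.map (φ k).symm)) v)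
      (liftStmt e φ get set lab x q)
  | .load f q => .load (fun v => set (f (get v)) v) (liftStmt e φ get set lab x q)
  | .branch f q q' => .branch (fun v => f (get v)) (liftStmt e φ get set lab x q)
      (liftStmt e φ get set lab x q')
  | .goto l => .goto fun v => lab (l (get v))
  | .halt => x.elim .halt fun l => .goto fun _ => l

/-- The configuration of the larger machine that corresponds to a configuration of the
smaller one. -/
def liftCfg (V : σ → σ') (J : (∀ k, List (Γ k)) → ∀ k, List (Γ' k)) (lab : Λ → Λ')
    (x : Option Λ') (c : TM2.Cfg Γ Λ σ) : TM2.Cfg Γ' Λ' σ' :=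
  ⟨c.l.elim x fun l => some (lab l), V c.var, J c.stk⟩

variable {e : K → K'} {φ : ∀ k, Γ k ≃ Γ' (e k)} {get : σ' → σ} {set : σ → σ' → σ'}
  {lab : Λ → Λ'} {x : Option Λ'} {V : σ → σ'} {J : (∀ k, List (Γ k)) → ∀ k, List (Γ' k)}

theorem stepAux_liftStmt (hget : ∀ v, get (V v) = v) (hset : ∀ v w, set v (V w) = V v)
    (hJ : ∀ S k, J S (e k) = (S k).map (φ k))
    (hJu : ∀ S k l, update (J S) (e k) (l.map (φ k)) = J (update S k l))
    (q : TM2.Stmt Γ Λ σ) (v : σ) (S : ∀ k, List (Γ k)) :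
    TM2.stepAux (liftStmt e φ get set lab x q) (V v) (J S)
      = liftCfg V J lab x (TM2.stepAux q v S) := by
  have hhead : ∀ k (l : List (Γ k)), ((l.map (φ k)).head?.map (φ k).symm) = l.head? := by
    intro k l
    cases l <;> simp
  induction q generalizing v S with
  | push k f q ih =>
    simp only [liftStmt, TM2.stepAux, hget, hJ, ← List.map_cons, hJu, ih]
  | peek k f q ih => simp only [liftStmt, TM2.stepAux, hget, hset, hJ, hhead, ih]
  | pop k f q ih =>
    simp only [liftStmt, TM2.stepAux, hget, hset, hJ, hhead, ← List.map_tail, hJu, ih]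
  | load f q ih => simp only [liftStmt, TM2.stepAux, hget, hset, ih]
  | branch f q q' ih ih' =>
    simp only [liftStmt, TM2.stepAux, hget]
    cases f v
    · exact ih' v S
    · exact ih v S
  | goto l => simp only [liftStmt, TM2.stepAux, hget, liftCfg, Option.elim_some]
  | halt => cases x <;> rfl

theorem iterate_bind_none {X : Type} (f : X → Option X) (n : ℕ) :
    (flip bind f)^[n] none = none := by
  induction n with
  | zero => rfl
  | succ n ih => rw [iterate_succ_apply]; exact ih

/-- The larger machine simulates the smaller one step by step. -/
theorem iterate_liftCfg (hget : ∀ v, get (V v) = v) (hset : ∀ v w, set v (V w) = V v)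
    (hJ : ∀ S k, J S (e k) = (S k).map (φ k))
    (hJu : ∀ S k l, update (J S) (e k) (l.map (φ k)) = J (update S k l))
    {M : Λ → TM2.Stmt Γ Λ σ} {M' : Λ' → TM2.Stmt Γ' Λ' σ'}
    (hM : ∀ l, M' (lab l) = liftStmt e φ get set lab x (M l)) (n : ℕ) (c c' : TM2.Cfg Γ Λ σ)
    (h : (flip bind (TM2.step M))^[n] (some c) = some c') :
    (flip bind (TM2.step M'))^[n] (some (liftCfg V J lab x c))
      = some (liftCfg V J lab x c') := by
  induction n generalizing c with
  | zero =>
    obtain rfl : c = c' := by simpa using h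
    rfl
  | succ n ih =>
    rw [iterate_succ_apply] at h ⊢
    obtain ⟨_ | l, v, S⟩ := c
    · exact absurd ((iterate_bind_none _ n).symm.trans h) (by simp)
    · refine Eq.trans ?_ (ih _ h)
      refine congrArg (flip bind (TM2.step M'))^[n] ?_
      change some (TM2.stepAux (M' (lab l)) (V v) (J S)) = _
      rw [hM, stepAux_liftStmt hget hset hJ hJu]

end Lift

section Growth

variable {K : Type} [DecidableEq K] {Γ : K → Type} {Λ σ : Type}

/-- A bound on the number of symbols that a statement pushes. -/
def pushes : TM2.Stmt Γ Λ σ → ℕ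
  | .push _ _ q => pushes q + 1
  | .peek _ _ q => pushes q
  | .pop _ _ q => pushes q
  | .load _ q => pushes q
  | .branch _ q q' => pushes q + pushes q'
  | .goto _ => 0
  | .halt => 0

theorem length_stepAux_le (q : TM2.Stmt Γ Λ σ) (v : σ) (S : ∀ k, List (Γ k)) (k : K) :
    ((TM2.stepAux q v S).stk k).length ≤ (S k).length + pushes q := by
  induction q generalizing v S with
  | push j f q ih =>
    refine (ih _ _).trans ?_
    by_cases h : k = j
    · subst h; simp [pushes]; omega
    · simp [update_of_ne h, pushes]
  | peek j f q ih => exact ih _ _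
  | pop j f q ih =>
    refine (ih _ _).trans ?_
    by_cases h : k = j
    · subst h; simp [pushes]
    · simp [update_of_ne h, pushes]
  | load f q ih => exact ih _ _
  | branch f q q' ih ih' =>
    have h1 := ih v S
    have h2 := ih' v S
    simp only [TM2.stepAux, pushes]
    cases f v <;> simp <;> omega
  | goto l => simp [pushes]
  | halt => simp [pushes]

theorem length_iterate_le {M : Λ → TM2.Stmt Γ Λ σ} {C : ℕ} (hC : ∀ l, pushes (M l) ≤ C) (n : ℕ)
    (c c' : TM2.Cfg Γ Λ σ) (h : (flip bind (TM2.step M))^[n] (some c) = some c') (k : K) :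
    (c'.stk k).length ≤ (c.stk k).length + n * C := by
  induction n generalizing c with
  | zero =>
    obtain rfl : c = c' := by simpa using h
    simp
  | succ n ih =>
    rw [iterate_succ_apply] at h
    obtain ⟨_ | l, v, S⟩ := c
    · exact absurd ((iterate_bind_none _ n).symm.trans h) (by simp)
    · have h1 := ih _ h
      have h2 := length_stepAux_le (M l) v S k
      have h3 := hC l
      rw [Nat.succ_mul]
      simp only at *
      omega

end Growth

theorem initList_eq (tm : FinTM2) (s : List (tm.Γ tm.k₀)) :
    initList tm s = ⟨some tm.main, tm.initialState, update (fun _ => []) tm.k₀ s⟩ := by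
  unfold initList
  congr 1
  funext k
  by_cases h : k = tm.k₀
  · subst h; simp
  · simp [h]

theorem haltList_eq (tm : FinTM2) (s : List (tm.Γ tm.k₁)) :
    haltList tm s = ⟨none, tm.initialState, update (fun _ => []) tm.k₁ s⟩ := by
  unfold haltList
  congr 1
  funext k
  by_cases h : k = tm.k₁
  · subst h; simp
  · simp [h]

/-- The output of a machine is at most linearly longer than its input and its running time. -/
theorem exists_length_output_le (tm : FinTM2) : ∃ C, ∀ (s : List (tm.Γ tm.k₀))
    (s' : List (tm.Γ tm.k₁)) (n : ℕ),
    (flip bind tm.step)^[n] (some (initList tm s)) = some (haltList tm s') →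
      s'.length ≤ s.length + n * C := by
  have := tm.ΛFin
  refine ⟨Finset.univ.sup fun l => pushes (tm.m l), fun s s' n h => ?_⟩
  have h1 := length_iterate_le (C := Finset.univ.sup fun l => pushes (tm.m l))
    (fun l => Finset.le_sup (f := fun l => pushes (tm.m l)) (Finset.mem_univ l)) n _ _ h tm.k₁
  rw [initList_eq, haltList_eq] at h1
  simp only [update_self] at h1
  refine h1.trans (Nat.add_le_add_right ?_ _)
  by_cases h2 : tm.k₁ = tm.k₀
  · rw [h2, update_self]
  · simp [update_of_ne h2]

end LPComplexity

namespace LPComplexity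

open Function Turing StateTransition

section Compose

variable (A B : TM2ComputableAux (Option Sym) (Option Sym))

/-- The stacks of the composition of two machines: their stacks, and one more stack for the
transfer of the output of the first machine to the input of the second one. -/
abbrev CompK : Type := A.tm.K ⊕ (B.tm.K ⊕ Unit)

/-- The alphabets of the stacks of a composition. -/
def CompΓ : CompK A B → Type := Sum.elim A.tm.Γ (Sum.elim B.tm.Γ fun _ => Option Sym)

/-- The alphabets of the first machine as alphabets of the composition. -/
def fstΓ (k : A.tm.K) : A.tm.Γ k ≃ CompΓ A B (.inl k) := Equiv.refl _

/-- The alphabets of the second machine as alphabets of the composition. -/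
def sndΓ (k : B.tm.K) : B.tm.Γ k ≃ CompΓ A B (.inr (.inl k)) := Equiv.refl _

/-- The alphabet of the additional stack of the composition. -/
def addΓ : Option Sym ≃ CompΓ A B (.inr (.inr ())) := Equiv.refl _

/-- The labels of a composition; there are two more labels for the two halves of the transfer. -/
abbrev CompΛ : Type := A.tm.Λ ⊕ (B.tm.Λ ⊕ Bool)

/-- The internal states of a composition, with a register for the transferred symbol. -/
abbrev CompS : Type := A.tm.σ × B.tm.σ × Option (Option Sym)

/-- The stacks of a composition, put together. -/
def joinStk (S : ∀ k, List (A.tm.Γ k)) (T : ∀ k, List (B.tm.Γ k)) (w : List (Option Sym)) :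
    ∀ k, List (CompΓ A B k)
  | .inl k => (S k).map (fstΓ A B k)
  | .inr (.inl k) => (T k).map (sndΓ A B k)
  | .inr (.inr _) => w.map (addΓ A B)

/-- The statements of a composition: the first machine with jumps to the transfer instead of
halting, the second machine, and two loops that move the output of the first machine to the
additional stack and from there to the input stack of the second machine. -/
def compStmt : CompΛ A B → TM2.Stmt (CompΓ A B) (CompΛ A B) (CompS A B)
  | .inl l => liftStmt Sum.inl (fstΓ A B) (fun v => v.1)
      (fun a v => (a, v.2)) Sum.inl (some (.inr (.inr false))) (A.tm.m l)
  | .inr (.inl l) => liftStmt (fun k => .inr (.inl k)) (sndΓ A B)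
      (fun v => v.2.1) (fun a v => (v.1, a, v.2.2)) (fun l => .inr (.inl l)) none (B.tm.m l)
  | .inr (.inr false) => .pop (.inl A.tm.k₁)
      (fun v o => (v.1, v.2.1, o.map fun c => A.outputAlphabet ((fstΓ A B _).symm c)))
      (.branch (fun v => v.2.2.isSome)
        (.push (.inr (.inr ())) (fun v => addΓ A B (v.2.2.getD none))
          (.goto fun _ => .inr (.inr false)))
        (.goto fun _ => .inr (.inr true)))
  | .inr (.inr true) => .pop (.inr (.inr ())) (fun v o => (v.1, v.2.1, o.map (addΓ A B).symm))
      (.branch (fun v => v.2.2.isSome)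
        (.push (.inr (.inl B.tm.k₀))
          (fun v => sndΓ A B _ (B.inputAlphabet.symm (v.2.2.getD none)))
          (.goto fun _ => .inr (.inr true)))
        (.goto fun _ => .inr (.inl B.tm.main)))

/-- The composition of two machines. -/
noncomputable def compMachine : FinTM2 :=
  have := A.tm.kFin
  have := B.tm.kFin
  have := A.tm.ΛFin
  have := B.tm.ΛFin
  have := A.tm.σFin
  have := B.tm.σFin
  { K := CompK A B
    k₀ := .inl A.tm.k₀
    k₁ := .inr (.inl B.tm.k₁)
    Γ := CompΓ A B
    Λ := CompΛ A B
    main := .inl A.tm.main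
    σ := CompS A B
    initialState := (A.tm.initialState, B.tm.initialState, none)
    Γk₀Fin := have := A.tm.Γk₀Fin; Fintype.ofEquiv _ (fstΓ A B A.tm.k₀)
    m := compStmt A B }

variable {A B}

theorem update_joinStk_inl (S : ∀ k, List (A.tm.Γ k)) (T : ∀ k, List (B.tm.Γ k))
    (w : List (Option Sym)) (k : A.tm.K) (l : List (A.tm.Γ k)) :
    update (joinStk A B S T w) (.inl k) (l.map (fstΓ A B k))
      = joinStk A B (update S k l) T w := by
  funext j
  rcases j with j | j | j
  · by_cases h : j = k
    · subst h; simp [joinStk]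
    · rw [update_of_ne (by simpa using h)]; simp [joinStk, h]
  · rw [update_of_ne (by simp)]; rfl
  · rw [update_of_ne (by simp)]; rfl

theorem update_joinStk_inr_inl (S : ∀ k, List (A.tm.Γ k)) (T : ∀ k, List (B.tm.Γ k))
    (w : List (Option Sym)) (k : B.tm.K) (l : List (B.tm.Γ k)) :
    update (joinStk A B S T w) (.inr (.inl k)) (l.map (sndΓ A B k))
      = joinStk A B S (update T k l) w := by
  funext j
  rcases j with j | j | j
  · rw [update_of_ne (by simp)]; rfl
  · by_cases h : j = k
    · subst h; simp [joinStk]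
    · rw [update_of_ne (by simpa using h)]; simp [joinStk, h]
  · rw [update_of_ne (by simp)]; rfl

theorem update_joinStk_inr_inr (S : ∀ k, List (A.tm.Γ k)) (T : ∀ k, List (B.tm.Γ k))
    (w l : List (Option Sym)) :
    update (joinStk A B S T w) (.inr (.inr ())) (l.map (addΓ A B)) = joinStk A B S T l := by
  funext j
  rcases j with j | j | j
  · rw [update_of_ne (by simp)]; rfl
  · rw [update_of_ne (by simp)]; rfl
  · rw [update_self]; rfl

theorem transfer_out (a : A.tm.σ) (b : B.tm.σ) (r : Option (Option Sym))
    (w : List (A.tm.Γ A.tm.k₁)) (u : List (Option Sym)) :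
    (flip bind (TM2.step (compStmt A B)))^[w.length + 1]
      (some ⟨some (.inr (.inr false)), (a, b, r),
        joinStk A B (update (fun _ => []) A.tm.k₁ w) (fun _ => []) u⟩)
      = some ⟨some (.inr (.inr true)), (a, b, none),
        joinStk A B (fun _ => []) (fun _ => []) ((w.map A.outputAlphabet).reverse ++ u)⟩ := by
  induction w generalizing r u with
  | nil =>
    have h := update_joinStk_inl (A := A) (B := B) (fun _ => []) (fun _ => []) u A.tm.k₁ []
    rw [List.map_nil, update_eq_self_iff.2 rfl] at h
    rw [List.length_nil, iterate_one]
    change some (TM2.stepAux (compStmt A B _) _ _) = _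
    simp [compStmt, joinStk] at h ⊢
  | cons x w ih =>
    rw [List.length_cons, iterate_succ_apply, List.map_cons, List.reverse_cons, List.append_assoc,
      List.singleton_append, ← ih (some (A.outputAlphabet x))]
    refine congrArg _ ?_
    change some (TM2.stepAux (compStmt A B _) _ _) = _
    have h := update_joinStk_inl (A := A) (B := B) (update (fun _ => []) A.tm.k₁ (x :: w))
      (fun _ => []) u A.tm.k₁ w
    have h2 := update_joinStk_inr_inr (A := A) (B := B) (update (fun _ => []) A.tm.k₁ w)
      (fun _ => []) u (A.outputAlphabet x :: u)
    rw [update_idem] at h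
    have h1 : joinStk A B (update (fun _ => []) A.tm.k₁ (x :: w)) (fun _ => []) u (.inl A.tm.k₁)
      = fstΓ A B _ x :: w.map (fstΓ A B _) := by simp [joinStk]
    have h3 : joinStk A B (update (fun _ => []) A.tm.k₁ w) (fun _ => []) u (.inr (.inr ()))
      = u.map (addΓ A B) := rfl
    simp only [compStmt, TM2.stepAux, h1, List.head?_cons, Option.map_some, Equiv.symm_apply_apply,
      Option.isSome_some, cond_true, List.tail_cons, h, h3, Option.getD_some]
    rw [← List.map_cons, h2]

theorem transfer_in (a : A.tm.σ) (b : B.tm.σ) (r : Option (Option Sym))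
    (w : List (Option Sym)) (u : List (B.tm.Γ B.tm.k₀)) :
    (flip bind (TM2.step (compStmt A B)))^[w.length + 1]
      (some ⟨some (.inr (.inr true)), (a, b, r),
        joinStk A B (fun _ => []) (update (fun _ => []) B.tm.k₀ u) w⟩)
      = some ⟨some (.inr (.inl B.tm.main)), (a, b, none),
        joinStk A B (fun _ => [])
          (update (fun _ => []) B.tm.k₀ ((w.map B.inputAlphabet.symm).reverse ++ u)) []⟩ := by
  induction w generalizing r u with
  | nil =>
    have h := update_joinStk_inr_inr (A := A) (B := B) (fun _ => [])
      (update (fun _ => []) B.tm.k₀ u) [] []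
    rw [List.length_nil, iterate_one]
    change some (TM2.stepAux (compStmt A B _) _ _) = _
    simp [compStmt, joinStk] at h ⊢
  | cons x w ih =>
    rw [List.length_cons, iterate_succ_apply, List.map_cons, List.reverse_cons, List.append_assoc,
      List.singleton_append, ← ih (some x)]
    refine congrArg _ ?_
    change some (TM2.stepAux (compStmt A B _) _ _) = _
    have h := update_joinStk_inr_inr (A := A) (B := B) (fun _ => [])
      (update (fun _ => []) B.tm.k₀ u) (x :: w) w
    have h2 := update_joinStk_inr_inl (A := A) (B := B) (fun _ => [])
      (update (fun _ => []) B.tm.k₀ u) w B.tm.k₀ (B.inputAlphabet.symm x :: u)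
    rw [update_idem] at h2
    have h1 : joinStk A B (fun _ => []) (update (fun _ => []) B.tm.k₀ u) (x :: w) (.inr (.inr ()))
      = addΓ A B x :: w.map (addΓ A B) := rfl
    have h3 : joinStk A B (fun _ => []) (update (fun _ => []) B.tm.k₀ u) w (.inr (.inl B.tm.k₀))
      = u.map (sndΓ A B _) := by simp [joinStk]
    simp only [compStmt, TM2.stepAux, h1, List.head?_cons, Option.map_some, Equiv.symm_apply_apply,
      Option.isSome_some, cond_true, List.tail_cons, h, h3, Option.getD_some]
    rw [← List.map_cons, h2]

/-- The composition of two machines feeds the output of the first one to the second one. -/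
theorem compMachine_outputs {s v t : List (Option Sym)} {n m : ℕ}
    (hA : TM2OutputsInTime A.tm (s.map A.inputAlphabet.symm)
      (some (v.map A.outputAlphabet.symm)) n)
    (hB : TM2OutputsInTime B.tm (v.map B.inputAlphabet.symm)
      (some (t.map B.outputAlphabet.symm)) m) :
    Nonempty (TM2OutputsInTime (compMachine A B)
      (s.map (A.inputAlphabet.symm.trans (fstΓ A B A.tm.k₀)))
      (some (t.map (B.outputAlphabet.symm.trans (sndΓ A B B.tm.k₁))))
      (n + 2 * (v.length + 1) + m)) := by
  obtain ⟨⟨i, hi⟩, hin⟩ := hA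
  obtain ⟨⟨j, hj⟩, hjm⟩ := hB
  have h1 := iterate_liftCfg (e := Sum.inl) (φ := fstΓ A B)
    (get := fun v : CompS A B => v.1) (set := fun a v => (a, v.2)) (lab := Sum.inl)
    (x := some (.inr (.inr false))) (V := fun a => (a, B.tm.initialState, none))
    (J := fun S => joinStk A B S (fun _ => []) []) (M' := compStmt A B) (fun _ => rfl)
    (fun _ _ => rfl) (fun S k => rfl) (fun S k l => update_joinStk_inl _ _ _ _ _)
    (fun _ => rfl) i _ _ hi
  have h4 := iterate_liftCfg (e := fun k => Sum.inr (.inl k)) (φ := sndΓ A B)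
    (get := fun v : CompS A B => v.2.1) (set := fun a v => (v.1, a, v.2.2))
    (lab := fun l => Sum.inr (.inl l))
    (x := none) (V := fun b => (A.tm.initialState, b, none))
    (J := fun S => joinStk A B (fun _ => []) S []) (M' := compStmt A B) (fun _ => rfl)
    (fun _ _ => rfl) (fun S k => rfl) (fun S k l => update_joinStk_inr_inl _ _ _ _ _)
    (fun _ => rfl) j _ _ hj
  have h2 := transfer_out (B := B) A.tm.initialState B.tm.initialState none
    (v.map A.outputAlphabet.symm) []
  have h3 := transfer_in (A := A) A.tm.initialState B.tm.initialState none v.reverse []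
  rw [initList_eq, haltList_eq] at h1 h4
  simp only [liftCfg, Option.elim_some, Option.elim_none, List.map_map, Equiv.self_comp_symm,
    List.map_id, List.append_nil, List.length_map, List.length_reverse, List.map_reverse,
    List.reverse_reverse, update_eq_self_iff.2] at h1 h2 h3 h4
  refine ⟨⟨⟨j + ((v.length + 1) + ((v.length + 1) + i)), ?_⟩, by simp at *; omega⟩⟩
  have hi' : initList (compMachine A B) (s.map (A.inputAlphabet.symm.trans (fstΓ A B A.tm.k₀)))
      = ⟨some (.inl A.tm.main), (A.tm.initialState, B.tm.initialState, none),
        joinStk A B (update (fun _ => []) A.tm.k₀ (s.map A.inputAlphabet.symm))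
          (fun _ => []) []⟩ := by
    rw [initList_eq, ← update_joinStk_inl, List.map_map]
    congr 1
    refine congrArg (fun f => update f _ _) ?_
    funext k
    rcases k with k | k | k <;> rfl
  have hh' : haltList (compMachine A B)
      (t.map (B.outputAlphabet.symm.trans (sndΓ A B B.tm.k₁)))
      = ⟨none, (A.tm.initialState, B.tm.initialState, none),
        joinStk A B (fun _ => []) (update (fun _ => []) B.tm.k₁ (t.map B.outputAlphabet.symm))
          []⟩ := by
    rw [haltList_eq, ← update_joinStk_inr_inl, List.map_map]
    congr 1
    refine congrArg (fun f => update f _ _) ?_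
    funext k
    rcases k with k | k | k <;> rfl
  change (flip bind (TM2.step (compStmt A B)))^[_] (some (initList (compMachine A B) _))
    = some (haltList (compMachine A B) _)
  rw [hi', hh', iterate_add_apply _ j, iterate_add_apply _ (v.length + 1) (v.length + 1 + i),
    iterate_add_apply _ (v.length + 1) i]
  erw [h1, h2, h3, h4]
  rfl

end Compose

/-- A bound for a function of words in terms of the length of the word. -/
theorem exists_bound_length (h : Word → ℕ) : ∃ Q : ℕ → ℕ, ∀ y, h y ≤ Q y.length := by
  refine ⟨fun n => Finset.univ.sup fun v : List.Vector Sym n => h v.1, fun y => ?_⟩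
  exact Finset.le_sup (f := fun v : List.Vector Sym y.length => h v.1)
    (Finset.mem_univ ⟨y, rfl⟩)

theorem composition_time_le {a b F G p p' q c C n Q : ℕ} (hn : n ≤ q * (a + 1) ^ p)
    (hF : F + G + 1 ≤ a + b + 1 + n * C) (hQ : c ≤ Q) :
    q * (a + 1) ^ p + 2 * (F + G + 1 + 1) + c * (F + 1) ^ p' ≤
      (q + 2 * (b + 2 + q * C) + Q * (b + 1 + q * C) ^ p') *
        (a + 1) ^ (p + (p + 1) + (p + 1) * p') := by
  have hX : ∀ {i j : ℕ}, i ≤ j → (a + 1) ^ i ≤ (a + 1) ^ j := fun h =>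
    Nat.pow_le_pow_right (by omega) h
  have h1 : 1 ≤ (a + 1) ^ (p + 1) := Nat.one_le_pow _ _ (by omega)
  have h2 : n * C ≤ q * C * (a + 1) ^ (p + 1) := by
    calc n * C ≤ q * (a + 1) ^ p * C := Nat.mul_le_mul_right _ hn
      _ = q * C * (a + 1) ^ p := by ring
      _ ≤ _ := Nat.mul_le_mul_left _ (hX (by omega))
  have h3 : a + 1 ≤ (a + 1) ^ (p + 1) := by simpa using hX (i := 1) (j := p + 1) (by omega)
  have h4 : b ≤ b * (a + 1) ^ (p + 1) := Nat.le_mul_of_pos_right _ h1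
  have hW : F + G + 1 ≤ (b + 1 + q * C) * (a + 1) ^ (p + 1) := by
    rw [add_mul, add_mul]
    omega
  have hT1 : q * (a + 1) ^ p ≤ q * (a + 1) ^ (p + (p + 1) + (p + 1) * p') :=
    Nat.mul_le_mul_left _ (hX (by omega))
  have hT2 : 2 * (F + G + 1 + 1) ≤
      2 * (b + 2 + q * C) * (a + 1) ^ (p + (p + 1) + (p + 1) * p') := by
    calc 2 * (F + G + 1 + 1) ≤ 2 * ((b + 2 + q * C) * (a + 1) ^ (p + 1)) := by
          have : (b + 2 + q * C) * (a + 1) ^ (p + 1)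
            = (b + 1 + q * C) * (a + 1) ^ (p + 1) + (a + 1) ^ (p + 1) := by ring
          omega
      _ = 2 * (b + 2 + q * C) * (a + 1) ^ (p + 1) := by ring
      _ ≤ _ := Nat.mul_le_mul_left _ (hX (by omega))
  have hT3 : c * (F + 1) ^ p' ≤
      Q * (b + 1 + q * C) ^ p' * (a + 1) ^ (p + (p + 1) + (p + 1) * p') := by
    calc c * (F + 1) ^ p' ≤ Q * ((b + 1 + q * C) * (a + 1) ^ (p + 1)) ^ p' :=
          Nat.mul_le_mul hQ (Nat.pow_le_pow_left (by omega) _)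
      _ = Q * (b + 1 + q * C) ^ p' * (a + 1) ^ ((p + 1) * p') := by
          rw [mul_pow, ← pow_mul]; ring
      _ ≤ _ := Nat.mul_le_mul_left _ (hX (by omega))
  rw [add_mul, add_mul]
  omega

/-- Fixed-parameter reducibility is transitive. The length of the intermediate instance is bounded
by the running time of the first machine, and the intermediate parameter is bounded by a function
of the given parameter, as there are only finitely many words of each length. -/
theorem Reduces.trans {L₁ L₂ L₃ : ParamProblem} (h₁ : Reduces L₁ L₂) (h₂ : Reduces L₂ L₃) :
    Reduces L₁ L₃ := by
  obtain ⟨A, p, q, f, g, hA, hfg⟩ := h₁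
  obtain ⟨B, p', q', f', g', hB, hfg'⟩ := h₂
  obtain ⟨C, hC⟩ := exists_length_output_le A.tm
  obtain ⟨Q, hQ⟩ := exists_bound_length fun y => q' (g y).length
  refine ⟨⟨compMachine A B, (fstΓ A B A.tm.k₀).symm.trans A.inputAlphabet,
    (sndΓ A B B.tm.k₁).symm.trans B.outputAlphabet⟩, p + (p + 1) + (p + 1) * p',
    fun n => q n + 2 * (n + 2 + q n * C) + Q n * (n + 1 + q n * C) ^ p',
    fun x y => f' (f x y) (g y), fun y => g' (g y), fun x y => ?_, fun x y =>
      (hfg x y).trans (hfg' _ _)⟩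
  obtain ⟨hA⟩ := hA x y
  obtain ⟨hB⟩ := hB (f x y) (g y)
  have hlen := hC _ _ _ hA.evals_in_steps
  obtain ⟨ho⟩ := compMachine_outputs hA hB
  suffices hm : ho.steps ≤ _ from ⟨⟨ho.toEvalsTo, hm⟩⟩
  refine ho.steps_le_m.trans ?_
  have hst := hA.steps_le_m
  have hq := hQ y
  simp only [List.length_map] at hlen
  have hW : ∀ x y : Word, (pairTape x y).length = x.length + y.length + 1 := fun x y => by
    simp [pairTape]
    omega
  rw [hW, hW] at hlen
  rw [hW]
  exact composition_time_le hst hlen hq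

end LPComplexity

namespace LPComplexity

open Function

variable {α β γ δ σ : Type} [TreeCode α] [TreeCode β] [TreeCode γ] [TreeCode δ] [TreeCode σ]

/-! ### Reading and writing formulas and programs -/

instance : TreeCode Literal := ⟨fun l => TreeCode.tree (l.positive, l.atom)⟩

instance : TreeCode Rule := ⟨fun r => TreeCode.tree (r.head, r.posBody, r.negBody)⟩

namespace Poly

@[fun_prop]
theorem ite {c : α → Bool} {f g : α → β} (hc : Poly c) (hf : Poly f) (hg : Poly g) :
    Poly (fun a => if c a then f a else g a) := by
  simpa only [Bool.cond_eq_ite] using hc.cond hf hg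

@[fun_prop]
theorem literal_mk {f : α → Bool} {g : α → Atom} (hf : Poly f) (hg : Poly g) :
    Poly (fun a => Literal.mk (f a) (g a)) := by
  have : Poly (fun p : Bool × Atom => Literal.mk p.1 p.2) := of_enc_eq fun _ => rfl
  exact this.comp (hf.pair hg)

@[fun_prop]
theorem literal_positive {f : α → Literal} (hf : Poly f) : Poly (fun a => (f a).positive) := by
  have : Poly (fun l : Literal => (l.positive, l.atom)) := of_enc_eq fun _ => rfl
  exact fst.comp (this.comp hf)

@[fun_prop]
theorem literal_atom {f : α → Literal} (hf : Poly f) : Poly (fun a => (f a).atom) := by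
  have : Poly (fun l : Literal => (l.positive, l.atom)) := of_enc_eq fun _ => rfl
  exact snd.comp (this.comp hf)

@[fun_prop]
theorem rule_mk {f : α → Atom} {g h : α → List Atom} (hf : Poly f) (hg : Poly g) (hh : Poly h) :
    Poly (fun a => Rule.mk (f a) (g a) (h a)) := by
  have : Poly (fun p : Atom × List Atom × List Atom => Rule.mk p.1 p.2.1 p.2.2) :=
    of_enc_eq fun _ => rfl
  exact this.comp (hf.pair (hg.pair hh))

theorem rule_triple : Poly (fun r : Rule => (r.head, r.posBody, r.negBody)) :=
  of_enc_eq fun _ => rfl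

@[fun_prop]
theorem rule_head {f : α → Rule} (hf : Poly f) : Poly (fun a => (f a).head) :=
  fst.comp (rule_triple.comp hf)

@[fun_prop]
theorem rule_posBody {f : α → Rule} (hf : Poly f) : Poly (fun a => (f a).posBody) :=
  fst.comp (snd.comp (rule_triple.comp hf))

@[fun_prop]
theorem rule_negBody {f : α → Rule} (hf : Poly f) : Poly (fun a => (f a).negBody) :=
  snd.comp (snd.comp (rule_triple.comp hf))

@[fun_prop]
theorem decide_atom {f g : α → List Bool} (hf : Poly f) (hg : Poly g) :
    Poly (fun a => decide (f a = g a)) := (decEq_list decEq_bool).decide_eq hf hg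

@[fun_prop]
theorem decide_nat {f g : α → ℕ} (hf : Poly f) (hg : Poly g) :
    Poly (fun a => decide (f a = g a)) := decEq_nat.decide_eq hf hg

@[fun_prop]
theorem decide_sym {f g : α → Sym} (hf : Poly f) (hg : Poly g) :
    Poly (fun a => decide (f a = g a)) := decEq_sym.decide_eq hf hg

@[fun_prop]
theorem decide_word {f g : α → List Sym} (hf : Poly f) (hg : Poly g) :
    Poly (fun a => decide (f a = g a)) := (decEq_list decEq_sym).decide_eq hf hg

@[fun_prop]
theorem encodeAtom {f : α → Atom} (hf : Poly f) : Poly (fun a => encodeAtom (f a)) := by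
  unfold LPComplexity.encodeAtom
  fun_prop

@[fun_prop]
theorem cnf_encode {f : α → CNF} (hf : Poly f) : Poly (fun a => (f a).encode) := by
  unfold CNF.encode Literal.encode
  fun_prop

@[fun_prop]
theorem program_encode {f : α → Program} (hf : Poly f) : Poly (fun a => (f a).encode) := by
  unfold Program.encode Rule.encode
  fun_prop

/-- Folding from the right with steps that enlarge the state by a bounded amount. -/
theorem foldr_of_add {f : α → β → σ → σ} {l : α → List β} {s : α → σ}
    (hf : Poly fun p : α × β × σ => f p.1 p.2.1 p.2.2) (hl : Poly l) (hs : Poly s) (N : ℕ)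
    (hN : ∀ a b s, size (f a b s) ≤ size s + N) :
    Poly (fun a => (l a).foldr (f a) (s a)) := by
  obtain ⟨S, hS, -, hSs⟩ := hs.size_bound
  obtain ⟨T, hT, -, hTl⟩ := hl.size_bound
  have key : ∀ a (l : List β) s, size (l.foldr (f a) s) ≤ size s + l.length * N := by
    intro a l s
    induction l with
    | nil => simp
    | cons b l ih =>
      have := hN a b (l.foldr (f a) s)
      rw [List.length_cons, Nat.succ_mul, List.foldr_cons]
      omega
  refine foldr hf hl hs ⟨fun n => S n + T n * N, by fun_prop, fun a l' h => ?_⟩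
  refine (key a l' (s a)).trans (Nat.add_le_add (hSs a) (Nat.mul_le_mul_right _ ?_))
  exact h.length_le.trans ((length_lt_size _).le.trans (hTl a))

end Poly

/-- One step of the parser for formulas, which reads a word from the right. The state consists of
the name of the atom, the literals of the clause, and the clauses read so far. -/
def cnfStep (x : Sym) (s : Atom × List Literal × CNF) : Atom × List Literal × CNF :=
  bif decide (x = .zero) then (false :: s.1, s.2)
  else bif decide (x = .one) then (true :: s.1, s.2)
  else bif decide (x = .clause) then ([], [], s.2.1 :: s.2.2)
  else ([], ⟨decide (x = .pos), s.1⟩ :: s.2.1, s.2.2)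

/-- The formula that a word encodes; words that encode no formula get an arbitrary value. -/
def parseCNF (w : Word) : CNF := (w.foldr cnfStep ([], [], [])).2.2

theorem foldr_cnfStep_encodeAtom (a b : Atom) (s : List Literal × CNF) :
    (encodeAtom a).foldr cnfStep (b, s) = (a ++ b, s) := by
  induction a with
  | nil => rfl
  | cons x a ih =>
    rw [encodeAtom] at ih
    cases x <;> simp [encodeAtom, ih, cnfStep]

theorem parseCNF_encode (F : CNF) : parseCNF F.encode = F := by
  have h1 : ∀ (c l : List Literal) (F : CNF),
      (c.flatMap Literal.encode).foldr cnfStep ([], l, F) = ([], c ++ l, F) := by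
    intro c l F
    induction c with
    | nil => rfl
    | cons x c ih =>
      obtain ⟨p, a⟩ := x
      rw [List.flatMap_cons, List.foldr_append, ih, Literal.encode, List.foldr_cons,
        foldr_cnfStep_encodeAtom]
      cases p <;> simp [cnfStep]
  have h2 : F.encode.foldr cnfStep ([], [], []) = ([], [], F) := by
    induction F with
    | nil => rfl
    | cons c F ih =>
      rw [CNF.encode] at ih ⊢
      rw [List.flatMap_cons, List.foldr_append, ih, List.foldr_cons, h1]
      simp [cnfStep]
  rw [parseCNF, h2]

/-- One step of the parser for programs, which reads a word from the right. The state consists of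
the name of the atom, the bodies of the rule, and the rules read so far. -/
def programStep (x : Sym) (s : Atom × List Atom × List Atom × Program) :
    Atom × List Atom × List Atom × Program :=
  bif decide (x = .zero) then (false :: s.1, s.2)
  else bif decide (x = .one) then (true :: s.1, s.2)
  else bif decide (x = .clause) then ([], [], [], ⟨s.1, s.2.1, s.2.2.1⟩ :: s.2.2.2)
  else bif decide (x = .pos) then ([], s.1 :: s.2.1, s.2.2)
  else ([], s.2.1, s.1 :: s.2.2.1, s.2.2.2)

/-- The program that a word encodes; words that encode no program get an arbitrary value. -/
def parseProgram (w : Word) : Program := (w.foldr programStep ([], [], [], [])).2.2.2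

theorem foldr_programStep_encodeAtom (a b : Atom) (s : List Atom × List Atom × Program) :
    (encodeAtom a).foldr programStep (b, s) = (a ++ b, s) := by
  induction a with
  | nil => rfl
  | cons x a ih =>
    rw [encodeAtom] at ih
    cases x <;> simp [encodeAtom, ih, programStep]

theorem parseProgram_encode (P : Program) : parseProgram P.encode = P := by
  have h1 : ∀ (l m n : List Atom) (P : Program),
      (l.flatMap fun q => Sym.pos :: encodeAtom q).foldr programStep ([], m, n, P)
        = ([], l ++ m, n, P) := by
    intro l m n P
    induction l with
    | nil => rfl
    | cons x c ih =>
      rw [List.flatMap_cons, List.foldr_append, ih, List.foldr_cons, foldr_programStep_encodeAtom]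
      simp [programStep]
  have h2 : ∀ (l m n : List Atom) (P : Program),
      (l.flatMap fun q => Sym.neg :: encodeAtom q).foldr programStep ([], m, n, P)
        = ([], m, l ++ n, P) := by
    intro l m n P
    induction l with
    | nil => rfl
    | cons x c ih =>
      rw [List.flatMap_cons, List.foldr_append, ih, List.foldr_cons, foldr_programStep_encodeAtom]
      simp [programStep]
  have h3 : P.encode.foldr programStep ([], [], [], []) = ([], [], [], P) := by
    induction P with
    | nil => rfl
    | cons r P ih =>
      rw [Program.encode] at ih ⊢
      rw [List.flatMap_cons, List.foldr_append, ih, Rule.encode, List.foldr_cons,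
        List.foldr_append, h2, List.foldr_append, h1, foldr_programStep_encodeAtom]
      simp [programStep]
  rw [parseProgram, h3]

theorem Poly.parseCNF : Poly parseCNF := by
  have h : Poly fun p : Word × Sym × (Atom × List Literal × CNF) => cnfStep p.2.1 p.2.2 := by
    unfold cnfStep
    fun_prop
  -- A step adds a bit, or a constructor with a sign and empty lists, to the state.
  have := foldr_of_add (α := Word) (f := fun _ => cnfStep) (l := fun w => w)
    (s := fun _ => ([], [], [])) h (by fun_prop) (by fun_prop) 6 fun _ x s => by
      have ht : size true = 3 := rfl
      have hf : size false = 1 := rfl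
      have hl : ∀ l : Literal, size l = size l.positive + size l.atom + 1 :=
        fun l => size_pair (l.positive, l.atom)
      cases x <;> simp [cnfStep, size_pair, size_cons, size_nil, hl] <;> omega
  unfold LPComplexity.parseCNF
  fun_prop

theorem Poly.parseProgram : Poly parseProgram := by
  have h : Poly fun p : Word × Sym × (Atom × List Atom × List Atom × Program) =>
      programStep p.2.1 p.2.2 := by
    unfold programStep
    fun_prop
  -- A step adds a bit, or a constructor with empty lists, to the state.
  have := foldr_of_add (α := Word) (f := fun _ => programStep) (l := fun w => w)
    (s := fun _ => ([], [], [], [])) h (by fun_prop) (by fun_prop) 6 fun _ x s => by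
      have ht : size true = 3 := rfl
      have hf : size false = 1 := rfl
      have hr : ∀ r : Rule, size r = size r.head + (size r.posBody + size r.negBody + 1) + 1 := by
        intro r
        rw [← size_pair (r.posBody, r.negBody)]
        exact size_pair (r.head, r.posBody, r.negBody)
      cases x <;> simp [programStep, size_pair, size_cons, size_nil, hr] <;> omega
  unfold LPComplexity.parseProgram
  fun_prop

end LPComplexity

namespace LPComplexity

open Function

/-! ### Supported and stable models through justifying rules -/

/-- `M` is closed under the rules of `P`, and every atom `p ∈ M` is the head of a rule `ρ p` whose
body is true in `M`. Unless `sup` is true, the atoms of the positive body of `ρ p` have to lie on a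
lower level than `p`, so that they can be derived before `p`. -/
structure Program.Justified (sup : Bool) (P : Program) (M : Finset Atom) (ρ : Atom → Rule)
    (lev : Atom → ℕ) : Prop where
  closed : ∀ r ∈ P, r.BodyHolds M → r.head ∈ M
  mem : ∀ p ∈ M, ρ p ∈ P
  head : ∀ p ∈ M, (ρ p).head = p
  body : ∀ p ∈ M, (ρ p).BodyHolds M
  lt : ∀ p ∈ M, ∀ q ∈ (ρ p).posBody, sup = true ∨ lev q < lev p

theorem Program.mem_atoms {P : Program} {a : Atom} :
    a ∈ P.atoms ↔ ∃ r ∈ P, a = r.head ∨ a ∈ r.posBody ∨ a ∈ r.negBody := by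
  simp [Program.atoms]

theorem Program.mem_reduct {P : Program} {M : Finset Atom} {r : Rule} :
    r ∈ P.reduct M ↔ ∃ r' ∈ P, (∀ s ∈ r'.negBody, s ∉ M) ∧ ⟨r'.head, r'.posBody, []⟩ = r := by
  simp [Program.reduct, and_assoc]

theorem Program.IsSupportedModel.exists_justified {P : Program} {M : Finset Atom}
    (h : P.IsSupportedModel M) :
    ∃ ρ lev, P.Justified true M ρ lev ∧ ∀ p ∈ M, lev p < M.card := by
  have : ∀ p : Atom, ∃ r : Rule, p ∈ M → r ∈ P ∧ r.head = p ∧ r.BodyHolds M := by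
    intro p
    by_cases hp : p ∈ M
    · obtain ⟨r, hr⟩ := (h.2 p (h.1 hp)).1 hp
      exact ⟨r, fun _ => hr⟩
    · exact ⟨⟨[], [], []⟩, fun h => absurd h hp⟩
  choose ρ hρ using this
  exact ⟨ρ, fun _ => 0,
    ⟨fun r hr hb => (h.2 _ (Program.mem_atoms.2 ⟨r, hr, .inl rfl⟩)).2 ⟨r, hr, rfl, hb⟩,
      fun p hp => (hρ p hp).1, fun p hp => (hρ p hp).2.1, fun p hp => (hρ p hp).2.2,
      fun _ _ _ _ => .inl rfl⟩, fun p hp => Finset.card_pos.2 ⟨p, hp⟩⟩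

theorem Program.Justified.subset_atoms {sup : Bool} {P : Program} {M : Finset Atom}
    {ρ : Atom → Rule} {lev : Atom → ℕ} (h : P.Justified sup M ρ lev) : M ⊆ P.atoms :=
  fun p hp => Program.mem_atoms.2 ⟨ρ p, h.mem p hp, .inl (h.head p hp).symm⟩

theorem Program.Justified.isSupportedModel {sup : Bool} {P : Program} {M : Finset Atom}
    {ρ : Atom → Rule} {lev : Atom → ℕ} (h : P.Justified sup M ρ lev) : P.IsSupportedModel M :=
  ⟨h.subset_atoms, fun p _ => ⟨fun hp => ⟨ρ p, h.mem p hp, h.head p hp, h.body p hp⟩,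
    fun ⟨r, hr, he, hb⟩ => he ▸ h.closed r hr hb⟩⟩

/-- The levels of a stable model record the order in which the least model of the reduct is
built up, one atom at a time. -/
theorem Program.IsStableModel.exists_justified {P : Program} {M : Finset Atom}
    (h : P.IsStableModel M) :
    ∃ ρ lev, P.Justified false M ρ lev ∧ ∀ p ∈ M, lev p < M.card := by
  obtain ⟨⟨hsub, hM⟩, hmin⟩ := h
  have key : ∀ n ≤ M.card, ∃ (A : Finset Atom) (ρ : Atom → Rule) (lev : Atom → ℕ),
      A ⊆ M ∧ A.card = n ∧ ∀ p ∈ A, lev p < n ∧ ρ p ∈ P ∧ (ρ p).head = p ∧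
        (∀ s ∈ (ρ p).negBody, s ∉ M) ∧ ∀ q ∈ (ρ p).posBody, q ∈ A ∧ lev q < lev p := by
    intro n
    induction n with
    | zero => exact fun _ => ⟨∅, fun _ => ⟨[], [], []⟩, fun _ => 0, by simp⟩
    | succ n ih =>
      intro hn
      obtain ⟨A, ρ, lev, hA, hc, hp⟩ := ih (by omega)
      have hnot : ¬ (P.reduct M).IsModel A := fun hmod => by
        have := Finset.card_le_card (hmin hmod)
        omega
      have : ∃ r ∈ P.reduct M, r.BodyHolds A ∧ r.head ∉ A := by
        by_contra! hcon
        exact hnot ⟨hA.trans hsub, hcon⟩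
      obtain ⟨r', hr', hb, hh⟩ := this
      obtain ⟨r, hr, hneg, rfl⟩ := Program.mem_reduct.1 hr'
      have hmem : r.head ∈ M := hM ⟨r.head, r.posBody, []⟩ hr' ⟨fun q hq => hA (hb.1 q hq), by simp⟩
      refine ⟨insert r.head A, update ρ r.head r, update lev r.head n,
        Finset.insert_subset hmem hA, by rw [Finset.card_insert_of_notMem hh, hc], fun p hpA => ?_⟩
      have hlev : ∀ q ∈ A, update lev r.head n q = lev q := fun q hq =>
        update_of_ne (by rintro rfl; exact hh hq) _ _
      rcases eq_or_ne p r.head with rfl | hne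
      · rw [update_self, update_self]
        refine ⟨by omega, hr, rfl, hneg, fun q hq => ?_⟩
        have hqA := hb.1 q hq
        exact ⟨Finset.mem_insert_of_mem hqA, by rw [hlev q hqA]; exact (hp q hqA).1⟩
      · have hpA' := Finset.mem_of_mem_insert_of_ne hpA hne
        obtain ⟨h1, h2, h3, h4, h5⟩ := hp p hpA'
        rw [hlev p hpA', update_of_ne hne]
        refine ⟨by omega, h2, h3, h4, fun q hq => ⟨Finset.mem_insert_of_mem (h5 q hq).1, ?_⟩⟩
        rw [hlev q (h5 q hq).1]
        exact (h5 q hq).2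
  obtain ⟨A, ρ, lev, hA, hc, hp⟩ := key _ le_rfl
  obtain rfl := Finset.eq_of_subset_of_card_le hA hc.ge
  refine ⟨ρ, lev, ⟨fun r hr hb => ?_, fun p h => (hp p h).2.1, fun p h => (hp p h).2.2.1,
    fun p h => ⟨fun q hq => ((hp p h).2.2.2.2 q hq).1, (hp p h).2.2.2.1⟩,
    fun p h q hq => .inr ((hp p h).2.2.2.2 q hq).2⟩, fun p h => (hp p h).1⟩
  exact hM ⟨r.head, r.posBody, []⟩ (Program.mem_reduct.2 ⟨r, hr, hb.2, rfl⟩) ⟨hb.1, by simp⟩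

theorem Program.Justified.isStableModel {P : Program} {M : Finset Atom}
    {ρ : Atom → Rule} {lev : Atom → ℕ} (h : P.Justified false M ρ lev) : P.IsStableModel M := by
  have hmem : ∀ p ∈ M, ⟨(ρ p).head, (ρ p).posBody, []⟩ ∈ P.reduct M := fun p hp =>
    Program.mem_reduct.2 ⟨ρ p, h.mem p hp, (h.body p hp).2, rfl⟩
  refine ⟨⟨fun p hp => Program.mem_atoms.2 ⟨_, hmem p hp, .inl (h.head p hp).symm⟩, ?_⟩, ?_⟩
  · intro r' hr' hb
    obtain ⟨r, hr, hneg, rfl⟩ := Program.mem_reduct.1 hr'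
    exact h.closed r hr ⟨hb.1, hneg⟩
  · intro N hN
    have : ∀ n, ∀ p ∈ M, lev p = n → p ∈ N := by
      intro n
      induction n using Nat.strong_induction_on with
      | _ n ih =>
        intro p hp hn
        rw [← h.head p hp]
        refine hN.2 ⟨(ρ p).head, (ρ p).posBody, []⟩ (hmem p hp) ⟨fun q hq => ?_, by simp⟩
        have := (h.lt p hp q hq).resolve_left (by simp)
        exact ih (lev q) (by omega) q ((h.body p hp).1 q hq) rfl
    exact fun p hp => this _ p hp rfl

/-- Without positive bodies there is nothing to order, so supported models are stable. -/
theorem Program.isStableModel_iff_of_negative {P : Program} (hP : P ∈ negativePrograms)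
    {M : Finset Atom} : P.IsStableModel M ↔ P.IsSupportedModel M := by
  constructor
  · intro h
    obtain ⟨ρ, lev, hj, -⟩ := h.exists_justified
    exact hj.isSupportedModel
  · intro h
    obtain ⟨ρ, lev, hj, -⟩ := h.exists_justified
    refine Justified.isStableModel (ρ := ρ) (lev := lev) ⟨hj.closed, hj.mem, hj.head, hj.body, fun p hp q hq => ?_⟩
    rw [hP _ (hj.mem p hp)] at hq
    simp at hq

end LPComplexity

namespace LPComplexity

open Function

/-! ### Names for the atoms of constructed formulas and programs -/

/-- A self-delimiting code of bit strings: every bit is preceded by `true`, and `false` ends the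
string. -/
def block (a : Atom) : Atom := (a.flatMap fun b => [true, b]) ++ [false]

/-- A self-delimiting code of numbers. -/
def natBlock (n : ℕ) : Atom := block (List.replicate n true)

/-- A self-delimiting code of lists of bit strings. -/
def blocks (l : List Atom) : Atom := (l.flatMap fun a => true :: block a) ++ [false]

theorem block_append_inj {a b s t : Atom} : block a ++ s = block b ++ t ↔ a = b ∧ s = t := by
  refine ⟨?_, by rintro ⟨rfl, rfl⟩; rfl⟩
  induction a generalizing b with
  | nil => cases b <;> simp [block]
  | cons x a ih =>
    cases b with
    | nil => simp [block]
    | cons y b =>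
      intro h
      simp only [block, List.flatMap_cons, List.cons_append, List.nil_append, List.cons.injEq,
        true_and] at h
      obtain ⟨rfl, h⟩ := h
      obtain ⟨rfl, h'⟩ := ih (b := b) h
      exact ⟨rfl, h'⟩

theorem natBlock_append_inj {m n : ℕ} {s t : Atom} :
    natBlock m ++ s = natBlock n ++ t ↔ m = n ∧ s = t := by
  simp [natBlock, block_append_inj, List.replicate_inj]

theorem blocks_append_inj {l l' : List Atom} {s t : Atom} :
    blocks l ++ s = blocks l' ++ t ↔ l = l' ∧ s = t := by
  refine ⟨?_, by rintro ⟨rfl, rfl⟩; rfl⟩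
  induction l generalizing l' with
  | nil => cases l' <;> simp [blocks]
  | cons x l ih =>
    cases l' with
    | nil => simp [blocks]
    | cons y l' =>
      intro h
      simp only [blocks, List.flatMap_cons, List.cons_append, List.append_assoc, List.cons.injEq,
        true_and, block_append_inj] at h
      obtain ⟨rfl, h⟩ := h
      obtain ⟨rfl, h'⟩ := ih (l' := l') (by simpa [blocks] using h)
      exact ⟨rfl, h'⟩

namespace Poly

variable {α : Type} [TreeCode α]

@[fun_prop]
theorem block {f : α → Atom} (hf : Poly f) : Poly (fun a => block (f a)) := by
  unfold LPComplexity.block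
  fun_prop

@[fun_prop]
theorem natBlock {f : α → ℕ} (hf : Poly f) : Poly (fun a => natBlock (f a)) := by
  unfold LPComplexity.natBlock
  fun_prop

@[fun_prop]
theorem blocks {f : α → List Atom} (hf : Poly f) : Poly (fun a => blocks (f a)) := by
  unfold LPComplexity.blocks
  fun_prop

end Poly

/-! ### A formula that expresses the existence of small models -/

/-- The atom of the formula that says that the atom `p` of the program is true. -/
def truthAtom (p : Atom) : Atom := false :: false :: p

/-- Atoms of the formula that are free to fill up the weight of a model. -/
def padAtom (j : ℕ) : Atom := false :: true :: List.replicate j true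

/-- The atom of the formula that says that the rule `u.2` justifies its head on level `u.1`. -/
def ruleAtom (u : ℕ × Rule) : Atom :=
  true :: (natBlock u.1 ++ (block u.2.head ++ (blocks u.2.posBody ++ blocks u.2.negBody)))

theorem truthAtom_inj {p q : Atom} : truthAtom p = truthAtom q ↔ p = q := by simp [truthAtom]

theorem padAtom_inj {i j : ℕ} : padAtom i = padAtom j ↔ i = j := by
  simp [padAtom, List.replicate_inj]

theorem ruleAtom_inj {u v : ℕ × Rule} : ruleAtom u = ruleAtom v ↔ u = v := by
  refine ⟨fun h => ?_, fun h => h ▸ rfl⟩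
  obtain ⟨i, ⟨a, b, c⟩⟩ := u
  obtain ⟨j, ⟨a', b', c'⟩⟩ := v
  have key := blocks_append_inj (l := c) (l' := c') (s := []) (t := [])
  simp_all [ruleAtom, natBlock_append_inj, block_append_inj, blocks_append_inj]

/-- The pairs of a level below `k` and a rule of `P`. -/
def levelRules (P : Program) (k : ℕ) : List (ℕ × Rule) :=
  (List.range k).flatMap fun i => P.map fun r => (i, r)

theorem mem_levelRules {P : Program} {k : ℕ} {u : ℕ × Rule} :
    u ∈ levelRules P k ↔ u.1 < k ∧ u.2 ∈ P := by
  obtain ⟨i, r⟩ := u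
  simp [levelRules]

/-- The formula whose models choose a set of true atoms of `P`, and for each of them exactly one
rule and one level below `k` that justify it. If `pad` is true, then the formula has `2 * k`
additional atoms that are free. -/
def justificationFormula (sup pad : Bool) (P : Program) (k : ℕ) : CNF :=
  ((levelRules P k).map fun u => [⟨false, ruleAtom u⟩, ⟨true, truthAtom u.2.head⟩]) ++
  (((P.flatMap fun r => r.head :: (r.posBody ++ r.negBody)).map fun p => ⟨false, truthAtom p⟩ ::
    (((levelRules P k).filter fun u => decide (u.2.head = p)).map fun u => ⟨true, ruleAtom u⟩)) ++
  (((levelRules P k).flatMap fun u => ((levelRules P k).filter fun v =>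
    decide (u.2.head = v.2.head) && !decide (ruleAtom u = ruleAtom v)).map fun v =>
      [⟨false, ruleAtom u⟩, ⟨false, ruleAtom v⟩]) ++
  (((levelRules P k).flatMap fun u => u.2.posBody.map fun q => ⟨false, ruleAtom u⟩ ::
    (((levelRules P k).filter fun v => decide (v.2.head = q) && (sup || decide (v.1 < u.1))).map
      fun v => ⟨true, ruleAtom v⟩)) ++
  (((levelRules P k).flatMap fun u => u.2.negBody.map fun s =>
    [⟨false, ruleAtom u⟩, ⟨false, truthAtom s⟩]) ++
  ((P.map fun r => ⟨true, truthAtom r.head⟩ :: ((r.posBody.map fun q => ⟨false, truthAtom q⟩) ++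
    (r.negBody.map fun s => ⟨true, truthAtom s⟩))) ++
  (bif pad then (List.range (k + k)).map fun j => [⟨true, padAtom j⟩, ⟨false, padAtom j⟩]
    else []))))))

theorem CNF.mem_atoms {F : CNF} {a : Atom} : a ∈ F.atoms ↔ ∃ c ∈ F, ∃ l ∈ c, l.atom = a := by
  simp [CNF.atoms]

theorem mem_atoms_justificationFormula {sup pad : Bool} {P : Program} {k : ℕ} {a : Atom} :
    a ∈ (justificationFormula sup pad P k).atoms ↔
      (∃ p ∈ P.atoms, truthAtom p = a) ∨ (∃ u ∈ levelRules P k, ruleAtom u = a) ∨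
        pad = true ∧ ∃ j < k + k, padAtom j = a := by
  rw [CNF.mem_atoms]
  constructor
  · rintro ⟨c, hc, l, hl, rfl⟩
    simp only [justificationFormula, List.mem_append, List.mem_map, List.mem_flatMap,
      List.mem_filter] at hc
    rcases hc with ⟨u, hu, rfl⟩ | ⟨p, ⟨r, hr, hp⟩, rfl⟩ | ⟨u, hu, v, ⟨hv, -⟩, rfl⟩ |
      ⟨u, hu, q, hq, rfl⟩ | ⟨u, hu, s, hs, rfl⟩ | ⟨r, hr, rfl⟩ | hc
    · simp only [List.mem_cons, List.not_mem_nil, or_false] at hl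
      rcases hl with rfl | rfl
      · exact .inr (.inl ⟨u, hu, rfl⟩)
      · exact .inl ⟨_, Program.mem_atoms.2 ⟨u.2, (mem_levelRules.1 hu).2, .inl rfl⟩, rfl⟩
    · simp only [List.mem_cons, List.mem_map, List.mem_filter] at hl
      rcases hl with rfl | ⟨u, ⟨hu, -⟩, rfl⟩
      · exact .inl ⟨p, Program.mem_atoms.2 ⟨r, hr, by simpa using hp⟩, rfl⟩
      · exact .inr (.inl ⟨u, hu, rfl⟩)
    · simp only [List.mem_cons, List.not_mem_nil, or_false] at hl
      rcases hl with rfl | rfl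
      · exact .inr (.inl ⟨u, hu, rfl⟩)
      · exact .inr (.inl ⟨v, hv, rfl⟩)
    · simp only [List.mem_cons, List.mem_map, List.mem_filter] at hl
      rcases hl with rfl | ⟨v, ⟨hv, -⟩, rfl⟩
      · exact .inr (.inl ⟨u, hu, rfl⟩)
      · exact .inr (.inl ⟨v, hv, rfl⟩)
    · simp only [List.mem_cons, List.not_mem_nil, or_false] at hl
      rcases hl with rfl | rfl
      · exact .inr (.inl ⟨u, hu, rfl⟩)
      · exact .inl ⟨s, Program.mem_atoms.2 ⟨u.2, (mem_levelRules.1 hu).2, .inr (.inr hs)⟩, rfl⟩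
    · simp only [List.mem_cons, List.mem_append, List.mem_map] at hl
      rcases hl with rfl | ⟨q, hq, rfl⟩ | ⟨s, hs, rfl⟩
      · exact .inl ⟨_, Program.mem_atoms.2 ⟨r, hr, .inl rfl⟩, rfl⟩
      · exact .inl ⟨_, Program.mem_atoms.2 ⟨r, hr, .inr (.inl hq)⟩, rfl⟩
      · exact .inl ⟨_, Program.mem_atoms.2 ⟨r, hr, .inr (.inr hs)⟩, rfl⟩
    · cases pad with
      | false => simp at hc
      | true =>
        simp only [cond_true, List.mem_map, List.mem_range] at hc
        obtain ⟨j, hj, rfl⟩ := hc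
        refine .inr (.inr ⟨rfl, j, hj, ?_⟩)
        simp only [List.mem_cons, List.not_mem_nil, or_false] at hl
        rcases hl with rfl | rfl <;> rfl
  · rintro (⟨p, hp, rfl⟩ | ⟨u, hu, rfl⟩ | ⟨rfl, j, hj, rfl⟩)
    · exact ⟨_, List.mem_append_right _ (List.mem_append_left _ (List.mem_map.2
        ⟨p, List.mem_toFinset.1 hp, rfl⟩)), _, List.mem_cons_self, rfl⟩
    · exact ⟨_, List.mem_append_left _ (List.mem_map.2 ⟨u, hu, rfl⟩), _, List.mem_cons_self, rfl⟩
    · refine ⟨[⟨true, padAtom j⟩, ⟨false, padAtom j⟩], ?_, _, List.mem_cons_self, rfl⟩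
      iterate 6 refine List.mem_append_right _ ?_
      exact List.mem_map.2 ⟨j, List.mem_range.2 hj, rfl⟩

theorem exists_holds_pos_cons {a : Atom} {c : List Literal} {N : Finset Atom} :
    (∃ l ∈ ⟨true, a⟩ :: c, l.Holds N) ↔ a ∈ N ∨ ∃ l ∈ c, l.Holds N := by
  simp [Literal.Holds]

theorem exists_holds_neg_cons {a : Atom} {c : List Literal} {N : Finset Atom} :
    (∃ l ∈ ⟨false, a⟩ :: c, l.Holds N) ↔ (a ∈ N → ∃ l ∈ c, l.Holds N) := by
  simp [Literal.Holds, imp_iff_not_or]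

theorem exists_holds_map {β : Type} {b : Bool} {g : β → Atom} {l : List β} {N : Finset Atom} :
    (∃ x ∈ l.map (fun v => Literal.mk b (g v)), x.Holds N) ↔
      ∃ v ∈ l, (Literal.mk b (g v)).Holds N := by
  simp

theorem justificationFormula_holds_iff {sup pad : Bool} {P : Program} {k : ℕ} {N : Finset Atom} :
    (∀ c ∈ justificationFormula sup pad P k, ∃ l ∈ c, l.Holds N) ↔
      (∀ u ∈ levelRules P k, ruleAtom u ∈ N → truthAtom u.2.head ∈ N) ∧
      (∀ p ∈ P.atoms, truthAtom p ∈ N →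
        ∃ u ∈ levelRules P k, u.2.head = p ∧ ruleAtom u ∈ N) ∧
      (∀ u ∈ levelRules P k, ∀ v ∈ levelRules P k, ruleAtom u ∈ N → ruleAtom v ∈ N →
        u.2.head = v.2.head → u = v) ∧
      (∀ u ∈ levelRules P k, ruleAtom u ∈ N → ∀ q ∈ u.2.posBody, ∃ v ∈ levelRules P k,
        v.2.head = q ∧ (sup = true ∨ v.1 < u.1) ∧ ruleAtom v ∈ N) ∧
      (∀ u ∈ levelRules P k, ruleAtom u ∈ N → ∀ s ∈ u.2.negBody, truthAtom s ∉ N) ∧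
      (∀ r ∈ P, (∀ q ∈ r.posBody, truthAtom q ∈ N) → (∀ s ∈ r.negBody, truthAtom s ∉ N) →
        truthAtom r.head ∈ N) := by
  rw [justificationFormula, List.forall_mem_append, List.forall_mem_append,
    List.forall_mem_append, List.forall_mem_append, List.forall_mem_append,
    List.forall_mem_append, Program.atoms]
  refine and_congr ?_ (and_congr ?_ (and_congr ?_ (and_congr ?_ (and_congr ?_ ?_))))
  · rw [List.forall_mem_map]
    refine forall₂_congr fun u _ => ?_
    rw [exists_holds_neg_cons, exists_holds_pos_cons]
    simp
  · rw [List.forall_mem_map]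
    simp only [List.mem_toFinset]
    refine forall₂_congr fun p _ => ?_
    rw [exists_holds_neg_cons, exists_holds_map]
    simp [Literal.Holds, and_assoc]
  · rw [List.forall_mem_flatMap]
    refine forall₂_congr fun u _ => ?_
    rw [List.forall_mem_map]
    simp only [exists_holds_neg_cons, List.mem_filter, ruleAtom_inj, Bool.and_eq_true,
      decide_eq_true_eq, Bool.not_eq_true', decide_eq_false_iff_not]
    refine forall_congr' fun v => ⟨fun h hv hu' hv' he => ?_, fun h hv hu' hv' => ?_⟩
    · by_contra hne
      simpa using h ⟨hv, he, hne⟩ hu' hv'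
    · exact absurd (h hv.1 hu' hv' hv.2.1) hv.2.2
  · rw [List.forall_mem_flatMap]
    refine forall₂_congr fun u _ => ?_
    rw [List.forall_mem_map]
    simp only [exists_holds_neg_cons, exists_holds_map]
    refine ⟨fun h hu q hq => ?_, fun h q hq hu => ?_⟩
    · simpa [Literal.Holds, and_assoc] using h q hq hu
    · simpa [Literal.Holds, and_assoc] using h hu q hq
  · rw [List.forall_mem_flatMap]
    refine forall₂_congr fun u _ => ?_
    rw [List.forall_mem_map]
    simp only [exists_holds_neg_cons]
    exact ⟨fun h hu q hq hs => by simpa using h q hq hu hs, fun h q hq hu hs => absurd hs (h hu q hq)⟩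
  · rw [List.forall_mem_map]
    have hpad : ∀ c ∈ (bif pad then (List.range (k + k)).map fun j =>
        [Literal.mk true (padAtom j), Literal.mk false (padAtom j)] else []),
        ∃ l ∈ c, l.Holds N := by
      cases pad with
      | false => simp
      | true =>
        rw [cond_true, List.forall_mem_map]
        intro j _
        rw [exists_holds_pos_cons]
        by_cases h : padAtom j ∈ N <;> simp [h, Literal.Holds]
    rw [and_iff_left hpad]
    refine forall₂_congr fun r _ => ?_
    simp only [exists_holds_pos_cons, List.mem_append, or_and_right, exists_or, exists_holds_map]
    simp only [Literal.Holds, if_true, Bool.false_eq_true, if_false]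
    constructor
    · rintro (h | ⟨q, hq, h⟩ | ⟨s, hs, h⟩) h1 h2
      · exact h
      · exact absurd (h1 q hq) h
      · exact absurd h (h2 s hs)
    · intro h
      by_contra! hcon
      exact hcon.1 (h hcon.2.1 hcon.2.2)

/-- A model of the formula has two true atoms for each true atom of the program, one that names
it and one that names its justifying rule; the additional atoms fill up the weight. -/
theorem exists_model_justificationFormula_iff {sup pad : Bool} {P : Program} {k : ℕ} :
    (∃ N, (justificationFormula sup pad P k).IsModel N ∧ N.card = k + k) ↔
      ∃ M ρ lev, P.Justified sup M ρ lev ∧ (∀ p ∈ M, lev p < k) ∧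
        M.card ≤ k ∧ (pad = false → M.card = k) := by
  simp only [CNF.IsModel, justificationFormula_holds_iff]
  constructor
  · rintro ⟨N, ⟨hsub, h1, h2, h3, h4, h5, h6⟩, hcard⟩
    have : ∀ p : Atom, ∃ u : ℕ × Rule, p ∈ P.atoms → truthAtom p ∈ N →
        u ∈ levelRules P k ∧ u.2.head = p ∧ ruleAtom u ∈ N := by
      intro p
      by_cases hp : p ∈ P.atoms ∧ truthAtom p ∈ N
      · obtain ⟨u, hu⟩ := h2 p hp.1 hp.2
        exact ⟨u, fun _ _ => hu⟩
      · exact ⟨(0, ⟨[], [], []⟩), fun h h' => absurd ⟨h, h'⟩ hp⟩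
    choose u hu using this
    have hhead : ∀ v ∈ levelRules P k, v.2.head ∈ P.atoms := fun v hv =>
      Program.mem_atoms.2 ⟨v.2, (mem_levelRules.1 hv).2, .inl rfl⟩
    set M := P.atoms.filter fun p => truthAtom p ∈ N with hM
    have hmem : ∀ p, p ∈ M ↔ p ∈ P.atoms ∧ truthAtom p ∈ N := fun p => by
      rw [hM, Finset.mem_filter]
    replace hu : ∀ p ∈ M, u p ∈ levelRules P k ∧ (u p).2.head = p ∧ ruleAtom (u p) ∈ N :=
      fun p hp => hu p ((hmem p).1 hp).1 ((hmem p).1 hp).2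
    have huniq : ∀ v ∈ levelRules P k, ruleAtom v ∈ N → v.2.head ∈ M ∧ u v.2.head = v := by
      intro v hv hvN
      have hM' := (hmem _).2 ⟨hhead v hv, h1 v hv hvN⟩
      obtain ⟨hu1, hu2, hu3⟩ := hu _ hM'
      exact ⟨hM', h3 _ hu1 _ hv hu3 hvN hu2⟩
    have hlow : M.card + M.card ≤ N.card ∧ (pad = false → N.card = M.card + M.card) := by
      have hc1 : (M.image truthAtom).card = M.card :=
        Finset.card_image_of_injective _ fun _ _ => truthAtom_inj.1
      have hc2 : (M.image fun p => ruleAtom (u p)).card = M.card :=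
        Finset.card_image_of_injOn fun p hp q hq h => by
          rw [← (hu p hp).2.1, ruleAtom_inj.1 h, (hu q hq).2.1]
      have hd : Disjoint (M.image truthAtom) (M.image fun p => ruleAtom (u p)) := by
        simp [Finset.disjoint_left, truthAtom, ruleAtom]
      have hsub' : M.image truthAtom ∪ M.image (fun p => ruleAtom (u p)) ⊆ N := by
        intro a ha
        simp only [Finset.mem_union, Finset.mem_image] at ha
        rcases ha with ⟨p, hp, rfl⟩ | ⟨p, hp, rfl⟩
        · exact ((hmem p).1 hp).2
        · exact (hu p hp).2.2
      rw [← Finset.card_union_of_disjoint hd |>.trans (congrArg₂ _ hc1 hc2)]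
      refine ⟨Finset.card_le_card hsub', fun hpad => congrArg _ (subset_antisymm ?_ hsub')⟩
      intro a ha
      simp only [Finset.mem_union, Finset.mem_image]
      rcases mem_atoms_justificationFormula.1 (hsub ha) with ⟨p, hp, rfl⟩ | ⟨v, hv, rfl⟩ | ⟨h, -⟩
      · exact .inl ⟨p, (hmem p).2 ⟨hp, ha⟩, rfl⟩
      · exact .inr ⟨_, (huniq v hv ha).1, by rw [(huniq v hv ha).2]⟩
      · simp [hpad] at h
    refine ⟨M, fun p => (u p).2, fun p => (u p).1, ⟨?_, ?_, ?_, ?_, ?_⟩,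
      fun p hp => (mem_levelRules.1 (hu p hp).1).1, by omega, fun h => by have := hlow.2 h; omega⟩
    · intro r hr hb
      refine (hmem _).2 ⟨Program.mem_atoms.2 ⟨r, hr, .inl rfl⟩, h6 r hr
        (fun q hq => ((hmem q).1 (hb.1 q hq)).2) fun s hs hsN => hb.2 s hs ((hmem s).2
          ⟨Program.mem_atoms.2 ⟨r, hr, .inr (.inr hs)⟩, hsN⟩)⟩
    · exact fun p hp => (mem_levelRules.1 (hu p hp).1).2
    · exact fun p hp => (hu p hp).2.1
    · refine fun p hp => ⟨fun q hq => ?_, fun s hs hsM => ?_⟩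
      · obtain ⟨v, hv, rfl, -, hvN⟩ := h4 _ (hu p hp).1 (hu p hp).2.2 q hq
        exact (huniq v hv hvN).1
      · exact h5 _ (hu p hp).1 (hu p hp).2.2 s hs ((hmem s).1 hsM).2
    · intro p hp q hq
      obtain ⟨v, hv, rfl, hlt, hvN⟩ := h4 _ (hu p hp).1 (hu p hp).2.2 q hq
      rw [(huniq v hv hvN).2]
      exact hlt
  · rintro ⟨M, ρ, lev, hj, hlev, hle, hpad⟩
    set N := M.image truthAtom ∪ M.image (fun p => ruleAtom (lev p, ρ p)) ∪
      (Finset.range (k + k - (M.card + M.card))).image padAtom with hN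
    have ht : ∀ p, truthAtom p ∈ N ↔ p ∈ M := fun p => by
      simp [hN, truthAtom_inj]
      simp [truthAtom, ruleAtom, padAtom]
    have hr : ∀ u, ruleAtom u ∈ N ↔ ∃ p ∈ M, (lev p, ρ p) = u := fun u => by
      simp [hN, ruleAtom_inj]
      simp [truthAtom, ruleAtom, padAtom]
    have hU : ∀ p ∈ M, (lev p, ρ p) ∈ levelRules P k := fun p hp =>
      mem_levelRules.2 ⟨hlev p hp, hj.mem p hp⟩
    refine ⟨N, ⟨?_, ?_, ?_, ?_, ?_, ?_, ?_⟩, ?_⟩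
    · intro a ha
      rw [mem_atoms_justificationFormula]
      simp only [hN, Finset.mem_union, Finset.mem_image, Finset.mem_range] at ha
      rcases ha with (⟨p, hp, rfl⟩ | ⟨p, hp, rfl⟩) | ⟨j, hj', rfl⟩
      · exact .inl ⟨p, hj.subset_atoms hp, rfl⟩
      · exact .inr (.inl ⟨_, hU p hp, rfl⟩)
      · cases pad with
        | true => exact .inr (.inr ⟨rfl, j, by omega, rfl⟩)
        | false => have := hpad rfl; omega
    · rintro u - hu
      obtain ⟨p, hp, rfl⟩ := (hr u).1 hu
      rw [ht, hj.head p hp]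
      exact hp
    · intro p _ hp
      rw [ht] at hp
      exact ⟨_, hU p hp, hj.head p hp, (hr _).2 ⟨p, hp, rfl⟩⟩
    · rintro u - v - hu hv he
      obtain ⟨p, hp, rfl⟩ := (hr u).1 hu
      obtain ⟨q, hq, rfl⟩ := (hr v).1 hv
      rw [hj.head p hp, hj.head q hq] at he
      rw [he]
    · rintro u - hu q hq
      obtain ⟨p, hp, rfl⟩ := (hr u).1 hu
      have hqM := (hj.body p hp).1 q hq
      exact ⟨_, hU q hqM, hj.head q hqM, hj.lt p hp q hq, (hr _).2 ⟨q, hqM, rfl⟩⟩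
    · rintro u - hu s hs
      obtain ⟨p, hp, rfl⟩ := (hr u).1 hu
      rw [ht]
      exact (hj.body p hp).2 s hs
    · intro r hrP hpos hneg
      simp only [ht] at hpos hneg ⊢
      exact hj.closed r hrP ⟨hpos, hneg⟩
    · have hc1 : (M.image truthAtom).card = M.card :=
        Finset.card_image_of_injective _ fun _ _ => truthAtom_inj.1
      have hc2 : (M.image fun p => ruleAtom (lev p, ρ p)).card = M.card :=
        Finset.card_image_of_injOn fun p hp q hq h => by
          have := congrArg (fun u => u.2.head) (ruleAtom_inj.1 h)
          simpa only [hj.head p hp, hj.head q hq] using this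
      have hc3 : ((Finset.range (k + k - (M.card + M.card))).image padAtom).card =
          k + k - (M.card + M.card) := by
        rw [Finset.card_image_of_injective _ fun _ _ => padAtom_inj.1, Finset.card_range]
      rw [hN, Finset.card_union_of_disjoint, Finset.card_union_of_disjoint, hc1, hc2, hc3]
      · omega
      · simp [Finset.disjoint_left, truthAtom, ruleAtom]
      · simp [Finset.disjoint_left, truthAtom, ruleAtom, padAtom, or_imp, forall_and]

end LPComplexity

namespace LPComplexity

/-! ### The eight problems belong to W[2] -/

theorem CNF.encode_injective : Function.Injective CNF.encode :=
  Function.LeftInverse.injective parseCNF_encode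

theorem CNF.encode_ne_one (F : CNF) : [Sym.one] ≠ F.encode := by
  cases F <;> simp [CNF.encode]

theorem Program.encode_ne_one (P : Program) : [Sym.one] ≠ P.encode := by
  cases P <;> simp [Program.encode, Rule.encode]

theorem zero_ne_encodeNat (k : ℕ) : [Sym.zero] ≠ encodeNat k := by
  intro h
  have : Sym.zero ∈ encodeNat k := h ▸ List.mem_singleton_self _
  simp [encodeNat] at this

/-- The test whether a word is the code of a number. -/
def isUnary (y : Word) : Bool := y.all fun s => decide (s = .one)

theorem isUnary_iff {y : Word} : isUnary y = true ↔ y = encodeNat y.length := by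
  simp [isUnary, encodeNat, List.eq_replicate_iff]

theorem isUnary_encodeNat (k : ℕ) : isUnary (encodeNat k) = true := by
  simp [isUnary, encodeNat]

theorem length_encodeNat (k : ℕ) : (encodeNat k).length = k := List.length_replicate

@[fun_prop]
theorem Poly.isUnary {α : Type} [TreeCode α] {f : α → Word} (hf : Poly f) :
    Poly (fun a => isUnary (f a)) := by
  unfold LPComplexity.isUnary
  fun_prop

theorem Poly.justificationFormula (sup pad : Bool) :
    Poly (fun w : Program × ℕ => justificationFormula sup pad w.1 w.2) := by
  unfold LPComplexity.justificationFormula levelRules truthAtom padAtom ruleAtom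
  fun_prop

/-- A problem on programs is in W[2] if its models are the sets of atoms that can be justified by
rules. The formula gets twice the weight, as each true atom comes with its justification. Words
that encode no instance are mapped to words that encode no instance. -/
theorem modelProblem_mem_W2 {D : Program → Finset Atom → Prop} {Δ : ℕ → ℕ → Prop}
    {C : Set Program} {sup pad : Bool} {test : Program → Bool}
    (hD : ∀ P M, D P M → ∃ ρ lev, P.Justified sup M ρ lev ∧ ∀ p ∈ M, lev p < M.card)
    (hD' : ∀ P M ρ lev, P.Justified sup M ρ lev → D P M)
    (hΔ : ∀ m k, Δ m k ↔ m ≤ k ∧ (pad = false → m = k))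
    (hC : ∀ P, P ∈ C ↔ test P = true) (htest : Poly test) : modelProblem D Δ C ∈ W2 := by
  have key : ∀ (P : Program) (k : ℕ), (∃ M, D P M ∧ Δ M.card k) ↔
      ∃ N, (justificationFormula sup pad P k).IsModel N ∧ N.card = k + k := by
    intro P k
    rw [exists_model_justificationFormula_iff]
    constructor
    · rintro ⟨M, hM, hk⟩
      obtain ⟨ρ, lev, hj, hlev⟩ := hD P M hM
      rw [hΔ] at hk
      exact ⟨M, ρ, lev, hj, fun p hp => (hlev p hp).trans_le hk.1, hk⟩
    · rintro ⟨M, ρ, lev, hj, -, hk⟩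
      exact ⟨M, hD' P M ρ lev hj, (hΔ _ _).2 hk⟩
  -- The word `[.one]` encodes no formula and `[.zero]` encodes no number.
  refine reduces_of_poly
    (F := fun w => bif decide ((parseProgram w.1).encode = w.1) && test (parseProgram w.1) then
      (justificationFormula sup pad (parseProgram w.1) w.2.length).encode else [.one])
    (G := fun y => bif isUnary y then y ++ y else [.zero]) ?_ (by fun_prop) fun x y => ?_
  · have h1 : Poly fun w : Word × Word => parseProgram w.1 := Poly.parseProgram.comp Poly.fst
    have h2 := htest.comp h1
    have h3 : Poly fun w : Word × Word =>
        justificationFormula sup pad (parseProgram w.1) w.2.length :=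
      (Poly.justificationFormula sup pad).comp (h1.pair (Poly.length Poly.snd))
    exact Poly.cond (((h1.program_encode).decide_word Poly.fst).and h2) h3.cnf_encode
      (Poly.const _)
  · constructor
    · rintro ⟨P, k, hP, hw, hM⟩
      obtain ⟨rfl, rfl⟩ := Prod.mk.inj hw
      obtain ⟨N, hN⟩ := (key P k).1 hM
      refine ⟨justificationFormula sup pad P k, k + k, ?_, N, hN⟩
      simp only [parseProgram_encode, (hC P).1 hP, isUnary_encodeNat, length_encodeNat,
        decide_true, Bool.and_true, cond_true, Prod.mk.injEq, true_and]
      rw [encodeNat, encodeNat, List.replicate_append_replicate]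
    · rintro ⟨F, k', hw, N, hN, hk'⟩
      obtain ⟨hF, hG⟩ := Prod.mk.inj hw
      cases hc : decide ((parseProgram x).encode = x) && test (parseProgram x) with
      | false => exact absurd hF (by simpa only [hc, cond_false] using F.encode_ne_one)
      | true =>
      cases hy : isUnary y with
      | false => exact absurd hG (by simpa only [hy, cond_false] using zero_ne_encodeNat k')
      | true =>
      simp only [hc, hy, cond_true] at hF hG
      simp only [Bool.and_eq_true, decide_eq_true_eq] at hc
      have hlen := congrArg List.length hG
      rw [List.length_append, length_encodeNat] at hlen
      obtain rfl := CNF.encode_injective hF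
      refine ⟨parseProgram x, y.length, (hC _).2 hc.2, ?_, (key _ _).2 ⟨N, hN, by omega⟩⟩
      rw [hc.1, ← isUnary_iff.1 hy]

theorem mem_negativePrograms_iff (P : Program) :
    P ∈ negativePrograms ↔ (P.all fun r => r.posBody.isEmpty) = true := by
  simp [negativePrograms]

/-- With padding, the weight of the formula only bounds the size of the model. -/
theorem le_iff_le_and (m k : ℕ) : m ≤ k ↔ m ≤ k ∧ (true = false → m = k) := by simp

/-- Without padding, the weight of the formula determines the size of the model. -/
theorem eq_iff_le_and (m k : ℕ) : m = k ↔ m ≤ k ∧ (false = false → m = k) := by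
  simp only [forall_const]
  omega

theorem stable_mem_W2 {Δ : ℕ → ℕ → Prop} {C : Set Program} {pad : Bool} {test : Program → Bool}
    (hΔ : ∀ m k, Δ m k ↔ m ≤ k ∧ (pad = false → m = k))
    (hC : ∀ P, P ∈ C ↔ test P = true) (htest : Poly test) : ST Δ C ∈ W2 :=
  modelProblem_mem_W2 (sup := false) (fun _ _ h => h.exists_justified)
    (fun _ _ _ _ h => h.isStableModel) hΔ hC htest

theorem supported_mem_W2 {Δ : ℕ → ℕ → Prop} {C : Set Program} {pad : Bool}
    {test : Program → Bool} (hΔ : ∀ m k, Δ m k ↔ m ≤ k ∧ (pad = false → m = k))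
    (hC : ∀ P, P ∈ C ↔ test P = true) (htest : Poly test) : SP Δ C ∈ W2 :=
  modelProblem_mem_W2 (sup := true) (fun _ _ h => h.exists_justified)
    (fun _ _ _ _ h => h.isSupportedModel) hΔ hC htest

theorem Poly.isNegative : Poly (fun P : Program => P.all fun r => r.posBody.isEmpty) := by
  fun_prop

end LPComplexity

namespace LPComplexity

open Function

/-! ### Purely negative programs that choose one element of each group -/

/-- A gap `(i, a, b)`: the numbers `a` and `b` are the consecutive elements with the positions `i`
and `i + 1` of a set of numbers that is listed increasingly. -/
abbrev Gap : Type := ℕ × ℕ × ℕ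

/-- The atom of the program for a gap. -/
def gapAtom (g : Gap) : Atom :=
  true :: (natBlock g.1 ++ (natBlock g.2.1 ++ natBlock g.2.2))

/-- The atom that is false in all supported models. -/
def falseAtom : Atom := [false]

theorem gapAtom_inj {g h : Gap} : gapAtom g = gapAtom h ↔ g = h := by
  refine ⟨fun e => ?_, fun e => e ▸ rfl⟩
  obtain ⟨i, a, b⟩ := g
  obtain ⟨j, c, d⟩ := h
  have key := natBlock_append_inj (m := b) (n := d) (s := []) (t := [])
  simp_all [gapAtom, natBlock_append_inj]

theorem gapAtom_ne_falseAtom (g : Gap) : gapAtom g ≠ falseAtom := by simp [gapAtom, falseAtom]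

/-- The program whose supported models choose exactly one element of `G` for each first component
that occurs, and at least one element of each set in `C`. -/
def choiceProgram (G : List Gap) (C : List (List Gap)) : Program :=
  (G.map fun g => ⟨gapAtom g, [],
    (G.filter fun h => decide (h.1 = g.1) && !decide (gapAtom h = gapAtom g)).map gapAtom⟩) ++
  C.map fun S => ⟨falseAtom, [], falseAtom :: S.map gapAtom⟩

theorem choiceProgram_negative (G : List Gap) (C : List (List Gap)) :
    choiceProgram G C ∈ negativePrograms := by
  intro r hr
  simp only [choiceProgram, List.mem_append, List.mem_map] at hr
  rcases hr with ⟨_, _, rfl⟩ | ⟨_, _, rfl⟩ <;> rfl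

theorem exists_rule_choiceProgram {G : List Gap} {C : List (List Gap)} {p : Atom}
    {M : Finset Atom} : (∃ r ∈ choiceProgram G C, r.head = p ∧ r.BodyHolds M) ↔
      (∃ g ∈ G, gapAtom g = p ∧ ∀ h ∈ G, h.1 = g.1 → h ≠ g → gapAtom h ∉ M) ∨
        falseAtom = p ∧ falseAtom ∉ M ∧ ∃ S ∈ C, ∀ g ∈ S, gapAtom g ∉ M := by
  simp only [choiceProgram, List.mem_append, or_and_right, exists_or, List.mem_map,
    exists_exists_and_eq_and, Rule.BodyHolds]
  refine or_congr (exists_congr fun g => and_congr_right fun _ => and_congr_right fun _ => ?_) ?_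
  · simp only [List.not_mem_nil, false_imp_iff, implies_true, true_and,
      List.mem_filter, gapAtom_inj, Bool.and_eq_true, Bool.not_eq_true', decide_eq_true_eq,
      decide_eq_false_iff_not, forall_exists_index, and_imp]
    exact ⟨fun h x hx h1 h2 => h _ x hx h1 h2 rfl, fun h _ x hx h1 h2 e => e ▸ h x hx h1 h2⟩
  · simp only [List.not_mem_nil, false_imp_iff, implies_true, true_and, List.forall_mem_cons,
      List.forall_mem_map]
    exact ⟨fun ⟨S, hS, h1, h2, h3⟩ => ⟨h1, h2, S, hS, h3⟩,
      fun ⟨h1, h2, S, hS, h3⟩ => ⟨S, hS, h1, h2, h3⟩⟩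

/-- A rule `f ← not f, …` excludes the sets in which the rest of its body is true, as `f` can
neither be false nor be supported by it. -/
theorem choiceProgram_isSupportedModel_iff {G : List Gap} {C : List (List Gap)}
    {M : Finset Atom} : (choiceProgram G C).IsSupportedModel M ↔
      ∃ T : Finset Gap, (∀ g ∈ T, g ∈ G) ∧ T.image gapAtom = M ∧
        (∀ g ∈ G, g ∈ T ↔ ∀ h ∈ G, h.1 = g.1 → h ≠ g → h ∉ T) ∧ ∀ S ∈ C, ∃ g ∈ S, g ∈ T := by
  have hatom : ∀ g ∈ G, gapAtom g ∈ (choiceProgram G C).atoms := fun g hg =>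
    Program.mem_atoms.2 ⟨_, List.mem_append_left _ (List.mem_map.2 ⟨g, hg, rfl⟩), .inl rfl⟩
  simp only [Program.IsSupportedModel, exists_rule_choiceProgram]
  constructor
  · rintro ⟨hsub, hM⟩
    have hf : falseAtom ∉ M := fun hf => by
      rcases (hM _ (hsub hf)).1 hf with ⟨g, -, h, -⟩ | ⟨-, h, -⟩
      · exact gapAtom_ne_falseAtom g h
      · exact h hf
    have himg : (G.toFinset.filter fun g => gapAtom g ∈ M).image gapAtom = M := by
      ext p
      simp only [Finset.mem_image, Finset.mem_filter, List.mem_toFinset]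
      constructor
      · rintro ⟨g, ⟨-, h⟩, rfl⟩
        exact h
      · intro hp
        rcases (hM _ (hsub hp)).1 hp with ⟨g, hg, rfl, -⟩ | ⟨rfl, -⟩
        · exact ⟨g, ⟨hg, hp⟩, rfl⟩
        · exact absurd hp hf
    refine ⟨G.toFinset.filter fun g => gapAtom g ∈ M, by simp +contextual, himg, ?_, ?_⟩
    · intro g hg
      simp only [Finset.mem_filter, List.mem_toFinset, hg, true_and, hM _ (hatom g hg),
        gapAtom_inj, (gapAtom_ne_falseAtom g).symm, false_and, or_false]
      constructor
      · rintro ⟨g', -, rfl, h⟩ x hx h1 h2 h3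
        exact h x hx h1 h2 h3.2
      · exact fun h => ⟨g, hg, rfl, fun x hx h1 h2 h3 => h x hx h1 h2 ⟨hx, h3⟩⟩
    · intro S hS
      by_contra! hcon
      have hfa : falseAtom ∈ (choiceProgram G C).atoms := Program.mem_atoms.2
        ⟨_, List.mem_append_right _ (List.mem_map.2 ⟨S, hS, rfl⟩), .inl rfl⟩
      refine hf ((hM _ hfa).2 (.inr ⟨rfl, hf, S, hS, fun g hg hgM => ?_⟩))
      rw [← himg, Finset.mem_image] at hgM
      obtain ⟨g', hg', e⟩ := hgM
      exact hcon g hg (gapAtom_inj.1 e ▸ hg')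
  · rintro ⟨T, hTG, rfl, hT, hC⟩
    have hmem : ∀ g, gapAtom g ∈ T.image gapAtom ↔ g ∈ T := fun g => by simp [gapAtom_inj]
    have hf : falseAtom ∉ T.image gapAtom := by
      simp [gapAtom_ne_falseAtom]
    simp only [hmem]
    refine ⟨fun p hp => ?_, fun p _ => ⟨fun hp => ?_, ?_⟩⟩
    · obtain ⟨g, hg, rfl⟩ := Finset.mem_image.1 hp
      exact hatom g (hTG g hg)
    · obtain ⟨g, hg, rfl⟩ := Finset.mem_image.1 hp
      exact .inl ⟨g, hTG g hg, rfl, (hT g (hTG g hg)).1 hg⟩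
    · rintro (⟨g, hg, rfl, h⟩ | ⟨-, -, S, hS, h⟩)
      · exact (hmem g).2 ((hT g hg).2 h)
      · obtain ⟨g, hg, hgT⟩ := hC S hS
        exact absurd hgT (h g hg)

/-! ### Sets of numbers as chains of gaps -/

/-- The position of the first occurrence of `a` in `L`, counted from `1`. If `a` does not occur in
`L`, the value is `L.length` and has no meaning. -/
def position (L : List Atom) (a : Atom) : ℕ :=
  L.foldr (fun b n => bif decide (b = a) then 1 else n + 1) 0

theorem position_cons (b : Atom) (L : List Atom) (a : Atom) :
    position (b :: L) a = if b = a then 1 else position L a + 1 := by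
  by_cases h : b = a <;> simp [position, h]

theorem position_pos {L : List Atom} {a : Atom} (ha : a ∈ L) : 0 < position L a := by
  cases L with
  | nil => simp at ha
  | cons b L => rw [position_cons]; split <;> omega

theorem position_le (L : List Atom) (a : Atom) : position L a ≤ L.length := by
  induction L with
  | nil => rfl
  | cons b L ih => rw [position_cons, List.length_cons]; split <;> omega

theorem position_inj {L : List Atom} {a b : Atom} (ha : a ∈ L) (hb : b ∈ L)
    (h : position L a = position L b) : a = b := by
  induction L with
  | nil => simp at ha
  | cons c L ih =>
    have hpa : a ∈ L → 0 < position L a := position_pos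
    have hpb : b ∈ L → 0 < position L b := position_pos
    rw [position_cons, position_cons] at h
    rw [List.mem_cons] at ha hb
    split at h <;> split at h
    · simp_all
    · have := hpb (hb.resolve_left fun e => by simp_all)
      omega
    · have := hpa (ha.resolve_left fun e => by simp_all)
      omega
    · exact ih (ha.resolve_left fun e => by simp_all) (hb.resolve_left fun e => by simp_all)
        (by omega)

/-- The gaps of the sets of `k` positions of elements of `L`, where `0` and `L.length + 1` are
added to each set as its ends. -/
def gaps (L : List Atom) (k : ℕ) : List Gap :=
  (List.range (k + 1)).flatMap fun i => (List.range (L.length + 2)).flatMap fun a =>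
    ((List.range (L.length + 2)).filter fun b => decide (a < b) &&
      ((!decide (i = 0) || decide (a = 0)) &&
        (bif decide (i = k) then decide (b = L.length + 1)
          else L.any fun p => decide (position L p = b)))).map fun b => (i, a, b)

theorem mem_gaps {L : List Atom} {k : ℕ} {g : Gap} : g ∈ gaps L k ↔
    g.1 ≤ k ∧ g.2.2 ≤ L.length + 1 ∧ g.2.1 < g.2.2 ∧ (g.1 = 0 → g.2.1 = 0) ∧
      (g.1 = k → g.2.2 = L.length + 1) ∧ (g.1 ≠ k → ∃ p ∈ L, position L p = g.2.2) := by
  obtain ⟨i, a, b⟩ := g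
  simp only [gaps, List.mem_flatMap, List.mem_range, List.mem_map, List.mem_filter,
    Prod.mk.injEq]
  constructor
  · rintro ⟨i, hi, a, ha, b, ⟨hb, h⟩, rfl, rfl, rfl⟩
    by_cases hik : i = k <;> simp [hik] at h ⊢ <;> grind
  · rintro ⟨h1, h2, h3, h4, h5, h6⟩
    refine ⟨i, by omega, a, by omega, b, ⟨by omega, ?_⟩, rfl, rfl, rfl⟩
    by_cases hik : i = k <;> simp [hik] at h5 h6 ⊢ <;> grind

/-- The sets of gaps that a chain of gaps for a model of `F` has to meet. The first ones ask for a
gap in each place and for consecutive gaps to fit together, the last ones for the truth of the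
clauses: a positive literal is true if its atom ends a gap, a negative one if its atom lies inside
a gap. -/
def gapConstraints (L : List Atom) (F : CNF) (k : ℕ) : List (List Gap) :=
  ((List.range (k + 1)).map fun i => (gaps L k).filter fun g => decide (g.1 = i)) ++
  (((List.range k).flatMap fun i => (List.range (L.length + 2)).map fun c =>
    (gaps L k).filter fun g => (decide (g.1 = i) && !decide (g.2.2 = c)) ||
      (decide (g.1 = i + 1) && decide (g.2.1 = c))) ++
  (F.map fun c => (gaps L k).filter fun g => c.any fun l =>
    bif l.positive then decide (g.2.2 = position L l.atom)
    else decide (g.2.1 < position L l.atom) && decide (position L l.atom < g.2.2)))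

/-- The increasing sequence `s` lists `0`, the positions of `k` elements of `L`, and
`L.length + 1`, and makes the clauses of `F` true. -/
structure IsChain (L : List Atom) (F : CNF) (k : ℕ) (s : ℕ → ℕ) : Prop where
  strictMono : StrictMono s
  zero : s 0 = 0
  last : s (k + 1) = L.length + 1
  position : ∀ i < k, ∃ p ∈ L, position L p = s (i + 1)
  clause : ∀ c ∈ F, ∃ l ∈ c, ∃ i ≤ k,
    if l.positive then s (i + 1) = LPComplexity.position L l.atom
    else s i < LPComplexity.position L l.atom ∧ LPComplexity.position L l.atom < s (i + 1)

theorem isSupportedModel_gap_iff {L : List Atom} {F : CNF} {k : ℕ} {M : Finset Atom} :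
    (choiceProgram (gaps L k) (gapConstraints L F k)).IsSupportedModel M ↔
      ∃ s, IsChain L F k s ∧
        ((Finset.range (k + 1)).image fun i => gapAtom (i, s i, s (i + 1))) = M := by
  rw [choiceProgram_isSupportedModel_iff]
  constructor
  · rintro ⟨T, hTG, rfl, hT, hC⟩
    have huniq : ∀ g ∈ T, ∀ h ∈ T, h.1 = g.1 → h = g := fun g hg h hh e => by
      by_contra hne
      exact (hT g (hTG g hg)).1 hg h (hTG h hh) e hne hh
    have : ∀ i : ℕ, ∃ g : Gap, i ≤ k → g ∈ T ∧ g.1 = i := by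
      intro i
      by_cases hi : i ≤ k
      · obtain ⟨g, hg, hgT⟩ := hC ((gaps L k).filter fun g => decide (g.1 = i))
          (List.mem_append_left _ (List.mem_map.2 ⟨i, List.mem_range.2 (by omega), rfl⟩))
        exact ⟨g, fun _ => ⟨hgT, by simpa using (List.mem_filter.1 hg).2⟩⟩
      · exact ⟨(0, 0, 0), fun h => absurd h hi⟩
    choose e he using this
    have heG : ∀ i ≤ k, _ := fun i hi => mem_gaps.1 (hTG _ (he i hi).1)
    -- Beyond the last gap the sequence is continued by consecutive numbers.
    set s : ℕ → ℕ := fun i => if i ≤ k then (e i).2.1 else L.length + 1 + (i - (k + 1)) with hs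
    have hs1 : ∀ i ≤ k, s i = (e i).2.1 := fun i hi => if_pos hi
    have hs2 : ∀ i ≤ k, s (i + 1) = (e i).2.2 := by
      intro i hi
      rcases hi.lt_or_eq with hi' | rfl
      · obtain ⟨g, hg, hgT⟩ := hC ((gaps L k).filter fun g =>
          (decide (g.1 = i) && !decide (g.2.2 = (e i).2.2)) ||
            (decide (g.1 = i + 1) && decide (g.2.1 = (e i).2.2)))
          (List.mem_append_right _ (List.mem_append_left _ (List.mem_flatMap.2
            ⟨i, List.mem_range.2 hi', List.mem_map.2 ⟨(e i).2.2, List.mem_range.2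
              (by have := (heG i hi).2.1; omega), rfl⟩⟩)))
        have hg' := (List.mem_filter.1 hg).2
        simp only [Bool.or_eq_true, Bool.and_eq_true, decide_eq_true_eq, Bool.not_eq_true',
          decide_eq_false_iff_not] at hg'
        rw [hs1 _ hi']
        rcases hg' with ⟨h1, h2⟩ | ⟨h1, h2⟩
        · rw [huniq _ (he i hi).1 g hgT (h1.trans (he i hi).2.symm)] at h2
          exact absurd rfl h2
        · rw [← h2, huniq _ (he (i + 1) hi').1 g hgT (h1.trans (he (i + 1) hi').2.symm)]
      · rw [(heG i hi).2.2.2.2.1 (he i hi).2, hs]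
        simp
    have hei : ∀ i ≤ k, e i = (i, s i, s (i + 1)) := fun i hi => by
      rw [hs1 i hi, hs2 i hi]
      exact Prod.ext (he i hi).2 rfl
    have hTi : ∀ g ∈ T, g.1 ≤ k ∧ g = (g.1, s g.1, s (g.1 + 1)) := fun g hg => by
      have hg1 := (mem_gaps.1 (hTG g hg)).1
      exact ⟨hg1, by rw [← hei _ hg1]; exact huniq _ (he _ hg1).1 _ hg (he _ hg1).2.symm⟩
    refine ⟨s, ⟨strictMono_nat_of_lt_succ fun i => ?_, ?_, ?_, fun i hi => ?_, fun c hc => ?_⟩, ?_⟩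
    · by_cases hi : i ≤ k
      · rw [hs1 i hi, hs2 i hi]
        exact (heG i hi).2.2.1
      · simp only [hs, if_neg hi, if_neg (show ¬ i + 1 ≤ k by omega)]
        omega
    · rw [hs1 0 (Nat.zero_le _)]
      exact (heG 0 (Nat.zero_le _)).2.2.2.1 (he 0 (Nat.zero_le _)).2
    · rw [hs2 k le_rfl]
      exact (heG k le_rfl).2.2.2.2.1 (he k le_rfl).2
    · rw [hs2 i hi.le]
      exact (heG i hi.le).2.2.2.2.2 (by rw [(he i hi.le).2]; exact hi.ne)
    · obtain ⟨g, hg, hgT⟩ := hC _ (List.mem_append_right _ (List.mem_append_right _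
        (List.mem_map.2 ⟨c, hc, rfl⟩)))
      obtain ⟨l, hl, h⟩ := List.any_eq_true.1 (List.mem_filter.1 hg).2
      obtain ⟨hgk, hgs⟩ := hTi g hgT
      refine ⟨l, hl, g.1, hgk, ?_⟩
      rw [hgs] at h
      cases hp : l.positive <;> simpa [hp] using h
    · ext p
      simp only [Finset.mem_image, Finset.mem_range]
      constructor
      · rintro ⟨i, hi, rfl⟩
        exact ⟨_, (he i (by omega)).1, by rw [hei i (by omega)]⟩
      · rintro ⟨g, hg, rfl⟩
        exact ⟨g.1, by have := (hTi g hg).1; omega, by rw [← (hTi g hg).2]⟩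
  · rintro ⟨s, hs, rfl⟩
    have hmem : ∀ g : Gap, (g ∈ (Finset.range (k + 1)).image fun i => (i, s i, s (i + 1))) ↔
        g.1 ≤ k ∧ g = (g.1, s g.1, s (g.1 + 1)) := by
      intro g
      simp only [Finset.mem_image, Finset.mem_range]
      constructor
      · rintro ⟨i, hi, rfl⟩
        exact ⟨by simpa using Nat.le_of_lt_succ hi, rfl⟩
      · rintro ⟨h1, h2⟩
        exact ⟨g.1, by omega, h2.symm⟩
    have hG : ∀ i ≤ k, (i, s i, s (i + 1)) ∈ gaps L k := by
      refine fun i hi => mem_gaps.2 ⟨hi, ?_, hs.strictMono (Nat.lt_succ_self i), ?_, ?_, fun h =>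
        hs.position i (lt_of_le_of_ne hi h)⟩
      · rw [← hs.last]
        exact hs.strictMono.monotone (Nat.succ_le_succ hi)
      · rintro (rfl : i = 0)
        exact hs.zero
      · rintro (rfl : i = k)
        exact hs.last
    refine ⟨(Finset.range (k + 1)).image fun i => (i, s i, s (i + 1)), fun g hg => ?_,
      Finset.image_image, fun g hg => ?_, fun S hS => ?_⟩
    · rw [hmem] at hg
      rw [hg.2]
      exact hG _ hg.1
    · have hgk := (mem_gaps.1 hg).1
      simp only [hmem]
      constructor
      · rintro ⟨-, h⟩ x - h1 h2 ⟨-, h3⟩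
        rw [h1] at h3
        exact h2 (h3.trans h.symm)
      · intro h
        refine ⟨hgk, ?_⟩
        by_contra hne
        exact h _ (hG g.1 hgk) rfl (Ne.symm hne) ⟨hgk, rfl⟩
    · simp only [gapConstraints, List.mem_append, List.mem_map, List.mem_flatMap,
        List.mem_range] at hS
      rcases hS with ⟨i, hi, rfl⟩ | ⟨i, hi, c, -, rfl⟩ | ⟨c, hc, rfl⟩
      · exact ⟨(i, s i, s (i + 1)), List.mem_filter.2 ⟨hG i (by omega), by simp⟩,
          (hmem _).2 ⟨by simp; omega, rfl⟩⟩
      · by_cases hsc : s (i + 1) = c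
        · exact ⟨(i + 1, s (i + 1), s (i + 1 + 1)), List.mem_filter.2
            ⟨hG (i + 1) (by omega), by simp [hsc]⟩, (hmem _).2 ⟨by simp; omega, rfl⟩⟩
        · exact ⟨(i, s i, s (i + 1)), List.mem_filter.2 ⟨hG i (by omega), by simp [hsc]⟩,
            (hmem _).2 ⟨by simp; omega, rfl⟩⟩
      · obtain ⟨l, hl, i, hi, h⟩ := hs.clause c hc
        refine ⟨(i, s i, s (i + 1)), List.mem_filter.2 ⟨hG i hi, List.any_eq_true.2
          ⟨l, hl, ?_⟩⟩, (hmem _).2 ⟨hi, rfl⟩⟩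
        cases hp : l.positive <;> simpa [hp] using h

end LPComplexity

namespace LPComplexity

open Function

/-! ### Models of weight `k` as chains of gaps -/

/-- The list of all occurrences of atoms in a formula. -/
def CNF.atomList (F : CNF) : List Atom := F.flatMap fun c => c.map Literal.atom

theorem CNF.mem_atomList {F : CNF} {a : Atom} : a ∈ F.atomList ↔ a ∈ F.atoms :=
  List.mem_toFinset.symm

theorem exists_gap {s : ℕ → ℕ} {x : ℕ} (h0 : s 0 ≤ x) {k : ℕ} (hk : x < s (k + 1)) :
    ∃ i ≤ k, s i ≤ x ∧ x < s (i + 1) := by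
  induction k with
  | zero => exact ⟨0, le_rfl, h0, hk⟩
  | succ k ih =>
    by_cases h : x < s (k + 1)
    · obtain ⟨i, hi, h⟩ := ih h
      exact ⟨i, by omega, h⟩
    · exact ⟨k + 1, le_rfl, by omega, hk⟩

theorem IsChain.exists_model {F : CNF} {k : ℕ} {s : ℕ → ℕ} (h : IsChain F.atomList F k s) :
    ∃ A, F.IsModel A ∧ A.card = k := by
  set A := F.atoms.filter fun p => ∃ i < k, s (i + 1) = LPComplexity.position F.atomList p with hA
  have hmem : ∀ p, p ∈ A ↔ p ∈ F.atoms ∧ ∃ i < k, s (i + 1) = LPComplexity.position F.atomList p :=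
    fun p => by rw [hA, Finset.mem_filter]
  refine ⟨A, ⟨Finset.filter_subset _ _, fun c hc => ?_⟩, ?_⟩
  · obtain ⟨l, hl, i, hi, hli⟩ := h.clause c hc
    have hlF : l.atom ∈ F.atoms := CNF.mem_atoms.2 ⟨c, hc, l, hl, rfl⟩
    refine ⟨l, hl, ?_⟩
    cases hp : l.positive with
    | true =>
      simp only [hp, if_true, Literal.Holds] at hli ⊢
      refine (hmem _).2 ⟨hlF, i, lt_of_le_of_ne hi ?_, hli⟩
      rintro rfl
      have := position_le F.atomList l.atom
      have := h.last
      omega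
    | false =>
      simp only [hp, Bool.false_eq_true, if_false, Literal.Holds] at hli ⊢
      intro hmemA
      obtain ⟨-, j, -, hj⟩ := (hmem _).1 hmemA
      rw [← hj, h.strictMono.lt_iff_lt, h.strictMono.lt_iff_lt] at hli
      omega
  · have hinj : Set.InjOn (LPComplexity.position F.atomList) A := fun p hp q hq e =>
      position_inj (CNF.mem_atomList.2 ((hmem p).1 hp).1) (CNF.mem_atomList.2 ((hmem q).1 hq).1) e
    have himg : A.image (LPComplexity.position F.atomList) =
        (Finset.range k).image fun i => s (i + 1) := by
      ext x
      simp only [Finset.mem_image, Finset.mem_range, hmem]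
      constructor
      · rintro ⟨p, ⟨-, i, hi, e⟩, rfl⟩
        exact ⟨i, hi, e⟩
      · rintro ⟨i, hi, rfl⟩
        obtain ⟨p, hp, e⟩ := h.position i hi
        exact ⟨p, ⟨CNF.mem_atomList.1 hp, i, hi, e.symm⟩, e⟩
    rw [← Finset.card_image_of_injOn hinj, himg, Finset.card_image_of_injective _
      fun i j e => Nat.succ_injective (h.strictMono.injective e), Finset.card_range]

theorem CNF.IsModel.exists_isChain {F : CNF} {A : Finset Atom} (h : F.IsModel A) :
    ∃ s, IsChain F.atomList F A.card s := by
  set L := F.atomList with hL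
  have hAL : ∀ p ∈ A, p ∈ L := fun p hp => CNF.mem_atomList.2 (h.1 hp)
  set B := A.image (LPComplexity.position L) with hB
  have hBcard : B.card = A.card := Finset.card_image_of_injOn fun p hp q hq e =>
    position_inj (hAL p hp) (hAL q hq) e
  have hBpos : ∀ x ∈ B, 0 < x ∧ x ≤ L.length := by
    intro x hx
    obtain ⟨p, hp, rfl⟩ := Finset.mem_image.1 hx
    exact ⟨position_pos (hAL p hp), position_le L p⟩
  -- All numbers from `L.length + 1` on are included to make the sequence infinite.
  let C : ℕ → Prop := fun x => x = 0 ∨ x ∈ B ∨ L.length + 1 ≤ x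
  classical
  have hinf : {x | C x}.Infinite := Set.infinite_of_not_bddAbove fun ⟨b, hb⟩ => by
    have := hb (show C (L.length + 1 + (b + 1)) from .inr (.inr (by omega)))
    omega
  have hmono : StrictMono (Nat.nth C) := Nat.nth_strictMono hinf
  have hCs : ∀ i, C (Nat.nth C i) := Nat.nth_mem_of_infinite hinf
  have h0 : Nat.nth C 0 = 0 := Nat.nth_zero_of_zero (.inl rfl)
  have hcount : Nat.count C (L.length + 1) = A.card + 1 := by
    have : (Finset.range (L.length + 1)).filter C = insert 0 B := by
      ext x
      simp only [Finset.mem_filter, Finset.mem_range, Finset.mem_insert, C]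
      constructor
      · rintro ⟨h1, h2 | h2 | h2⟩
        · exact .inl h2
        · exact .inr h2
        · omega
      · rintro (rfl | hx)
        · exact ⟨by omega, .inl rfl⟩
        · exact ⟨by have := (hBpos x hx).2; omega, .inr (.inl hx)⟩
    rw [Nat.count_eq_card_filter_range, this, Finset.card_insert_of_notMem, hBcard]
    exact fun h => (hBpos 0 h).1.false
  have hlast : Nat.nth C (A.card + 1) = L.length + 1 := by
    rw [← hcount]
    exact Nat.nth_count (.inr (.inr le_rfl))
  have hpos : ∀ p ∈ L, ∃ i ≤ A.card, Nat.nth C i < LPComplexity.position L p ∧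
      LPComplexity.position L p ≤ Nat.nth C (i + 1) ∧
        (LPComplexity.position L p = Nat.nth C (i + 1) ↔ p ∈ A) := by
    intro p hp
    have hp0 := position_pos hp
    obtain ⟨i, hi, h1, h2⟩ := exists_gap (s := Nat.nth C) (x := LPComplexity.position L p - 1)
      (k := A.card) (by omega) (by have := position_le L p; omega)
    refine ⟨i, hi, by omega, by omega, fun e => ?_, fun hpA => ?_⟩
    · have := hCs (i + 1)
      rw [← e] at this
      rcases this with h | h | h
      · omega
      · obtain ⟨q, hq, e⟩ := Finset.mem_image.1 h
        exact position_inj (hAL q hq) hp e ▸ hq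
      · have := position_le L p
        omega
    · have hcp : C (LPComplexity.position L p) := .inr (.inl (Finset.mem_image_of_mem _ hpA))
      have hj := Nat.nth_count hcp
      have h3 : Nat.nth C i < Nat.nth C (Nat.count C (LPComplexity.position L p)) := by omega
      rw [hmono.lt_iff_lt] at h3
      have := hmono.monotone (Nat.succ_le_of_lt h3)
      simp only [Nat.succ_eq_add_one] at this
      omega
  refine ⟨Nat.nth C, hmono, h0, hlast, fun i hi => ?_, fun c hc => ?_⟩
  · have h1 := hmono (Nat.succ_pos i)
    have h2 := hmono (Nat.succ_lt_succ hi)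
    rcases hCs (i + 1) with h | h | h
    · simp only [Nat.succ_eq_add_one] at h1; omega
    · obtain ⟨p, hp, e⟩ := Finset.mem_image.1 h
      exact ⟨p, hAL p hp, e⟩
    · simp only [Nat.succ_eq_add_one] at h2; omega
  · obtain ⟨l, hl, hlA⟩ := h.2 c hc
    obtain ⟨i, hi, h1, h2, h3⟩ := hpos l.atom
      (CNF.mem_atomList.2 (CNF.mem_atoms.2 ⟨c, hc, l, hl, rfl⟩))
    refine ⟨l, hl, i, hi, ?_⟩
    cases hp : l.positive with
    | true =>
      simp only [hp, if_true, Literal.Holds] at hlA ⊢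
      exact (h3.2 hlA).symm
    | false =>
      simp only [hp, Bool.false_eq_true, if_false, Literal.Holds] at hlA ⊢
      exact ⟨h1, lt_of_le_of_ne h2 fun e => hlA (h3.1 e)⟩

/-! ### The eight problems are hard for W[2] -/

/-- The purely negative program that has a supported model if and only if `F` has a model with `k`
atoms. -/
def weightProgram (F : CNF) (k : ℕ) : Program :=
  choiceProgram (gaps F.atomList k) (gapConstraints F.atomList F k)

/-- All supported models have the same number of atoms, one for each gap; therefore the program
serves for bounds on the size as well as for exact sizes. -/
theorem card_of_isSupportedModel_weightProgram {F : CNF} {k : ℕ} {M : Finset Atom}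
    (h : (weightProgram F k).IsSupportedModel M) : M.card = k + 1 := by
  obtain ⟨s, -, rfl⟩ := isSupportedModel_gap_iff.1 h
  rw [Finset.card_image_of_injective _ fun i j e => (Prod.mk.inj (gapAtom_inj.1 e)).1,
    Finset.card_range]

theorem exists_isSupportedModel_weightProgram_iff {F : CNF} {k : ℕ} :
    (∃ M, (weightProgram F k).IsSupportedModel M) ↔ ∃ A, F.IsModel A ∧ A.card = k := by
  simp only [weightProgram, isSupportedModel_gap_iff]
  constructor
  · rintro ⟨-, s, hs, -⟩
    exact hs.exists_model
  · rintro ⟨A, hA, rfl⟩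
    obtain ⟨s, hs⟩ := hA.exists_isChain
    exact ⟨_, s, hs, rfl⟩

namespace Poly

variable {α : Type} [TreeCode α]

@[fun_prop]
theorem position {f : α → List Atom} {g : α → Atom} (hf : Poly f) (hg : Poly g) :
    Poly (fun a => position (f a) (g a)) := by
  unfold LPComplexity.position
  refine foldr_of_add (f := fun a b n => bif decide (b = g a) then 1 else n + 1) (by fun_prop) hf
    (const 0) 2 fun a b n => ?_
  cases decide (b = g a)
  · simp only [cond_false, size_nat]
    omega
  · simp only [cond_true, size_nat]
    omega

@[fun_prop]
theorem gaps {f : α → List Atom} {g : α → ℕ} (hf : Poly f) (hg : Poly g) :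
    Poly (fun a => gaps (f a) (g a)) := by
  unfold LPComplexity.gaps
  fun_prop

@[fun_prop]
theorem gapConstraints {f : α → List Atom} {F : α → CNF} {g : α → ℕ} (hf : Poly f) (hF : Poly F)
    (hg : Poly g) : Poly (fun a => gapConstraints (f a) (F a) (g a)) := by
  unfold LPComplexity.gapConstraints
  fun_prop

@[fun_prop]
theorem choiceProgram {f : α → List Gap} {g : α → List (List Gap)} (hf : Poly f) (hg : Poly g) :
    Poly (fun a => choiceProgram (f a) (g a)) := by
  unfold LPComplexity.choiceProgram gapAtom
  fun_prop

@[fun_prop]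
theorem weightProgram {F : α → CNF} {g : α → ℕ} (hF : Poly F) (hg : Poly g) :
    Poly (fun a => weightProgram (F a) (g a)) := by
  unfold LPComplexity.weightProgram CNF.atomList
  fun_prop

end Poly

/-- A problem on programs is hard for W[2] as soon as its instances include the purely negative
programs, for which its models are the supported models. -/
theorem reduces_WS2_modelProblem {D : Program → Finset Atom → Prop} {Δ : ℕ → ℕ → Prop}
    {C : Set Program} (hD : ∀ P ∈ negativePrograms, ∀ M, D P M ↔ P.IsSupportedModel M)
    (hΔ : ∀ k, Δ k k) (hC : negativePrograms ⊆ C) : Reduces WS2 (modelProblem D Δ C) := by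
  have hneg : ∀ F k, weightProgram F k ∈ negativePrograms := fun F k => choiceProgram_negative _ _
  have key : ∀ (F : CNF) (k : ℕ),
      (∃ M, D (weightProgram F k) M) ↔ ∃ A, F.IsModel A ∧ A.card = k := fun F k => by
    simp only [hD _ (hneg F k), exists_isSupportedModel_weightProgram_iff]
  -- The models have one atom for each of the `k + 1` gaps; `[.one]` encodes no program and
  -- `[.zero]` encodes no number.
  refine reduces_of_poly
    (F := fun w => bif decide ((parseCNF w.1).encode = w.1) then
      (weightProgram (parseCNF w.1) w.2.length).encode else [.one])
    (G := fun y => bif isUnary y then y ++ [.one] else [.zero]) ?_ (by fun_prop) fun x y => ?_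
  · have h1 : Poly fun w : Word × Word => parseCNF w.1 := Poly.parseCNF.comp Poly.fst
    fun_prop
  · constructor
    · rintro ⟨F, k, hw, hA⟩
      obtain ⟨rfl, rfl⟩ := Prod.mk.inj hw
      obtain ⟨M, hM⟩ := (key F k).2 hA
      refine ⟨weightProgram F k, k + 1, hC (hneg F k), ?_, M, hM, ?_⟩
      · simp only [parseCNF_encode, isUnary_encodeNat, length_encodeNat, decide_true, cond_true,
          Prod.mk.injEq, true_and]
        rw [encodeNat, encodeNat, List.replicate_succ']
      · rw [card_of_isSupportedModel_weightProgram ((hD _ (hneg F k) M).1 hM)]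
        exact hΔ _
    · rintro ⟨P, k', -, hw, M, hM, -⟩
      obtain ⟨hF, hG⟩ := Prod.mk.inj hw
      cases hc : decide ((parseCNF x).encode = x) with
      | false => exact absurd hF (by simpa only [hc, cond_false] using P.encode_ne_one)
      | true =>
      cases hy : isUnary y with
      | false => exact absurd hG (by simpa only [hy, cond_false] using zero_ne_encodeNat k')
      | true =>
      simp only [hc, cond_true] at hF
      obtain rfl := Function.LeftInverse.injective parseProgram_encode hF
      refine ⟨parseCNF x, y.length, ?_, (key _ _).1 ⟨M, hM⟩⟩
      rw [of_decide_eq_true hc, ← isUnary_iff.1 hy]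

theorem isCompleteFor_W2 {D : Program → Finset Atom → Prop} {Δ : ℕ → ℕ → Prop}
    {C : Set Program} (hmem : modelProblem D Δ C ∈ W2)
    (hD : ∀ P ∈ negativePrograms, ∀ M, D P M ↔ P.IsSupportedModel M)
    (hΔ : ∀ k, Δ k k) (hC : negativePrograms ⊆ C) : IsCompleteFor (modelProblem D Δ C) W2 :=
  ⟨hmem, fun _ h => Reduces.trans h (reduces_WS2_modelProblem hD hΔ hC)⟩

theorem stable_isCompleteFor_W2 {Δ : ℕ → ℕ → Prop} {C : Set Program} (hmem : ST Δ C ∈ W2)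
    (hΔ : ∀ k, Δ k k) (hC : negativePrograms ⊆ C) : IsCompleteFor (ST Δ C) W2 :=
  isCompleteFor_W2 hmem (fun _ hP _ => Program.isStableModel_iff_of_negative hP) hΔ hC

theorem supported_isCompleteFor_W2 {Δ : ℕ → ℕ → Prop} {C : Set Program} (hmem : SP Δ C ∈ W2)
    (hΔ : ∀ k, Δ k k) (hC : negativePrograms ⊆ C) : IsCompleteFor (SP Δ C) W2 :=
  isCompleteFor_W2 hmem (fun _ _ _ => Iff.rfl) hΔ hC

theorem mem_allPrograms_iff (P : Program) : P ∈ allPrograms ↔ true = true := by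
  simp [allPrograms]

end LPComplexity

theorem mainTheorem1 :
    LPComplexity.IsCompleteFor
      (LPComplexity.ST (· ≤ ·) LPComplexity.negativePrograms) LPComplexity.W2 ∧
    LPComplexity.IsCompleteFor
      (LPComplexity.SP (· ≤ ·) LPComplexity.negativePrograms) LPComplexity.W2 ∧
    LPComplexity.IsCompleteFor
      (LPComplexity.ST (· ≤ ·) LPComplexity.allPrograms) LPComplexity.W2 ∧
    LPComplexity.IsCompleteFor
      (LPComplexity.SP (· ≤ ·) LPComplexity.allPrograms) LPComplexity.W2 ∧
    LPComplexity.IsCompleteFor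
      (LPComplexity.ST (· = ·) LPComplexity.negativePrograms) LPComplexity.W2 ∧
    LPComplexity.IsCompleteFor
      (LPComplexity.SP (· = ·) LPComplexity.negativePrograms) LPComplexity.W2 ∧
    LPComplexity.IsCompleteFor
      (LPComplexity.ST (· = ·) LPComplexity.allPrograms) LPComplexity.W2 ∧
    LPComplexity.IsCompleteFor
      (LPComplexity.SP (· = ·) LPComplexity.allPrograms) LPComplexity.W2 := by
  open LPComplexity in
  have hn := mem_negativePrograms_iff
  have ha := mem_allPrograms_iff
  have ht := LPComplexity.Poly.isNegative
  have hc : LPComplexity.Poly fun _ : Program => true := LPComplexity.Poly.const true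
  have hall : negativePrograms ⊆ allPrograms := Set.subset_univ _
  exact ⟨stable_isCompleteFor_W2 (stable_mem_W2 le_iff_le_and hn ht) le_refl subset_rfl,
    supported_isCompleteFor_W2 (supported_mem_W2 le_iff_le_and hn ht) le_refl subset_rfl,
    stable_isCompleteFor_W2 (stable_mem_W2 le_iff_le_and ha hc) le_refl hall,
    supported_isCompleteFor_W2 (supported_mem_W2 le_iff_le_and ha hc) le_refl hall,
    stable_isCompleteFor_W2 (stable_mem_W2 eq_iff_le_and hn ht) (fun _ => rfl) subset_rfl,
    supported_isCompleteFor_W2 (supported_mem_W2 eq_iff_le_and hn ht) (fun _ => rfl) subset_rfl,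
    stable_isCompleteFor_W2 (stable_mem_W2 eq_iff_le_and ha hc) (fun _ => rfl) hall,
    supported_isCompleteFor_W2 (supported_mem_W2 eq_iff_le_and ha hc) (fun _ => rfl) hall⟩
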